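/- **Setting.** Let $d_x,d_u\ge 1$, $T\ge 2$. An oblivious (possibly randomized) adversary picks, independently of the learner's coins, $A_t\in\mathbb R^{d_x\times d_x}$, $B_t\in\mathbb R^{d_x\times d_u}$, $w_t\in\mathbb R^{d_x}$ and costs $c_t:\mathbb R^{d_x}\times\mathbb R^{d_u}\to\mathbb R$. The state evolves by $x_1=0$, $x_{t+1}=A_tx_t+B_tu_t+w_t$. Let $x^{\rm nat}_t$ be the states under $u\equiv 0$ (with $x^{\rm nat}_j=0$ for $j\le 0$), and let $G_t^{[i]}=A_tA_{t-1}\cdots A_{t-i+1}B_{t-i}$ for $0\le i<t$ and $G_t^{[i]}=0$ for $i\ge t$. Assume that almost surely, for all $t\in[T]$: (i) $\|x^{\rm nat}_t\|\le R_{\rm nat}$; (ii) $\sum_{i\ge n}\|G_t^{[i]}\|_{\rm op}\le R_G\rho^n$ for all $n\ge 0$; (iii) $c_t$ is convex, $0\le c_t(x,u)\le L\max\{1,\|x\|^2+\|u\|^2\}$, and every subgradient of $c_t$ at $(x,u)$ has norm at most $L\max\{1,\|x\|+\|u\|\}$. Here $R_{\rm nat},L>0$, $R_G\ge1$, $\rho\in(0,1)$.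 For $I=[r,s]\subseteq[T]$ put $\mathrm{Var}_I(\mathbf G)=|I|^{-1}\sum_{t\in I}\sum_i\|G_I^{[i]}-G_t^{[i]}\|_F^2$, where $G_I$ is the average of $G_t$ over $t\in I$. For $R_M>0$ and an integer $1\le m\le\sqrt T$ let $\mathcal M=\{(M^{[0]},\dots,M^{[m-1]})\in(\mathbb R^{d_u\times d_x})^m:\sum_i\|M^{[i]}\|_{\rm op}\le R_M\}$, and let $\Pi_{\rm drc}(m,R_M)$ be the class of policies $u^M_t=\sum_{i<m}M^{[i]}x^{\rm nat}_{t-i}$, $M\in\mathcal M$, with states $x_t^M$. Set $$\mathrm{Regret}_I=\sum_{t\in I}c_t(x_t,u_t)-\inf_{M\in\mathcal M}\sum_{t\in I}c_t(x^M_t,u^M_t).$$ **Algorithm (Ada-Ctrl).** Let $h=\lceil \log T/\log\rho^{-1}\rceil$, $p=T^{-1/3}$, $d_{\min}=\min\{d_x,d_u\}$, $R_{\rm sys}=R_GR_MR_{\rm nat}$, $\eta=\frac{\sqrt{d_{\min}}R_M^2}{2LR_{\rm sys}^2(h+1)^{5/4}\sqrt T}$, $\mathcal G=\{(G^{[i]})_{i<h}:\sum_i\|G^{[i]}\|_{\rm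 op}\le R_G\}$, and $\alpha=p/(R_z+\tilde R_z)^2$ with $R_z=\sqrt{h d_{\min}}R_G$ and $\tilde R_z=\sqrt{hd_u}\,(R_{\rm nat}+R_G\max\{\sqrt{d_u},R_{\rm nat}R_M\})$. All projections are Euclidean (Frobenius). Time is divided into epochs of length $h$, epoch $\tau$ being $\{(\tau-1)h+1,\dots,\tau h\}$ (the last one may be cut off at $T$). *Control.* In epoch $\tau$ the algorithm fixes the estimate $\hat G_t=\hat G_{[\tau]}\in\mathcal G$ of Ada-Pred and draws $b_\tau\sim\mathrm{Bernoulli}(p)$. In round $t$ of the epoch, if $b_\tau=1$ it plays $u_t$ uniform in $\{\pm1\}^{d_u}$; otherwise it plays $u_t=\hat u_t(M_t)$, where $\hat u_t(M)=\sum_{j<m}M^{[j]}\hat x^{\rm nat}_{t-j}$. In both cases it then sets $\hat x^{\rm nat}_{t+1}=\mathrm{Proj}_{\{\|x\|\le R_{\rm nat}\}}\big(x_{t+1}-\sum_{i<h}\hat G_t^{[i]}u_{t-i}\big)$ and $M_{t+1}=\mathrm{Proj}_{\mathcal M}(M_t-\eta\nabla_t)$, with $\nabla_t$ any subgradient at $M_t$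 of $$M\mapsto c_t\Big(\hat x^{\rm nat}_t+\sum_{i<h}\hat G_{t-1}^{[i]}\hat u_{t-1-i}(M),\ \hat u_t(M)\Big).$$ Here $M_1\in\mathcal M$ is arbitrary, $\hat x^{\rm nat}_1=0$, and inputs and Nature's x's at times $\le0$ are zero. At the end of an epoch with $b_\tau=1$, Ada-Pred receives $\tilde G_{[\tau]}^{[i]}=x_{\tau h+1}u_{\tau h-i}^\top$, $0\le i<h$. All coins are independent. *Ada-Pred.* Let $\mathcal S_\tau$ be the set of $i=r2^k\le\tau$ ($r$ odd) with $\tau\le i+2^{k+2}+1$. Instance $i$ starts in round $i$ at an arbitrary point $\hat z^{(i)}_i\in\mathcal G$, and $q^{(1)}_1=1$. The played iterate is $\hat G_{[\tau]}=\sum_{i\in\mathcal S_\tau}q^{(i)}_\tau\hat z^{(i)}_\tau$. Let $\tilde\ell_\tau(z)=\frac{b_\tau}{2p}\|z-\tilde G_{[\tau]}\|_F^2$. For $i\in\mathcal S_\tau$, $$\hat z^{(i)}_{\tau+1}=\mathrm{Proj}_{\mathcal G}\big(\hat z^{(i)}_\tau-\tfrac1{\tau-i+1}\nabla\tilde\ell_\tau(\hat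 z^{(i)}_\tau)\big),\qquad \bar q^{(i)}_{\tau+1}=\tfrac{\tau}{\tau+1}\,\frac{q^{(i)}_\tau e^{-\alpha\tilde\ell_\tau(\hat z^{(i)}_\tau)}}{\sum_{j\in\mathcal S_\tau}q^{(j)}_\tau e^{-\alpha\tilde\ell_\tau(\hat z^{(j)}_\tau)}},$$ $\bar q^{(\tau+1)}_{\tau+1}=\frac1{\tau+1}$, and $q_{\tau+1}$ is $\bar q_{\tau+1}$ normalized over $\mathcal S_{\tau+1}$. **Theorem.** There are absolute constants $C>0$ and $k\in\mathbb N$ such that in every such setting, for every interval $I=[r,s]\subseteq[T]$, $$\mathbb E[\mathrm{Regret}_I]\le C\,(1+R_{\rm nat}+R_G+R_M)^k\Big(1+\log T+\frac{\log T}{\log\rho^{-1}}\Big)^k\,Lm\Big(|I|\sqrt{\mathbb E[\mathrm{Var}_I(\mathbf G)]}+d_uT^{2/3}\Big).$$ The expectations are over the coins of the algorithm and the adversary. -/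

import Mathlib

open Finset MeasureTheory

noncomputable section

/-! ### Vectors, operator sequences, norms and projections -/

/-- `ℝⁿ` with the Euclidean norm. -/
abbrev Vec (n : ℕ) := EuclideanSpace ℝ (Fin n)

/-- Sequences `(G^[0], …, G^[k-1])` of `a × b` matrices, fully vectorised: the norm of this
Euclidean space is the `ℓ₂`-Frobenius norm. -/
abbrev OpSeq (k a b : ℕ) := EuclideanSpace ℝ (Fin k × Fin a × Fin b)

/-- The block `G^[i]`, with the convention `G^[i] = 0` for `i ≥ k`. -/
def block {k a b : ℕ} (G : OpSeq k a b) (i : ℕ) : Matrix (Fin a) (Fin b) ℝ :=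
  if hi : i < k then Matrix.of fun r c => G (⟨i, hi⟩, r, c) else 0

/-- The matrix-vector product, between Euclidean spaces. -/
def app {a b : ℕ} (A : Matrix (Fin a) (Fin b) ℝ) (v : Vec b) : Vec a :=
  Matrix.toEuclideanLin A v

section
open scoped Matrix.Norms.L2Operator

/-- The operator norm of a matrix with respect to the Euclidean norms. -/
def opNorm {a b : ℕ} (A : Matrix (Fin a) (Fin b) ℝ) : ℝ := ‖A‖

end

/-- The ball `{G : ∑_{i<k} ‖G^[i]‖_op ≤ R}`. It is `𝒢(h, R_G)` for `(k, a, b) = (h, d_x, d_u)`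
and `ℳ(m, R_M)` for `(k, a, b) = (m, d_u, d_x)`. -/
def opBall (k a b : ℕ) (R : ℝ) : Set (OpSeq k a b) :=
  {G | ∑ i ∈ range k, opNorm (block G i) ≤ R}

/-- Euclidean projection: the point of `K` nearest to `v`
(unique when `K` is nonempty, closed and convex). -/
def proj {V : Type*} [NormedAddCommGroup V] (K : Set V) (v : V) : V :=
  Classical.epsilon fun y => y ∈ K ∧ ∀ z ∈ K, ‖v - y‖ ≤ ‖v - z‖

/-- `g` is a subgradient of `f` at `v`. -/
def IsSubgradient {V : Type*} [NormedAddCommGroup V] [InnerProductSpace ℝ V]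
    (f : V → ℝ) (v g : V) : Prop :=
  ∀ v', f v + inner ℝ g (v' - v) ≤ f v'

/-! ### Linear time-varying systems -/

/-- Nature's choices: system matrices, disturbances and cost functions.
Time starts at `1`; entries at index `0` are never used. -/
structure LTV (dx du : ℕ) where
  A : ℕ → Matrix (Fin dx) (Fin dx) ℝ
  B : ℕ → Matrix (Fin dx) (Fin du) ℝ
  w : ℕ → Vec dx
  c : ℕ → Vec dx → Vec du → ℝ

namespace LTV

variable {dx du : ℕ}

/-- The states `x_t` under the inputs `u`: `x_1 = 0`, `x_{t+1} = A_t x_t + B_t u_t + w_t`. -/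
def state (S : LTV dx du) (u : ℕ → Vec du) : ℕ → Vec dx
  | 0 => 0
  | t + 1 => if t = 0 then 0 else app (S.A t) (S.state u t) + app (S.B t) (u t) + S.w t

/-- Nature's x's: the states under zero input. -/
def xnat (S : LTV dx du) : ℕ → Vec dx := S.state fun _ => 0

/-- `Φ_t^[i] = A_t A_{t-1} ⋯ A_{t-i+1}`. -/
def Phi (S : LTV dx du) (t : ℕ) : ℕ → Matrix (Fin dx) (Fin dx) ℝ
  | 0 => 1
  | i + 1 => S.Phi t i * S.A (t - i)

/-- The Markov operator `G_t^[i] = Φ_t^[i] B_{t-i}` for `0 ≤ i < t`, padded by zero. -/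
def markov (S : LTV dx du) (t i : ℕ) : Matrix (Fin dx) (Fin du) ℝ :=
  if i < t then S.Phi t i * S.B (t - i) else 0

/-- The system variability `Var_I(G) = |I|⁻¹ ∑_{t ∈ I} ‖G_I - G_t‖²_{ℓ₂,F}` over `I = [r, s]`, where
`G_I` is the average of `G_t` over `I`. All blocks `G_t^[i]` with `i ≥ s` vanish for `t ∈ I`. -/
def variability (S : LTV dx du) (r s : ℕ) : ℝ :=
  (#(Icc r s) : ℝ)⁻¹ * ∑ t ∈ Icc r s, ∑ i ∈ range s, ∑ a, ∑ b,
    ((#(Icc r s) : ℝ)⁻¹ * (∑ t' ∈ Icc r s, S.markov t' i a b) - S.markov t i a b) ^ 2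

/-- The standing assumptions: bounded Nature's x's, geometric decay of the Markov operators, and
convex costs of at most quadratic growth whose subgradients grow at most linearly. -/
structure Admissible (S : LTV dx du) (T : ℕ) (L Rnat RG ρ : ℝ) : Prop where
  xnat_le : ∀ t ∈ Icc 1 T, ‖S.xnat t‖ ≤ Rnat
  decay : ∀ n, ∀ t ∈ Icc 1 T, ∑ i ∈ Ico n t, opNorm (S.markov t i) ≤ RG * ρ ^ n
  cost_convex : ∀ t ∈ Icc 1 T,
    ConvexOn ℝ Set.univ fun z : WithLp 2 (Vec dx × Vec du) => S.c t z.fst z.snd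
  cost_nonneg : ∀ t ∈ Icc 1 T, ∀ x u, 0 ≤ S.c t x u
  cost_le : ∀ t ∈ Icc 1 T, ∀ x u, S.c t x u ≤ L * max 1 (‖x‖ ^ 2 + ‖u‖ ^ 2)
  subgradient_le : ∀ t ∈ Icc 1 T, ∀ z g : WithLp 2 (Vec dx × Vec du),
    IsSubgradient (fun z => S.c t z.fst z.snd) z g → ‖g‖ ≤ L * max 1 (‖z.fst‖ + ‖z.snd‖)

/-- The input at time `t` that the DRC parameter `M` computes from the sequence `y` of (true or
estimated) Nature's x's: `∑_{i<m} M^[i] y_{t-i}`, where `y_j = 0` for `j ≤ 0`. -/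
def drcInput {m : ℕ} (M : OpSeq m du dx) (y : ℕ → Vec dx) (t : ℕ) : Vec du :=
  ∑ i ∈ range m, if i < t then app (block M i) (y (t - i)) else 0

/-- Cumulative cost over `[r, s]` of the DRC policy with parameter `M`. -/
def drcCost {m : ℕ} (S : LTV dx du) (M : OpSeq m du dx) (r s : ℕ) : ℝ :=
  ∑ t ∈ Icc r s, S.c t (S.state (drcInput M S.xnat) t) (drcInput M S.xnat t)

end LTV

/-! ### Ada-Pred: adaptive estimation of a vector sequence -/

/-- The working set `𝒮_τ`: writing `i = r 2^k` with `r` odd, `i ∈ 𝒮_τ` iff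
`τ ∈ [i, i + 2^(k+2) + 1]`. -/
def workingSet (τ : ℕ) : Finset ℕ :=
  {i ∈ Icc 1 τ | τ ≤ i + (2 ^ (padicValNat 2 i + 2) + 1)}

/-- Iterates and weights of the instances; instance `i` is started in round `i`. -/
structure PredState (V : Type*) where
  z : ℕ → V
  q : ℕ → ℝ

namespace PredState

variable {V : Type*} [NormedAddCommGroup V] [InnerProductSpace ℝ V]

/-- Before round `1`: instance `i` is going to start at `z0 i`; only instance `1` has weight. -/
def init (z0 : ℕ → V) : PredState V := ⟨z0, fun i => if i = 1 then 1 else 0⟩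

/-- The iterate that is played in round `τ`. -/
def play (P : PredState V) (τ : ℕ) : V := ∑ i ∈ workingSet τ, P.q i • P.z i

/-- The importance weighted loss `(2p)⁻¹ ‖z - z̃‖²` if a query was made, and `0` otherwise. -/
def loss (p : ℝ) (queried : Bool) (zt z : V) : ℝ :=
  if queried then 1 / (2 * p) * ‖z - zt‖ ^ 2 else 0

/-- The gradient of that loss. -/
def grad (p : ℝ) (queried : Bool) (zt z : V) : V :=
  if queried then (1 / p) • (z - zt) else 0

/-- The weights of round `τ + 1` before pruning and normalisation. -/
def proxyWeight (p α : ℝ) (P : PredState V) (τ : ℕ) (queried : Bool) (zt : V) (i : ℕ) : ℝ :=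
  if i = τ + 1 then 1 / (τ + 1)
  else (τ : ℝ) / (τ + 1) * ((P.q i * Real.exp (-α * loss p queried zt (P.z i))) /
    ∑ j ∈ workingSet τ, P.q j * Real.exp (-α * loss p queried zt (P.z j)))

/-- The transition from round `τ` to round `τ + 1`: a projected gradient step with stepsize
`1 / (τ - i + 1)` in every active instance, then the update of the weights. -/
def step (p α : ℝ) (K : Set V) (P : PredState V) (τ : ℕ) (queried : Bool) (zt : V) :
    PredState V where
  z i := if i ∈ workingSet τ then
      proj K (P.z i - (1 / ((τ : ℝ) - i + 1)) • grad p queried zt (P.z i))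
    else P.z i
  q i := if i ∈ workingSet (τ + 1) then
      P.proxyWeight p α τ queried zt i /
        ∑ j ∈ workingSet (τ + 1), P.proxyWeight p α τ queried zt j
    else 0

end PredState

/-! ### Ada-Ctrl -/

/-- Numerical inputs and arbitrary choices of Ada-Ctrl: epoch length `h`, exploration
probability `p`, weight parameter `α`, stepsize `η`, radii, the initial DRC parameter `M1`, the
initial points `z0` of the estimation instances, and the rule `sg` that selects
subgradients (at time `t`, for the function `f`, at the point `M`). -/
structure AdaCtrl (dx du m : ℕ) where
  h : ℕ
  p : ℝ
  α : ℝ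
  η : ℝ
  Rnat : ℝ
  RG : ℝ
  RM : ℝ
  M1 : OpSeq m du dx
  z0 : ℕ → OpSeq h dx du
  sg : ℕ → (OpSeq m du dx → ℝ) → OpSeq m du dx → OpSeq m du dx

namespace AdaCtrl

variable {dx du m : ℕ}

/-- Data after round `t`: states `x_1, …, x_{t+1}`, inputs `u_1, …, u_t`, estimated Nature's x's
`x̂ⁿᵃᵗ_1, …, x̂ⁿᵃᵗ_{t+1}`, the operator estimate `Ĝ_t`, the DRC parameter `M_{t+1}`, and the state
of Ada-Pred. -/
structure Data (dx du m h : ℕ) where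
  x : ℕ → Vec dx
  u : ℕ → Vec du
  y : ℕ → Vec dx
  Ghat : OpSeq h dx du
  M : OpSeq m du dx
  pred : PredState (OpSeq h dx du)

/-- Before round `1`; here `x_1 = x̂ⁿᵃᵗ_1 = 0`. -/
def init (a : AdaCtrl dx du m) : Data dx du m a.h where
  x := fun _ => 0
  u := fun _ => 0
  y := fun _ => 0
  Ghat := 0
  M := a.M1
  pred := PredState.init a.z0

/-- The proxy loss `f̃_t(M) = c_t(x̂_t(M), û_t(M))` of DRC-OGD at time `t`, where
`û_s(M) = ∑_{j<m} M^[j] x̂ⁿᵃᵗ_{s-j}` and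
`x̂_t(M) = x̂ⁿᵃᵗ_t + ∑_{i<h} Ĝ_{t-1}^[i] û_{t-1-i}(M)`; here `D` holds the data after round
`t - 1`, and inputs at times `≤ 0` are `0`. -/
def proxyLoss {h : ℕ} (S : LTV dx du) (t : ℕ) (D : Data dx du m h) (M : OpSeq m du dx) : ℝ :=
  S.c t
    (D.y t + ∑ i ∈ range h,
      if i < t - 1 then app (block D.Ghat i) (LTV.drcInput M D.y (t - 1 - i)) else 0)
    (LTV.drcInput M D.y t)

/-- A vector of signs. -/
def signs (e : Fin du → Bool) : Vec du := WithLp.toLp 2 fun j => if e j then 1 else -1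

/-- The one-point estimate of the Markov operator at the end of the exploration epoch that ends at
time `t`: `G̃^[i] = x_{t+1} u_{t-i}ᵀ` for `0 ≤ i < h`. -/
def estimate {h : ℕ} (xnext : Vec dx) (u : ℕ → Vec du) (t : ℕ) : OpSeq h dx du :=
  WithLp.toLp 2 fun j => xnext j.2.1 * u (t - j.1) j.2.2

/-- Round `t`, which belongs to epoch `τ = ⌊(t-1)/h⌋ + 1`. The coin `b τ` decides whether the
epoch is used for exploration, and `e t` holds the random signs of round `t`. -/
def step (a : AdaCtrl dx du m) (S : LTV dx du) (b : ℕ → Bool) (e : ℕ → Fin du → Bool)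
    (t : ℕ) (D : Data dx du m a.h) : Data dx du m a.h :=
  let τ := (t - 1) / a.h + 1
  let Ghat := D.pred.play τ
  let u := Function.update D.u t (if b τ then signs (e t) else LTV.drcInput D.M D.y t)
  let xnext := app (S.A t) (D.x t) + app (S.B t) (u t) + S.w t
  let ynext := proj (Metric.closedBall 0 a.Rnat)
    (xnext - ∑ i ∈ range a.h, if i < t then app (block Ghat i) (u (t - i)) else 0)
  { x := Function.update D.x (t + 1) xnext
    u := u
    y := Function.update D.y (t + 1) ynext
    Ghat := Ghat
    M := proj (opBall m du dx a.RM) (D.M - a.η • a.sg t (proxyLoss S t D) D.M)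
    pred := if t = τ * a.h then
        D.pred.step a.p a.α (opBall a.h dx du a.RG) τ (b τ) (estimate xnext u t)
      else D.pred }

/-- The data after `t` rounds. -/
def run (a : AdaCtrl dx du m) (S : LTV dx du) (b : ℕ → Bool) (e : ℕ → Fin du → Bool) :
    ℕ → Data dx du m a.h
  | 0 => a.init
  | t + 1 => a.step S b e (t + 1) (a.run S b e t)

/-- The regret over `I = [r, s] ⊆ [T]` against the DRC class `Π_drc(m, R_M)`, for given coins. -/
def regret (a : AdaCtrl dx du m) (S : LTV dx du) (T r s : ℕ)
    (b : ℕ → Bool) (e : ℕ → Fin du → Bool) : ℝ :=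
  (∑ t ∈ Icc r s, S.c t ((a.run S b e T).x t) ((a.run S b e T).u t)) -
    ⨅ M : opBall m du dx a.RM, S.drcCost (M : OpSeq m du dx) r s

/-- The expectation of the regret over the independent coins of the algorithm: Bernoulli(`p`)
coins `b_1, …, b_T` (one per epoch; there are at most `T` epochs) and uniform signs for the rounds
`1, …, T`. The coins of index `0` are never used. -/
def expRegret (a : AdaCtrl dx du m) (S : LTV dx du) (T r s : ℕ) : ℝ :=
  ∑ b : Fin (T + 1) → Bool, ∑ e : Fin (T + 1) → Fin du → Bool,
    ((∏ τ, if b τ then a.p else 1 - a.p) * ∏ _t : Fin (T + 1), ∏ _j : Fin du, (1 / 2 : ℝ)) *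
      a.regret S T r s (fun τ => b (Fin.ofNat (T + 1) τ)) (fun t => e (Fin.ofNat (T + 1) t))

/-- The epoch length `log T / log ρ⁻¹`, rounded up. -/
def epochLength (T : ℕ) (ρ : ℝ) : ℕ := ⌈Real.log T / Real.log ρ⁻¹⌉₊

/-- The parameters for the horizon `T`: `h = ⌈log T / log ρ⁻¹⌉`, `p = T^(-1/3)`,
`α = p / (R_z + R̃_z)²` with the radius `R_z = √(h d_min) R_G` of `𝒢(h, R_G)` and the bound
`R̃_z = √(h d_u) (R_nat + R_G max{√d_u, R_nat R_M})` on the estimates, and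
`η = √d_min R_M² / (2 L R_sys² (h+1)^(5/4) √T)` with `R_sys = R_G R_M R_nat`,
where `d_min = min{d_x, d_u}`. -/
def tuned (T : ℕ) (L Rnat RG RM ρ : ℝ) (M1 : OpSeq m du dx)
    (z0 : ℕ → OpSeq (epochLength T ρ) dx du)
    (sg : ℕ → (OpSeq m du dx → ℝ) → OpSeq m du dx → OpSeq m du dx) : AdaCtrl dx du m where
  h := epochLength T ρ
  p := (T : ℝ) ^ (-(1 / 3) : ℝ)
  α := (T : ℝ) ^ (-(1 / 3) : ℝ) /
    (√((epochLength T ρ : ℝ) * (min dx du : ℕ)) * RG +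
      √((epochLength T ρ : ℝ) * du) * (Rnat + RG * max (√(du : ℝ)) (Rnat * RM))) ^ 2
  η := √((min dx du : ℕ) : ℝ) * RM ^ 2 /
    (2 * L * (RG * RM * Rnat) ^ 2 * ((epochLength T ρ : ℝ) + 1) ^ (5 / 4 : ℝ) * √(T : ℝ))
  Rnat := Rnat
  RG := RG
  RM := RM
  M1 := M1
  z0 := z0
  sg := sg

end AdaCtrl

end

/-! Fix the environment and the coins. The regret against a parameter `M` splits into three gaps,
with the losses `AdaCtrl.proxy` as intermediary: incurred cost against proxy loss at the current
parameter, regret of projected gradient descent on the proxy losses, and proxy loss at `M` against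
the true cost of `M`. The middle gap is of order √T on every interval, since the stepsize is
constant and the parameter set is bounded. The outer gaps are handled by Lipschitz continuity of the
costs on balls. They consist of the operator error `predErr`, the error `natErr` in the recovered
Nature's x's, the drift of the parameter over `h` rounds, and the memory cut at `h`, which is
negligible because ρ^h ≤ 1/T. Away from exploration `natErr` is itself controlled by `predErr`. The
result is `regret_le`: up to factors, the regret is at most the sum of `predErr`, plus `du` times
the amount of exploration, plus m·du·√T.

In expectation exploration costs du·T·p. For `predErr` the key fact is `coins_est_entry`: given the
past, the one-point estimates are unbiased. Differences of squared distances to a target are affine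
in the target, so regret against the noisy targets equals, in expectation, regret against the true
operators. An interval of epochs is cut into logarithmically many dyadic pieces
(`sum_Icc_le_of_dyadic`). On each piece the instance born at its start has logarithmic regret by
strong convexity, and the weighted average loses only a logarithm over the scale `α` against that
instance, because a Gaussian is concave on a ball whose radius is at most its standard deviation
(`sum_exp_neg_norm_sq_le`). This gives `coins_sum_norm_play_sub_sq_le`.

Taking the average operator over the interval as comparator bounds the expected sum of squared
operator errors by |I|·Var + du²/p up to factors. Young's inequality with weight √Var + du·p turns
this into |I|·√Var + du/p² (`weighted_error_le`), and p = T^(-1/3) makes T·p and 1/p² both equal to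
T^(2/3). Finally the bound is integrated over the environment, with Jensen's inequality for the
square root. -/

noncomputable section

/-! ### Matrices and operator sequences -/

section
open scoped Matrix.Norms.L2Operator

variable {k a b c : ℕ}

lemma app_apply (A : Matrix (Fin a) (Fin b) ℝ) (v : Vec b) (i : Fin a) :
    app A v i = ∑ j, A i j * v j := by
  simp [app, Matrix.toLpLin_apply, Matrix.mulVec, dotProduct]

@[simp] lemma app_add (A : Matrix (Fin a) (Fin b) ℝ) (v w : Vec b) :
    app A (v + w) = app A v + app A w := map_add _ _ _

@[simp] lemma app_sub (A : Matrix (Fin a) (Fin b) ℝ) (v w : Vec b) :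
    app A (v - w) = app A v - app A w := map_sub _ _ _

@[simp] lemma app_zero (A : Matrix (Fin a) (Fin b) ℝ) : app A 0 = 0 := map_zero _

lemma app_smul (A : Matrix (Fin a) (Fin b) ℝ) (x : ℝ) (v : Vec b) :
    app A (x • v) = x • app A v := map_smul _ _ _

lemma app_sum {ι : Type*} (s : Finset ι) (A : Matrix (Fin a) (Fin b) ℝ) (v : ι → Vec b) :
    app A (∑ i ∈ s, v i) = ∑ i ∈ s, app A (v i) := map_sum _ _ _

lemma add_app (A B : Matrix (Fin a) (Fin b) ℝ) (v : Vec b) :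
    app (A + B) v = app A v + app B v := by simp [app]

lemma sub_app (A B : Matrix (Fin a) (Fin b) ℝ) (v : Vec b) :
    app (A - B) v = app A v - app B v := by simp [app]

lemma smul_app (x : ℝ) (A : Matrix (Fin a) (Fin b) ℝ) (v : Vec b) :
    app (x • A) v = x • app A v := by simp [app]

@[simp] lemma zero_app (v : Vec b) : app (0 : Matrix (Fin a) (Fin b) ℝ) v = 0 := by simp [app]

lemma mul_app (A : Matrix (Fin a) (Fin b) ℝ) (B : Matrix (Fin b) (Fin c) ℝ) (v : Vec c) :
    app (A * B) v = app A (app B v) := by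
  ext i
  simp [app, Matrix.toLpLin_apply, Matrix.mulVec_mulVec]

lemma opNorm_nonneg (A : Matrix (Fin a) (Fin b) ℝ) : 0 ≤ opNorm A := norm_nonneg _

@[simp] lemma opNorm_zero : opNorm (0 : Matrix (Fin a) (Fin b) ℝ) = 0 := norm_zero

lemma opNorm_add_le (A B : Matrix (Fin a) (Fin b) ℝ) : opNorm (A + B) ≤ opNorm A + opNorm B :=
  norm_add_le _ _

lemma opNorm_sub_le (A B : Matrix (Fin a) (Fin b) ℝ) : opNorm (A - B) ≤ opNorm A + opNorm B :=
  norm_sub_le _ _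

lemma opNorm_smul (x : ℝ) (A : Matrix (Fin a) (Fin b) ℝ) : opNorm (x • A) = |x| * opNorm A :=
  norm_smul _ _

lemma norm_app_le (A : Matrix (Fin a) (Fin b) ℝ) (v : Vec b) : ‖app A v‖ ≤ opNorm A * ‖v‖ :=
  A.l2_opNorm_mulVec v

lemma opNorm_transpose (A : Matrix (Fin a) (Fin b) ℝ) : opNorm A.transpose = opNorm A := by
  have := A.l2_opNorm_conjTranspose
  rwa [Matrix.conjTranspose_eq_transpose_of_trivial] at this

lemma opNorm_le_frobenius (A : Matrix (Fin a) (Fin b) ℝ) :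
    opNorm A ≤ √(∑ i, ∑ j, A i j ^ 2) := by
  have h : opNorm A = ‖(Matrix.toEuclideanLin (𝕜 := ℝ) ≪≫ₗ LinearMap.toContinuousLinearMap) A‖ :=
    A.l2_opNorm_def
  rw [h]
  refine ContinuousLinearMap.opNorm_le_bound _ (Real.sqrt_nonneg _) fun v => ?_
  change ‖app A v‖ ≤ _
  rw [EuclideanSpace.norm_eq, EuclideanSpace.norm_eq, ← Real.sqrt_mul (by positivity)]
  refine Real.sqrt_le_sqrt ?_
  rw [Finset.sum_mul]
  refine Finset.sum_le_sum fun i _ => ?_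
  simp only [Real.norm_eq_abs, sq_abs, app_apply]
  exact Finset.sum_mul_sq_le_sq_mul_sq _ _ _

/-- Each column is the image of a unit basis vector, so its Euclidean norm is at most the operator
norm. -/
lemma frobenius_sq_le_card_right (A : Matrix (Fin a) (Fin b) ℝ) :
    ∑ i, ∑ j, A i j ^ 2 ≤ b * opNorm A ^ 2 := by
  rw [Finset.sum_comm]
  have h : ∀ j : Fin b, ∑ i, A i j ^ 2 ≤ opNorm A ^ 2 := by
    intro j
    have h1 := norm_app_le A (EuclideanSpace.single j (1 : ℝ))
    have h2 : ‖app A (EuclideanSpace.single j (1 : ℝ))‖ ^ 2 = ∑ i, A i j ^ 2 := by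
      rw [EuclideanSpace.norm_sq_eq]
      refine Finset.sum_congr rfl fun i _ => ?_
      simp [app_apply]
    rw [← h2]
    simp only [PiLp.norm_single, norm_one, mul_one] at h1
    gcongr
  calc _ ≤ ∑ _j : Fin b, opNorm A ^ 2 := Finset.sum_le_sum fun j _ => h j
    _ = _ := by simp

lemma frobenius_sq_le_card_left (A : Matrix (Fin a) (Fin b) ℝ) :
    ∑ i, ∑ j, A i j ^ 2 ≤ a * opNorm A ^ 2 := by
  have := frobenius_sq_le_card_right A.transpose
  rw [opNorm_transpose, Finset.sum_comm] at this
  exact this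

lemma block_of_lt (G : OpSeq k a b) {i : ℕ} (hi : i < k) (r : Fin a) (c : Fin b) :
    block G i r c = G (⟨i, hi⟩, r, c) := by simp [block, hi]

@[simp] lemma block_zero (i : ℕ) : block (0 : OpSeq k a b) i = 0 := by
  ext r c; simp only [block]; split_ifs <;> simp

lemma block_add (G H : OpSeq k a b) (i : ℕ) : block (G + H) i = block G i + block H i := by
  ext r c; simp only [block]; split_ifs <;> simp

lemma block_sub (G H : OpSeq k a b) (i : ℕ) : block (G - H) i = block G i - block H i := by
  ext r c; simp only [block]; split_ifs <;> simp

lemma block_smul (x : ℝ) (G : OpSeq k a b) (i : ℕ) : block (x • G) i = x • block G i := by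
  ext r c; simp only [block]; split_ifs <;> simp

lemma norm_sq_eq_sum_block (G : OpSeq k a b) :
    ‖G‖ ^ 2 = ∑ i ∈ range k, ∑ r, ∑ c, block G i r c ^ 2 := by
  rw [EuclideanSpace.norm_sq_eq, Fintype.sum_prod_type, Finset.sum_range]
  refine Finset.sum_congr rfl fun i _ => ?_
  rw [Fintype.sum_prod_type]
  refine Finset.sum_congr rfl fun r _ => Finset.sum_congr rfl fun c _ => ?_
  rw [block_of_lt G i.2]; simp

lemma sum_opNorm_block_sq_le (G : OpSeq k a b) :
    ∑ i ∈ range k, opNorm (block G i) ^ 2 ≤ ‖G‖ ^ 2 := by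
  rw [norm_sq_eq_sum_block]
  refine Finset.sum_le_sum fun i _ => ?_
  calc _ ≤ √(∑ r, ∑ c, block G i r c ^ 2) ^ 2 := by
        gcongr; exacts [opNorm_nonneg _, opNorm_le_frobenius _]
    _ = _ := Real.sq_sqrt (by positivity)

lemma sum_opNorm_block_le (G : OpSeq k a b) :
    ∑ i ∈ range k, opNorm (block G i) ≤ √k * ‖G‖ := by
  have h := Finset.sum_mul_sq_le_sq_mul_sq (range k) (fun _ => (1 : ℝ)) fun i => opNorm (block G i)
  simp only [one_mul, one_pow, sum_const, card_range, nsmul_eq_mul, mul_one] at h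
  refine abs_le_of_sq_le_sq' ?_ (by positivity) |>.2
  rw [mul_pow, Real.sq_sqrt (by positivity)]
  exact h.trans (by gcongr; exact sum_opNorm_block_sq_le G)

/-- The ball constrains the sum of the block norms, and a sum of squares is at most the square of
the sum, so no factor `k` is lost. -/
lemma norm_sq_le_of_mem_opBall_left {G : OpSeq k a b} {R : ℝ} (hG : G ∈ opBall k a b R) :
    ‖G‖ ^ 2 ≤ a * R ^ 2 := by
  rw [norm_sq_eq_sum_block]
  calc _ ≤ ∑ i ∈ range k, a * opNorm (block G i) ^ 2 :=
        Finset.sum_le_sum fun i _ => frobenius_sq_le_card_left _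
    _ = a * ∑ i ∈ range k, opNorm (block G i) ^ 2 := by rw [Finset.mul_sum]
    _ ≤ a * (∑ i ∈ range k, opNorm (block G i)) ^ 2 := by
        gcongr; exact Finset.sum_sq_le_sq_sum_of_nonneg fun i _ => opNorm_nonneg _
    _ ≤ a * R ^ 2 := by
        gcongr
        exacts [Finset.sum_nonneg fun i _ => opNorm_nonneg _, hG]

lemma norm_sq_le_of_mem_opBall_right {G : OpSeq k a b} {R : ℝ} (hG : G ∈ opBall k a b R) :
    ‖G‖ ^ 2 ≤ b * R ^ 2 := by
  rw [norm_sq_eq_sum_block]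
  calc _ ≤ ∑ i ∈ range k, b * opNorm (block G i) ^ 2 :=
        Finset.sum_le_sum fun i _ => frobenius_sq_le_card_right _
    _ = b * ∑ i ∈ range k, opNorm (block G i) ^ 2 := by rw [Finset.mul_sum]
    _ ≤ b * (∑ i ∈ range k, opNorm (block G i)) ^ 2 := by
        gcongr; exact Finset.sum_sq_le_sq_sum_of_nonneg fun i _ => opNorm_nonneg _
    _ ≤ b * R ^ 2 := by
        gcongr
        exacts [Finset.sum_nonneg fun i _ => opNorm_nonneg _, hG]

lemma norm_le_of_mem_opBall {G : OpSeq k a b} {R : ℝ} (hR : 0 ≤ R) (hG : G ∈ opBall k a b R) :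
    ‖G‖ ≤ √((min a b : ℕ) : ℝ) * R := by
  refine abs_le_of_sq_le_sq' ?_ (by positivity) |>.2
  rw [mul_pow, Real.sq_sqrt (by positivity)]
  rcases min_cases a b with h | h <;> rw [h.1]
  exacts [norm_sq_le_of_mem_opBall_left hG, norm_sq_le_of_mem_opBall_right hG]

lemma convex_opBall (k a b : ℕ) (R : ℝ) : Convex ℝ (opBall k a b R) := by
  intro G hG H hH x y hx hy hxy
  simp only [opBall, Set.mem_ofPred_eq] at *
  calc _ ≤ ∑ i ∈ range k, (x * opNorm (block G i) + y * opNorm (block H i)) := by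
        refine Finset.sum_le_sum fun i _ => ?_
        rw [block_add, block_smul, block_smul]
        refine (opNorm_add_le _ _).trans ?_
        rw [opNorm_smul, opNorm_smul, abs_of_nonneg hx, abs_of_nonneg hy]
    _ = x * ∑ i ∈ range k, opNorm (block G i) + y * ∑ i ∈ range k, opNorm (block H i) := by
        rw [Finset.sum_add_distrib, Finset.mul_sum, Finset.mul_sum]
    _ ≤ x * R + y * R := by gcongr
    _ = R := by rw [← add_mul, hxy, one_mul]

lemma isClosed_opBall (k a b : ℕ) (R : ℝ) : IsClosed (opBall k a b R) := by
  refine isClosed_le (continuous_finsetSum _ fun i _ => ?_) continuous_const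
  let f : OpSeq k a b →ₗ[ℝ] Matrix (Fin a) (Fin b) ℝ :=
    { toFun := fun G => block G i
      map_add' := fun G H => block_add G H i
      map_smul' := fun x G => block_smul x G i }
  have hf : Continuous f := f.continuous_of_finiteDimensional
  exact continuous_norm.comp hf

lemma zero_mem_opBall {R : ℝ} (hR : 0 ≤ R) : (0 : OpSeq k a b) ∈ opBall k a b R := by
  simpa [opBall] using hR

end

/-! ### Projections and projected gradient steps -/

section
variable {V : Type*} [NormedAddCommGroup V] [InnerProductSpace ℝ V] [CompleteSpace V] {K : Set V}

lemma proj_spec (hne : K.Nonempty) (hc : IsClosed K) (hK : Convex ℝ K) (v : V) :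
    proj K v ∈ K ∧ ∀ z ∈ K, ‖v - proj K v‖ ≤ ‖v - z‖ := by
  refine Classical.epsilon_spec (p := fun y => y ∈ K ∧ ∀ z ∈ K, ‖v - y‖ ≤ ‖v - z‖) ?_
  obtain ⟨y, hy, h⟩ := exists_norm_eq_iInf_of_complete_convex hne hc.isComplete hK v
  refine ⟨y, hy, fun z hz => ?_⟩
  rw [h]
  exact ciInf_le ⟨0, by rintro _ ⟨w, rfl⟩; exact norm_nonneg _⟩ (⟨z, hz⟩ : K)

lemma proj_mem (hne : K.Nonempty) (hc : IsClosed K) (hK : Convex ℝ K) (v : V) : proj K v ∈ K :=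
  (proj_spec hne hc hK v).1

/-- The variational inequality makes the angle at `proj K v` between `v` and `z` at least a right
angle, so projecting cannot move away from a point of `K`. -/
lemma norm_proj_sub_le (hc : IsClosed K) (hK : Convex ℝ K) (v : V) {z : V} (hz : z ∈ K) :
    ‖proj K v - z‖ ≤ ‖v - z‖ := by
  obtain ⟨h1, h2⟩ := proj_spec ⟨z, hz⟩ hc hK v
  set y := proj K v
  have : ‖v - y‖ = ⨅ w : K, ‖v - w‖ := by
    have : Nonempty K := ⟨⟨z, hz⟩⟩
    refine le_antisymm (le_ciInf fun w => h2 w w.2) ?_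
    exact ciInf_le ⟨0, by rintro _ ⟨w, rfl⟩; exact norm_nonneg _⟩ (⟨y, h1⟩ : K)
  have h3 := (norm_eq_iInf_iff_real_inner_le_zero hK h1).1 this z hz
  have h4 : ‖v - z‖ ^ 2 = ‖v - y‖ ^ 2 + 2 * inner ℝ (v - y) (y - z) + ‖y - z‖ ^ 2 := by
    rw [← norm_add_sq_real]; simp
  have h5 : inner ℝ (v - y) (y - z) = - inner ℝ (v - y) (z - y) := by
    rw [← inner_neg_right]; simp
  refine abs_le_of_sq_le_sq' ?_ (by positivity) |>.2
  nlinarith [sq_nonneg ‖v - y‖]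

lemma norm_proj_step_sq_le (hc : IsClosed K) (hK : Convex ℝ K) (v g : V) (x : ℝ) {z : V}
    (hz : z ∈ K) :
    ‖proj K (v - x • g) - z‖ ^ 2 ≤ ‖v - z‖ ^ 2 - 2 * x * inner ℝ g (v - z) + x ^ 2 * ‖g‖ ^ 2 := by
  have h := norm_proj_sub_le hc hK (v - x • g) hz
  calc _ ≤ ‖v - x • g - z‖ ^ 2 := by gcongr
    _ = ‖(v - z) - x • g‖ ^ 2 := by congr 2; abel
    _ = _ := by
      rw [norm_sub_sq_real, real_inner_smul_right, norm_smul, real_inner_comm, mul_pow,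
        Real.norm_eq_abs, sq_abs]; ring

lemma norm_proj_step_sub_le (hc : IsClosed K) (hK : Convex ℝ K) {v : V} (hv : v ∈ K) (g : V)
    (x : ℝ) : ‖proj K (v - x • g) - v‖ ≤ |x| * ‖g‖ := by
  refine (norm_proj_sub_le hc hK _ hv).trans ?_
  simp [norm_smul]

/-- Regret of projected online subgradient descent over an interval. -/
lemma projected_descent_regret (hc : IsClosed K) (hK : Convex ℝ K) {x : ℝ} (hx : 0 < x)
    (M g : ℕ → V) (f : ℕ → V → ℝ) {r s : ℕ} (hrs : r ≤ s + 1) {z : V} (hz : z ∈ K) {γ : ℝ}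
    (hM : ∀ t ∈ Icc r s, M (t + 1) = proj K (M t - x • g t))
    (hg : ∀ t ∈ Icc r s, IsSubgradient (f t) (M t) (g t)) (hγ : ∀ t ∈ Icc r s, ‖g t‖ ≤ γ) :
    ∑ t ∈ Icc r s, (f t (M t) - f t z) ≤
      ‖M r - z‖ ^ 2 / (2 * x) + #(Icc r s) * (x * γ ^ 2 / 2) := by
  have key : ∀ t ∈ Icc r s, f t (M t) - f t z ≤
      ‖M t - z‖ ^ 2 / (2 * x) - ‖M (t + 1) - z‖ ^ 2 / (2 * x) + x * γ ^ 2 / 2 := by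
    intro t ht
    have h1 := norm_proj_step_sq_le hc hK (M t) (g t) x hz
    rw [← hM t ht] at h1
    have h2 := hg t ht z
    have h3 : inner ℝ (g t) (z - M t) = - inner ℝ (g t) (M t - z) := by
      rw [← inner_neg_right]; simp
    have h4 : ‖g t‖ ^ 2 ≤ γ ^ 2 := by gcongr; exact hγ t ht
    rw [h3] at h2
    have h5 : 2 * x * inner ℝ (g t) (M t - z) ≤
        ‖M t - z‖ ^ 2 - ‖M (t + 1) - z‖ ^ 2 + x ^ 2 * γ ^ 2 := by
      have := mul_le_mul_of_nonneg_left h4 (sq_nonneg x)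
      linarith
    have h6 : inner ℝ (g t) (M t - z) ≤
        (‖M t - z‖ ^ 2 - ‖M (t + 1) - z‖ ^ 2 + x ^ 2 * γ ^ 2) / (2 * x) := by
      rw [le_div_iff₀ (by positivity)]; linarith
    have h7 : (‖M t - z‖ ^ 2 - ‖M (t + 1) - z‖ ^ 2 + x ^ 2 * γ ^ 2) / (2 * x) =
      ‖M t - z‖ ^ 2 / (2 * x) - ‖M (t + 1) - z‖ ^ 2 / (2 * x) + x * γ ^ 2 / 2 := by
      field_simp
    linarith
  calc _ ≤ ∑ t ∈ Icc r s, (‖M t - z‖ ^ 2 / (2 * x) - ‖M (t + 1) - z‖ ^ 2 / (2 * x)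
        + x * γ ^ 2 / 2) := Finset.sum_le_sum key
    _ = ‖M r - z‖ ^ 2 / (2 * x) - ‖M (s + 1) - z‖ ^ 2 / (2 * x)
        + #(Icc r s) * (x * γ ^ 2 / 2) := by
      rw [Finset.sum_add_distrib, Finset.sum_const, nsmul_eq_mul]
      congr 1
      have := Finset.sum_Ico_sub (fun t => - (‖M t - z‖ ^ 2 / (2 * x))) hrs
      rw [Finset.Ico_add_one_right_eq_Icc] at this
      rw [show ‖M r - z‖ ^ 2 / (2 * x) - ‖M (s + 1) - z‖ ^ 2 / (2 * x) =
        -(‖M (s + 1) - z‖ ^ 2 / (2 * x)) - -(‖M r - z‖ ^ 2 / (2 * x)) by ring, ← this]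
      exact Finset.sum_congr rfl fun t _ => by ring
    _ ≤ _ := by
      have : 0 ≤ ‖M (s + 1) - z‖ ^ 2 / (2 * x) := by positivity
      linarith

end

/-! ### Linear time-varying systems -/

namespace LTV

variable {dx du : ℕ} (S : LTV dx du)

@[simp] lemma markov_zero (t : ℕ) : S.markov (t + 1) 0 = S.B (t + 1) := by
  simp [markov, Phi]

lemma markov_of_ge {t i : ℕ} (h : t ≤ i) : S.markov t i = 0 := by
  simp [markov, h]

/-- `Phi` is built by multiplying on the right, whereas the state recursion multiplies on the left;
this exchange yields the recursion for the Markov operators. -/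
lemma Phi_succ_succ (t i : ℕ) (h : i ≤ t) : S.Phi (t + 1) (i + 1) = S.A (t + 1) * S.Phi t i := by
  induction i with
  | zero => simp [Phi]
  | succ i ih =>
    rw [Phi, ih (by omega), Phi, mul_assoc]
    congr 3
    omega

lemma markov_succ_succ (t i : ℕ) : S.markov (t + 1) (i + 1) = S.A (t + 1) * S.markov t i := by
  by_cases h : i < t
  · rw [markov, if_pos (by omega), markov, if_pos h, Phi_succ_succ _ _ _ h.le, Matrix.mul_assoc]
    congr 3
    omega
  · rw [markov_of_ge _ (by omega), markov_of_ge _ (by omega), Matrix.mul_zero]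

@[simp] lemma xnat_zero : S.xnat 0 = 0 := rfl

@[simp] lemma xnat_one : S.xnat 1 = 0 := by simp [xnat, state]

lemma xnat_succ {t : ℕ} (ht : 1 ≤ t) : S.xnat (t + 1) = app (S.A t) (S.xnat t) + S.w t := by
  have : t ≠ 0 := by omega
  simp [xnat, state, this]

/-- A trajectory is the sum of Nature's x's and the response to the inputs. -/
lemma trajectory_eq {x : ℕ → Vec dx} {u : ℕ → Vec du} {N : ℕ} (h1 : x 1 = 0)
    (h : ∀ t, 1 ≤ t → t ≤ N → x (t + 1) = app (S.A t) (x t) + app (S.B t) (u t) + S.w t) :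
    ∀ t ≤ N, x (t + 1) = S.xnat (t + 1) + ∑ i ∈ range t, app (S.markov t i) (u (t - i)) := by
  intro t
  induction t with
  | zero => intro _; simp [h1]
  | succ t ih =>
    intro ht
    rw [h (t + 1) (by omega) ht, ih (by omega), S.xnat_succ (by omega : 1 ≤ t + 1),
      Finset.sum_range_succ', app_add, app_sum]
    simp only [markov_succ_succ, mul_app, markov_zero, Nat.add_sub_add_right, Nat.sub_zero]
    abel

lemma state_eq (u : ℕ → Vec du) (t : ℕ) : S.state u (t + 1) =
    S.xnat (t + 1) + ∑ i ∈ range t, app (S.markov t i) (u (t - i)) := by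
  refine S.trajectory_eq (N := t) (by simp [state]) (fun s hs _ => ?_) t le_rfl
  have : s ≠ 0 := by omega
  simp [state, this]

/-- The first `h` blocks of the Markov operator. -/
def markovVec (h t : ℕ) : OpSeq h dx du :=
  WithLp.toLp 2 fun j => S.markov t j.1 j.2.1 j.2.2

lemma block_markovVec {h i : ℕ} (t : ℕ) (hi : i < h) : block (S.markovVec h t) i = S.markov t i := by
  ext r c
  rw [block_of_lt _ hi]; simp [markovVec]

lemma sum_range_app_markov (u : ℕ → Vec du) (t h : ℕ) (hth : t ≤ h) :
    ∑ i ∈ range h, app (S.markov t i) (u (t - i)) =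
      ∑ i ∈ range t, app (S.markov t i) (u (t - i)) := by
  symm
  refine Finset.sum_subset (Finset.range_mono hth) fun i _ hi => ?_
  rw [markov_of_ge _ (by simpa using hi), zero_app]

namespace Admissible

variable {S} {T : ℕ} {L Rnat RG ρ : ℝ} (hS : S.Admissible T L Rnat RG ρ)
include hS

lemma sum_markov_le {t : ℕ} (ht : t ∈ Icc 1 T) (n : ℕ) :
    ∑ i ∈ range n, opNorm (S.markov t i) ≤ RG := by
  have h := hS.decay 0 t ht
  rw [pow_zero, mul_one, ← Finset.range_eq_Ico] at h
  refine le_trans ?_ h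
  calc _ = ∑ i ∈ (range n) with i < t, opNorm (S.markov t i) := by
        symm
        refine Finset.sum_subset (Finset.filter_subset _ _) fun i h1 h2 => ?_
        have : t ≤ i := by
          simp only [mem_filter, not_and, not_lt] at h2
          exact h2 h1
        rw [markov_of_ge _ this, opNorm_zero]
    _ ≤ _ := Finset.sum_le_sum_of_subset_of_nonneg (by intro i; simp) fun _ _ _ => opNorm_nonneg _

lemma markovVec_mem {t : ℕ} (ht : t ∈ Icc 1 T) (h : ℕ) : S.markovVec h t ∈ opBall h dx du RG := by
  have := hS.sum_markov_le ht h
  refine le_trans (le_of_eq ?_) this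
  exact Finset.sum_congr rfl fun i hi => by rw [S.block_markovVec t (by simpa using hi)]

lemma norm_conv_le {t : ℕ} (ht : t ∈ Icc 1 T) {u : ℕ → Vec du} {U : ℝ} (n : ℕ) (hU : 0 ≤ U)
    (hu : ∀ i < n, i < t → ‖u (t - i)‖ ≤ U) :
    ‖∑ i ∈ range n, app (S.markov t i) (u (t - i))‖ ≤ RG * U := by
  calc _ ≤ ∑ i ∈ range n, opNorm (S.markov t i) * U := by
        refine norm_sum_le_of_le _ fun i hi => ?_
        by_cases h : i < t
        · refine (norm_app_le _ _).trans ?_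
          exact mul_le_mul_of_nonneg_left (hu i (by simpa using hi) h) (opNorm_nonneg _)
        · simp [markov_of_ge _ (not_lt.1 h)]
    _ = (∑ i ∈ range n, opNorm (S.markov t i)) * U := by rw [Finset.sum_mul]
    _ ≤ _ := by gcongr; exact hS.sum_markov_le ht n

/-- Only lags from `h` on are dropped, and the decay assumption bounds the sum of their operator
norms; for `t ≤ h` nothing is dropped. -/
lemma norm_conv_sub_trunc_le {t : ℕ} (ht : t ∈ Icc 1 T) {u : ℕ → Vec du} {U : ℝ} (h : ℕ)
    (hU : 0 ≤ U) (hu : ∀ s ∈ Icc 1 t, ‖u s‖ ≤ U) (hρ : 0 ≤ ρ) (hRG : 0 ≤ RG) :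
    ‖∑ i ∈ range t, app (S.markov t i) (u (t - i)) -
      ∑ i ∈ range h, app (S.markov t i) (u (t - i))‖ ≤ RG * ρ ^ h * U := by
  rcases le_total t h with hth | hth
  · rw [S.sum_range_app_markov u t h hth, sub_self, norm_zero]; positivity
  · rw [← Finset.sum_range_add_sum_Ico _ hth, add_sub_cancel_left]
    calc _ ≤ ∑ i ∈ Ico h t, opNorm (S.markov t i) * U := by
          refine norm_sum_le_of_le _ fun i hi => (norm_app_le _ _).trans ?_
          rw [Finset.mem_Ico] at hi
          exact mul_le_mul_of_nonneg_left (hu _ (Finset.mem_Icc.2 ⟨by omega, by omega⟩))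
            (opNorm_nonneg _)
      _ = (∑ i ∈ Ico h t, opNorm (S.markov t i)) * U := by rw [Finset.sum_mul]
      _ ≤ _ := by gcongr; exact hS.decay h t ht

/-- Convex costs of quadratic growth are Lipschitz on balls. -/
lemma cost_sub_le {t : ℕ} (ht : t ∈ Icc 1 T) {R : ℝ} (hR : 1 ≤ R) (hL : 0 < L) {x x' : Vec dx}
    {u u' : Vec du} (h : ‖x‖ + ‖u‖ ≤ R) (h' : ‖x'‖ + ‖u'‖ ≤ R) :
    S.c t x u - S.c t x' u' ≤ 5 * L * R * (‖x - x'‖ + ‖u - u'‖) := by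
  set d := ‖x - x'‖ + ‖u - u'‖ with hd
  have hd0 : 0 ≤ d := by positivity
  rcases hd0.eq_or_lt with h0 | h0
  · have h1 : ‖x - x'‖ = 0 := by linarith [norm_nonneg (x - x'), norm_nonneg (u - u')]
    have h2 : ‖u - u'‖ = 0 := by linarith [norm_nonneg (x - x'), norm_nonneg (u - u')]
    rw [sub_eq_zero.1 (norm_eq_zero.1 h1), sub_eq_zero.1 (norm_eq_zero.1 h2), sub_self]
    positivity
  have hd2 : d ≤ 2 * R := by
    have := norm_sub_le x x'
    have := norm_sub_le u u'
    linarith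
  -- Prolong the segment from `(x', u')` through `(x, u)` by the factor `θ⁻¹`, to total length `2 *
  -- R`. Its end has size at most `3 * R`, and convexity bounds the increment of the cost by `θ`
  -- times the cost there; `θ` is proportional to `d`.
  set θ := d / (2 * R) with hθ
  have hθ0 : 0 < θ := by positivity
  have hθ1 : θ ≤ 1 := by rw [hθ, div_le_one (by positivity)]; exact hd2
  have hc := (hS.cost_convex t ht).2 (Set.mem_univ (WithLp.toLp 2 (x', u')))
    (Set.mem_univ (WithLp.toLp 2 (x' + θ⁻¹ • (x - x'), u' + θ⁻¹ • (u - u'))))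
    (sub_nonneg.2 hθ1) hθ0.le (by ring)
  have e1 : (1 - θ) • x' + θ • (x' + θ⁻¹ • (x - x')) = x := by
    rw [smul_add, smul_smul, mul_inv_cancel₀ hθ0.ne', sub_smul]; simp; abel
  have e2 : (1 - θ) • u' + θ • (u' + θ⁻¹ • (u - u')) = u := by
    rw [smul_add, smul_smul, mul_inv_cancel₀ hθ0.ne', sub_smul]; simp; abel
  simp only [WithLp.add_fst, WithLp.add_snd, WithLp.smul_fst, WithLp.smul_snd, WithLp.toLp_fst,
    WithLp.toLp_snd, e1, e2, smul_eq_mul] at hc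
  have hq : ‖x' + θ⁻¹ • (x - x')‖ + ‖u' + θ⁻¹ • (u - u')‖ ≤ 3 * R := by
    have h1 := norm_add_le x' (θ⁻¹ • (x - x'))
    have h2 := norm_add_le u' (θ⁻¹ • (u - u'))
    rw [norm_smul, Real.norm_eq_abs, abs_of_pos (inv_pos.2 hθ0)] at h1 h2
    have h3 : θ⁻¹ * ‖x - x'‖ + θ⁻¹ * ‖u - u'‖ = 2 * R := by
      rw [← mul_add, ← hd, hθ]; field_simp
    linarith
  have hcost := hS.cost_le t ht (x' + θ⁻¹ • (x - x')) (u' + θ⁻¹ • (u - u'))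
  have hmax : max 1 (‖x' + θ⁻¹ • (x - x')‖ ^ 2 + ‖u' + θ⁻¹ • (u - u')‖ ^ 2) ≤ 9 * R ^ 2 := by
    refine max_le (by nlinarith) ?_
    have h1 := norm_nonneg (x' + θ⁻¹ • (x - x'))
    have h2 := norm_nonneg (u' + θ⁻¹ • (u - u'))
    nlinarith
  have h3 := hcost.trans (mul_le_mul_of_nonneg_left hmax hL.le)
  have h4 := hS.cost_nonneg t ht x' u'
  have h5 : θ * S.c t (x' + θ⁻¹ • (x - x')) (u' + θ⁻¹ • (u - u')) ≤ θ * (L * (9 * R ^ 2)) :=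
    mul_le_mul_of_nonneg_left h3 hθ0.le
  have h6 : θ * (L * (9 * R ^ 2)) = 9 / 2 * L * R * d := by rw [hθ]; field_simp
  have h7 : 0 ≤ θ * S.c t x' u' := by positivity
  have h8 : 0 ≤ L * R * d := by positivity
  linarith

end Admissible

/-! ### Disturbance response inputs -/

variable {m : ℕ}

lemma drcInput_of_zero (M : OpSeq m du dx) {y : ℕ → Vec dx} (hy : y 0 = 0) (t : ℕ) :
    drcInput M y t = ∑ i ∈ range m, app (block M i) (y (t - i)) := by
  refine Finset.sum_congr rfl fun i _ => ?_
  split_ifs with h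
  · rfl
  · rw [Nat.sub_eq_zero_of_le (not_lt.1 h), hy, app_zero]

lemma drcInput_congr (M : OpSeq m du dx) {y y' : ℕ → Vec dx} {t : ℕ}
    (h : ∀ s ∈ Icc 1 t, y s = y' s) : drcInput M y t = drcInput M y' t := by
  refine Finset.sum_congr rfl fun i _ => ?_
  split_ifs with hi
  · rw [h _ (Finset.mem_Icc.2 ⟨by omega, by omega⟩)]
  · rfl

lemma drcInput_add (M M' : OpSeq m du dx) (y : ℕ → Vec dx) (t : ℕ) :
    drcInput (M + M') y t = drcInput M y t + drcInput M' y t := by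
  simp only [drcInput, ← Finset.sum_add_distrib]
  refine Finset.sum_congr rfl fun i _ => ?_
  split_ifs <;> simp [block_add, add_app]

lemma drcInput_smul (a : ℝ) (M : OpSeq m du dx) (y : ℕ → Vec dx) (t : ℕ) :
    drcInput (a • M) y t = a • drcInput M y t := by
  simp only [drcInput, Finset.smul_sum]
  refine Finset.sum_congr rfl fun i _ => ?_
  split_ifs <;> simp [block_smul, smul_app]

lemma norm_drcInput_le_sum (M : OpSeq m du dx) {y : ℕ → Vec dx} {t : ℕ} {B : ℝ} (hB : 0 ≤ B)
    (hy : ∀ s ∈ Icc 1 t, ‖y s‖ ≤ B) :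
    ‖drcInput M y t‖ ≤ (∑ i ∈ range m, opNorm (block M i)) * B := by
  rw [drcInput, Finset.sum_mul]
  refine norm_sum_le_of_le _ fun i _ => ?_
  split_ifs with hi
  · refine (norm_app_le _ _).trans ?_
    exact mul_le_mul_of_nonneg_left (hy _ (Finset.mem_Icc.2 ⟨by omega, by omega⟩)) (opNorm_nonneg _)
  · rw [norm_zero]; exact mul_nonneg (opNorm_nonneg _) hB

lemma norm_drcInput_le {M : OpSeq m du dx} {R : ℝ} (hM : M ∈ opBall m du dx R) {y : ℕ → Vec dx}
    {t : ℕ} {B : ℝ} (hB : 0 ≤ B) (hy : ∀ s ∈ Icc 1 t, ‖y s‖ ≤ B) :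
    ‖drcInput M y t‖ ≤ R * B :=
  (norm_drcInput_le_sum M hB hy).trans (mul_le_mul_of_nonneg_right hM hB)

lemma norm_drcInput_sub_le (M M' : OpSeq m du dx) {y : ℕ → Vec dx} {t : ℕ} {B : ℝ} (hB : 0 ≤ B)
    (hy : ∀ s ∈ Icc 1 t, ‖y s‖ ≤ B) :
    ‖drcInput M y t - drcInput M' y t‖ ≤ B * √m * ‖M - M'‖ := by
  have h : drcInput M y t - drcInput M' y t = drcInput (M - M') y t := by
    rw [sub_eq_iff_eq_add, ← drcInput_add, sub_add_cancel]
  rw [h]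
  refine (norm_drcInput_le_sum _ hB hy).trans ?_
  have := sum_opNorm_block_le (M - M')
  calc _ ≤ (√m * ‖M - M'‖) * B := by gcongr
    _ = _ := by ring

/-- The block norms are kept as weights: they sum to at most the radius of the parameter ball, so
summing over time later costs no factor `m` on the errors. -/
lemma norm_drcInput_sub_le_sum (M : OpSeq m du dx) {y y' : ℕ → Vec dx} (hy : y 0 = 0)
    (hy' : y' 0 = 0) (t : ℕ) : ‖drcInput M y t - drcInput M y' t‖ ≤
      ∑ i ∈ range m, opNorm (block M i) * ‖y (t - i) - y' (t - i)‖ := by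
  rw [drcInput_of_zero M hy, drcInput_of_zero M hy', ← Finset.sum_sub_distrib]
  refine norm_sum_le_of_le _ fun i _ => ?_
  rw [← app_sub]
  exact norm_app_le _ _

/-! ### Variability -/

/-- The average of the Markov operators over `[r, s]`. -/
def avgMarkov (h r s : ℕ) : OpSeq h dx du :=
  (#(Icc r s) : ℝ)⁻¹ • ∑ t ∈ Icc r s, S.markovVec h t

/-- Averaging acts entrywise and so commutes with keeping the first `h` blocks. Truncation drops
nonnegative terms if `h < s`, and the blocks from `s` on vanish if `h ≥ s`. -/
lemma sum_norm_avgMarkov_sub_sq_le (h : ℕ) {r s : ℕ} (hrs : r ≤ s) :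
    ∑ t ∈ Icc r s, ‖S.avgMarkov h r s - S.markovVec h t‖ ^ 2 ≤
      #(Icc r s) * S.variability r s := by
  have hpos : (0 : ℝ) < #(Icc r s) := by
    rw [Nat.cast_pos, Finset.card_pos]; exact ⟨r, by simp [hrs]⟩
  rw [variability, ← mul_assoc, mul_inv_cancel₀ hpos.ne', one_mul]
  refine Finset.sum_le_sum fun t ht => ?_
  set f : ℕ → ℝ := fun i => ∑ a, ∑ b, ((#(Icc r s) : ℝ)⁻¹ * (∑ t' ∈ Icc r s, S.markov t' i a b)
    - S.markov t i a b) ^ 2 with hf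
  have h1 : ‖S.avgMarkov h r s - S.markovVec h t‖ ^ 2 = ∑ i ∈ range h, f i := by
    rw [EuclideanSpace.norm_sq_eq, Fintype.sum_prod_type, Finset.sum_range]
    refine Finset.sum_congr rfl fun i _ => ?_
    rw [Fintype.sum_prod_type]
    refine Finset.sum_congr rfl fun a _ => Finset.sum_congr rfl fun b _ => ?_
    simp [avgMarkov, markovVec]
  have h2 : ∀ i, s ≤ i → f i = 0 := by
    intro i hi
    refine Finset.sum_eq_zero fun a _ => Finset.sum_eq_zero fun b _ => ?_
    have : ∀ t' ∈ Icc r s, S.markov t' i a b = 0 := fun t' ht' => by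
      rw [S.markov_of_ge (by rw [Finset.mem_Icc] at ht'; omega)]; rfl
    rw [this t ht, Finset.sum_eq_zero this]; simp
  rw [h1]
  calc _ = ∑ i ∈ (range h) with i < s, f i := by
        symm
        refine Finset.sum_subset (Finset.filter_subset _ _) fun i h1 h3 => h2 i ?_
        simp only [mem_filter, not_and, not_lt] at h3
        exact h3 h1
    _ ≤ _ := Finset.sum_le_sum_of_subset_of_nonneg (by intro i; simp) fun _ _ _ => by
        rw [hf]; positivity

lemma variability_nonneg (r s : ℕ) : 0 ≤ S.variability r s := by
  unfold variability; positivity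

/-- By convexity of the ball, the average is an admissible comparator for the projected estimators.
-/
lemma Admissible.avgMarkov_mem {S : LTV dx du} {T : ℕ} {L Rnat RG ρ : ℝ}
    (hS : S.Admissible T L Rnat RG ρ) (h : ℕ) {r s : ℕ} (hr : 1 ≤ r) (hrs : r ≤ s) (hs : s ≤ T) :
    S.avgMarkov h r s ∈ opBall h dx du RG := by
  have hpos : (0 : ℝ) < #(Icc r s) := by
    rw [Nat.cast_pos, Finset.card_pos]; exact ⟨r, by simp [hrs]⟩
  rw [avgMarkov, Finset.smul_sum]
  refine (convex_opBall h dx du RG).sum_mem (fun _ _ => by positivity) ?_ fun t ht => ?_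
  · rw [Finset.sum_const, nsmul_eq_mul, mul_inv_cancel₀ hpos.ne']
  · rw [Finset.mem_Icc] at ht
    exact hS.markovVec_mem (Finset.mem_Icc.2 ⟨by omega, by omega⟩) h

end LTV

set_option linter.unusedSectionVars false

/-! ### Ada-Pred -/

lemma mem_workingSet {τ i : ℕ} :
    i ∈ workingSet τ ↔ (1 ≤ i ∧ i ≤ τ) ∧ τ ≤ i + (2 ^ (padicValNat 2 i + 2) + 1) := by
  simp [workingSet]

lemma self_mem_workingSet {τ : ℕ} (hτ : 1 ≤ τ) : τ ∈ workingSet τ := by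
  have := Nat.zero_le (2 ^ (padicValNat 2 τ + 2))
  rw [mem_workingSet]
  refine ⟨⟨hτ, le_rfl⟩, by omega⟩

lemma workingSet_succ_subset (τ : ℕ) : workingSet (τ + 1) ⊆ insert (τ + 1) (workingSet τ) := by
  intro i hi
  rw [mem_workingSet] at hi
  rw [Finset.mem_insert, mem_workingSet]
  omega

lemma succ_notMem_workingSet (τ : ℕ) : τ + 1 ∉ workingSet τ := by
  rw [mem_workingSet]; omega

/-- Dyadic covering: an interval `[a, b]` splits into at most `log₂ b + 1` pieces `[i, e]` with
`e < i + 2 ^ v₂(i)`. -/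
lemma sum_Icc_le_of_dyadic {f : ℕ → ℝ} {C : ℝ} (hC : 0 ≤ C) {b : ℕ}
    (h : ∀ i e, 1 ≤ i → i ≤ e → e < i + 2 ^ padicValNat 2 i → e ≤ b → ∑ τ ∈ Icc i e, f τ ≤ C)
    {a : ℕ} (ha : 1 ≤ a) : ∑ τ ∈ Icc a b, f τ ≤ (Nat.log 2 b + 1 : ℕ) * C := by
  -- Greedy covering: after the piece that starts at `a` the next one starts at `a + 2 ^ v`, whose
  -- 2-adic valuation is strictly larger. Here `n` bounds the valuation from below and `k` counts
  -- the pieces still allowed; at `k = 0` the power `2 ^ n` already exceeds `b`.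
  suffices H : ∀ k n a, 1 ≤ a → 2 ^ n ∣ a → n + k = Nat.log 2 b + 1 →
      ∑ τ ∈ Icc a b, f τ ≤ k * C from H _ 0 a ha (by simp) (by simp)
  intro k
  induction k with
  | zero =>
    intro n a ha hd hn
    have h1 : b < 2 ^ n := by
      rw [add_zero] at hn
      rw [hn]; exact Nat.lt_pow_succ_log_self (by norm_num) b
    have h2 := Nat.le_of_dvd ha hd
    rw [Finset.Icc_eq_empty (by omega)]; simp
  | succ k ih =>
    intro n a ha hd hn
    have hkC : 0 ≤ (k : ℝ) * C := by positivity
    push_cast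
    rcases lt_or_ge b a with hba | hba
    · rw [Finset.Icc_eq_empty (by omega), Finset.sum_empty]; positivity
    set v := padicValNat 2 a with hv
    have hnv : n ≤ v := (padicValNat_dvd_iff_le (by omega)).1 hd
    rcases lt_or_ge b (a + 2 ^ v) with hb | hb
    · have := h a b ha hba hb le_rfl
      linarith
    · have h2v : 1 ≤ 2 ^ v := Nat.one_le_two_pow
      have h1 := h a (a + 2 ^ v - 1) ha (by omega) (show a + 2 ^ v - 1 < a + 2 ^ v by omega) (by omega)
      -- `a` is an odd multiple of `2 ^ v`, so adding `2 ^ v` gives an even multiple.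
      have hdv : 2 ^ (v + 1) ∣ a + 2 ^ v := by
        obtain ⟨c, hc⟩ : 2 ^ v ∣ a := pow_padicValNat_dvd
        have hodd : ¬ 2 ∣ c := by
          rintro ⟨d, rfl⟩
          have : 2 ^ (v + 1) ∣ a := ⟨d, by rw [hc]; ring⟩
          have := (padicValNat_dvd_iff_le (p := 2) (by omega)).1 this
          omega
        obtain ⟨d, hd⟩ : 2 ∣ c + 1 := by omega
        exact ⟨d, by
          calc a + 2 ^ v = 2 ^ v * c + 2 ^ v := by rw [← hc]
            _ = 2 ^ v * (c + 1) := by ring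
            _ = 2 ^ (v + 1) * d := by rw [hd]; ring⟩
      have h2 := ih (n + 1) (a + 2 ^ v) (by omega)
        ((pow_dvd_pow 2 (by omega)).trans hdv) (by omega)
      have h3 : ∑ τ ∈ Icc a b, f τ =
          ∑ τ ∈ Icc a (a + 2 ^ v - 1), f τ + ∑ τ ∈ Icc (a + 2 ^ v) b, f τ := by
        rw [← Finset.Ico_add_one_right_eq_Icc, ← Finset.Ico_add_one_right_eq_Icc,
          ← Finset.Ico_add_one_right_eq_Icc, show a + 2 ^ v - 1 + 1 = a + 2 ^ v by omega,
          Finset.sum_Ico_consecutive _ (by omega) (by omega)]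
      rw [h3]
      linarith

/-- Tangent inequality for the Gaussian on `[-1, 1]`. -/
lemma exp_le_mul_exp_tangent {r a : ℝ} (hr0 : 0 ≤ r) (hr : r ≤ 1) (ha : |a| ≤ 1) :
    Real.exp (r ^ 2 / 2) ≤ (1 - r * (a - r)) * Real.exp (a ^ 2 / 2) := by
  obtain ⟨ha1, ha2⟩ := abs_le.1 ha
  -- The derivative is `(x - r) * (1 - r * x)` times a positive factor, and `1 - r * x ≥ 0` on [-1,
  -- 1], so the minimum there is attained at `r`.
  set ψ : ℝ → ℝ := fun a => (1 - r * (a - r)) * Real.exp (a ^ 2 / 2) with hψ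
  have hd : ∀ x, HasDerivAt ψ ((x - r) * (1 - r * x) * Real.exp (x ^ 2 / 2)) x := by
    intro x
    have h1 : HasDerivAt (fun a : ℝ => 1 - r * (a - r)) (-r) x := by
      simpa using (((hasDerivAt_id x).sub_const r).const_mul r).const_sub 1
    have h2 : HasDerivAt (fun a : ℝ => Real.exp (a ^ 2 / 2)) (Real.exp (x ^ 2 / 2) * x) x := by
      have h3 : HasDerivAt (fun a : ℝ => a ^ 2 / 2) x x := by
        have := ((hasDerivAt_id x).pow 2).div_const 2
        simpa using this
      exact h3.exp
    exact (h1.mul h2).congr_deriv (by ring)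
  have hc : Continuous ψ := continuous_iff_continuousAt.2 fun x => (hd x).continuousAt
  have hψr : ψ r = Real.exp (r ^ 2 / 2) := by simp [hψ]
  rw [← hψr]
  change ψ r ≤ ψ a
  rcases le_total r a with h | h
  · refine monotoneOn_of_deriv_nonneg (convex_Icc r 1) hc.continuousOn
      (fun x _ => (hd x).differentiableAt.differentiableWithinAt) (fun x hx => ?_)
      ⟨le_rfl, hr⟩ ⟨h, ha2⟩ h
    rw [interior_Icc] at hx
    rw [(hd x).deriv]
    have h1 : 0 ≤ x - r := by linarith [hx.1]
    have h2 : 0 ≤ 1 - r * x := by nlinarith [hx.1, hx.2]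
    positivity
  · refine antitoneOn_of_deriv_nonpos (convex_Icc (-1) r) hc.continuousOn
      (fun x _ => (hd x).differentiableAt.differentiableWithinAt) (fun x hx => ?_)
      ⟨ha1, h⟩ ⟨by linarith, le_rfl⟩ h
    rw [interior_Icc] at hx
    rw [(hd x).deriv]
    have h1 : 0 ≤ r - x := by linarith [hx.2]
    have h2 : 0 ≤ 1 - r * x := by nlinarith [hx.1, hx.2]
    have : 0 ≤ (r - x) * (1 - r * x) * Real.exp (x ^ 2 / 2) := by positivity
    linarith

section
variable {V : Type*} [NormedAddCommGroup V] [InnerProductSpace ℝ V]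

/-- This reduces to the scalar tangent inequality along the direction of `y`: the tangent factor
sees only the component of `x` along `y`, and replacing that component by the full norm of `x` only
lowers the Gaussian on the left. -/
lemma exp_neg_norm_sq_le_tangent {c R : ℝ} (hc : 0 ≤ c) (hcR : c * R ^ 2 ≤ 1) {x y : V}
    (hx : ‖x‖ ≤ R) (hy : ‖y‖ ≤ R) : Real.exp (-(c / 2 * ‖x‖ ^ 2)) ≤
      Real.exp (-(c / 2 * ‖y‖ ^ 2)) * (1 - c * inner ℝ y (x - y)) := by
  rcases eq_or_ne y 0 with rfl | hy0
  · simp only [norm_zero, inner_zero_left]; simp; positivity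
  have hyp : 0 < ‖y‖ := norm_pos_iff.2 hy0
  have hb : ∀ w : ℝ, 0 ≤ w → w ≤ R → √c * w ≤ 1 := by
    intro w hw hwR
    refine abs_le_of_sq_le_sq' ?_ zero_le_one |>.2
    rw [mul_pow, Real.sq_sqrt hc]
    have : c * w ^ 2 ≤ c * R ^ 2 := by gcongr
    linarith
  have hin : |inner ℝ x y| ≤ ‖x‖ * ‖y‖ := abs_real_inner_le_norm x y
  have hin2 : |inner ℝ x y / ‖y‖| ≤ ‖x‖ := by
    rw [abs_div, abs_of_pos hyp, div_le_iff₀ hyp]; exact hin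
  have ht := exp_le_mul_exp_tangent (r := √c * ‖y‖) (a := √c * (inner ℝ x y / ‖y‖))
    (by positivity) (hb _ hyp.le hy) (by
      rw [abs_mul, abs_of_nonneg (Real.sqrt_nonneg c)]
      exact hb _ (abs_nonneg _) (hin2.trans hx))
  have e1 : √c * ‖y‖ * (√c * (inner ℝ x y / ‖y‖) - √c * ‖y‖) = c * inner ℝ y (x - y) := by
    rw [inner_sub_right, real_inner_self_eq_norm_sq, real_inner_comm x y]
    have := Real.mul_self_sqrt hc
    calc _ = (√c * √c) * (‖y‖ * (inner ℝ x y / ‖y‖) - ‖y‖ ^ 2) := by ring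
      _ = _ := by rw [this, mul_div_cancel₀ _ hyp.ne']
  rw [e1, mul_pow, Real.sq_sqrt hc, mul_pow, Real.sq_sqrt hc] at ht
  have h3 : (inner ℝ x y / ‖y‖) ^ 2 ≤ ‖x‖ ^ 2 := by
    rw [← sq_abs]; gcongr
  set D := 1 - c * inner ℝ y (x - y)
  -- The scalar inequality bounds a positive number by `D` times a positive number. The sign is
  -- needed to enlarge the exponential that multiplies `D`.
  have hD : 0 < D := by
    by_contra hD
    have := Real.exp_pos (c * ‖y‖ ^ 2 / 2)
    nlinarith [Real.exp_pos (c * (inner ℝ x y / ‖y‖) ^ 2 / 2)]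
  have h4 : Real.exp (c * (inner ℝ x y / ‖y‖) ^ 2 / 2) ≤ Real.exp (c / 2 * ‖x‖ ^ 2) := by
    apply Real.exp_le_exp.2
    have := mul_le_mul_of_nonneg_left h3 hc
    linarith
  have h5 : Real.exp (c / 2 * ‖y‖ ^ 2) ≤ D * Real.exp (c / 2 * ‖x‖ ^ 2) := by
    refine le_trans (le_of_eq (by congr 1; ring)) (ht.trans ?_)
    exact mul_le_mul_of_nonneg_left h4 hD.le
  rw [Real.exp_neg, Real.exp_neg]
  have p1 := Real.exp_pos (c / 2 * ‖y‖ ^ 2)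
  have p2 := Real.exp_pos (c / 2 * ‖x‖ ^ 2)
  rw [inv_mul_eq_div, inv_eq_one_div, div_le_div_iff₀ p2 p1]
  linarith

/-- The Gaussian is concave on a ball of radius at most its standard deviation. -/
lemma sum_exp_neg_norm_sq_le {ι : Type*} {s : Finset ι} {q : ι → ℝ} {x : ι → V} {c R : ℝ}
    (hc : 0 ≤ c) (hcR : c * R ^ 2 ≤ 1) (hq : ∀ i ∈ s, 0 ≤ q i) (hs : ∑ i ∈ s, q i = 1)
    (hx : ∀ i ∈ s, ‖x i‖ ≤ R) :
    ∑ i ∈ s, q i * Real.exp (-(c / 2 * ‖x i‖ ^ 2)) ≤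
      Real.exp (-(c / 2 * ‖∑ i ∈ s, q i • x i‖ ^ 2)) := by
  set y := ∑ i ∈ s, q i • x i with hy
  have hyR : ‖y‖ ≤ R := by
    calc ‖y‖ ≤ ∑ i ∈ s, q i * R := norm_sum_le_of_le _ fun i hi => by
          rw [norm_smul, Real.norm_of_nonneg (hq i hi)]
          exact mul_le_mul_of_nonneg_left (hx i hi) (hq i hi)
      _ = R := by rw [← Finset.sum_mul, hs, one_mul]
  calc _ ≤ ∑ i ∈ s, q i * (Real.exp (-(c / 2 * ‖y‖ ^ 2)) * (1 - c * inner ℝ y (x i - y))) :=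
        Finset.sum_le_sum fun i hi =>
          mul_le_mul_of_nonneg_left (exp_neg_norm_sq_le_tangent hc hcR (hx i hi) hyR) (hq i hi)
    _ = Real.exp (-(c / 2 * ‖y‖ ^ 2)) *
        (∑ i ∈ s, q i - c * inner ℝ y (∑ i ∈ s, (q i • x i - q i • y))) := by
        rw [inner_sum, mul_sub, Finset.mul_sum, Finset.mul_sum, Finset.mul_sum,
          ← Finset.sum_sub_distrib]
        refine Finset.sum_congr rfl fun i _ => ?_
        rw [← smul_sub, real_inner_smul_right]; ring
    _ = _ := by
        rw [Finset.sum_sub_distrib, ← hy, ← Finset.sum_smul, hs, one_smul, sub_self]; simp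

namespace PredState

/-- Iterates stay in `K` and the weights of the active instances form a probability vector. -/
structure Valid (K : Set V) (τ : ℕ) (P : PredState V) : Prop where
  mem : ∀ i, P.z i ∈ K
  nonneg : ∀ i, 0 ≤ P.q i
  sum_eq : ∑ i ∈ workingSet τ, P.q i = 1

variable {K : Set V} {P : PredState V} {τ : ℕ} {p α : ℝ} {b : Bool} {y : V}

lemma Valid.play_mem (hP : P.Valid K τ) (hK : Convex ℝ K) : P.play τ ∈ K :=
  hK.sum_mem (fun i _ => hP.nonneg i) hP.sum_eq fun i _ => hP.mem i

lemma Valid.init {z0 : ℕ → V} (h : ∀ i, z0 i ∈ K) : (PredState.init z0).Valid K 1 where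
  mem := h
  nonneg i := by simp only [PredState.init]; split_ifs <;> norm_num
  sum_eq := by
    have : workingSet 1 = {1} := by
      ext i
      have := Nat.zero_le (2 ^ (padicValNat 2 i + 2))
      rw [mem_workingSet, Finset.mem_singleton]
      constructor
      · omega
      · rintro rfl; omega
    simp [this, PredState.init]

lemma Valid.partition_pos (hP : P.Valid K τ) (f : ℕ → ℝ) :
    0 < ∑ j ∈ workingSet τ, P.q j * Real.exp (f j) := by
  refine lt_of_le_of_ne (Finset.sum_nonneg fun i _ =>
    mul_nonneg (hP.nonneg i) (Real.exp_pos _).le) fun h => ?_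
  rw [eq_comm, Finset.sum_eq_zero_iff_of_nonneg
    (fun i _ => mul_nonneg (hP.nonneg i) (Real.exp_pos _).le)] at h
  have : ∑ i ∈ workingSet τ, P.q i = 0 :=
    Finset.sum_eq_zero fun i hi => (mul_eq_zero.1 (h i hi)).resolve_right (Real.exp_pos _).ne'
  linarith [hP.sum_eq]

lemma Valid.proxyWeight_nonneg (hP : P.Valid K τ) (i : ℕ) :
    0 ≤ P.proxyWeight p α τ b y i := by
  unfold proxyWeight
  split_ifs
  · positivity
  · exact mul_nonneg (by positivity) (div_nonneg (mul_nonneg (hP.nonneg i) (Real.exp_pos _).le)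
      (hP.partition_pos _).le)

lemma proxyWeight_self : P.proxyWeight p α τ b y (τ + 1) = 1 / (τ + 1) := by simp [proxyWeight]

lemma Valid.sum_proxyWeight_pos (hP : P.Valid K τ) :
    0 < ∑ j ∈ workingSet (τ + 1), P.proxyWeight p α τ b y j := by
  refine lt_of_lt_of_le ?_ (Finset.single_le_sum (fun i _ => hP.proxyWeight_nonneg i)
    (self_mem_workingSet (τ := τ + 1) (by omega)))
  rw [proxyWeight_self]; positivity

/-- Before pruning the total is exactly one: `1 / (τ + 1)` for the newborn instance and `τ / (τ +
1)` for the others. Pruning removes nonnegative terms. -/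
lemma Valid.sum_proxyWeight_le (hP : P.Valid K τ) :
    ∑ j ∈ workingSet (τ + 1), P.proxyWeight p α τ b y j ≤ 1 := by
  calc _ ≤ ∑ j ∈ insert (τ + 1) (workingSet τ), P.proxyWeight p α τ b y j :=
        Finset.sum_le_sum_of_subset_of_nonneg (workingSet_succ_subset τ)
          fun i _ _ => hP.proxyWeight_nonneg i
    _ = 1 / (τ + 1) + ∑ j ∈ workingSet τ, (τ : ℝ) / (τ + 1) *
          ((P.q j * Real.exp (-α * loss p b y (P.z j))) /
            ∑ j ∈ workingSet τ, P.q j * Real.exp (-α * loss p b y (P.z j))) := by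
        rw [Finset.sum_insert (succ_notMem_workingSet τ), proxyWeight_self]
        congr 1
        refine Finset.sum_congr rfl fun j hj => ?_
        have : j ≠ τ + 1 := fun h => succ_notMem_workingSet τ (h ▸ hj)
        simp [proxyWeight, this]
    _ = 1 := by
        rw [← Finset.mul_sum, ← Finset.sum_div, div_self (hP.partition_pos _).ne']
        field_simp
        ring
    _ ≤ 1 := le_rfl

section
variable [CompleteSpace V]

lemma Valid.step (hP : P.Valid K τ) (hc : IsClosed K) (hK : Convex ℝ K) :
    (P.step p α K τ b y).Valid K (τ + 1) where
  mem i := by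
    simp only [PredState.step]
    split_ifs
    · exact proj_mem ⟨_, hP.mem i⟩ hc hK _
    · exact hP.mem i
  nonneg i := by
    simp only [PredState.step]
    split_ifs
    · exact div_nonneg (hP.proxyWeight_nonneg i) hP.sum_proxyWeight_pos.le
    · exact le_rfl
  sum_eq := by
    have : ∀ i ∈ workingSet (τ + 1), (P.step p α K τ b y).q i =
        P.proxyWeight p α τ b y i / ∑ j ∈ workingSet (τ + 1), P.proxyWeight p α τ b y j := by
      intro i hi; simp [PredState.step, hi]
    rw [Finset.sum_congr rfl this, ← Finset.sum_div, div_self hP.sum_proxyWeight_pos.ne']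

end

/-- Normalisation divides by a number in (0, 1], so it can only raise the weight of a survivor. -/
lemma Valid.proxyWeight_le_step (hP : P.Valid K τ) {i : ℕ} (hi : i ∈ workingSet (τ + 1)) :
    P.proxyWeight p α τ b y i ≤ (P.step p α K τ b y).q i := by
  simp only [PredState.step, if_pos hi]
  exact le_div_self (hP.proxyWeight_nonneg i) hP.sum_proxyWeight_pos hP.sum_proxyWeight_le

/-- Exp-concavity of the loss: `α * R ^ 2 ≤ p` keeps all differences `z - y` within one standard
deviation of the Gaussian with exponent `-(α / (2p)) ‖·‖²`, where it is concave. Without a query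
both sides equal one. -/
lemma Valid.partition_le (hP : P.Valid K τ) {R : ℝ} (hp : 0 < p) (hα : 0 ≤ α)
    (hαR : α * R ^ 2 ≤ p) (hR : b = true → ∀ z ∈ K, ‖z - y‖ ≤ R) :
    ∑ j ∈ workingSet τ, P.q j * Real.exp (-α * loss p b y (P.z j)) ≤
      Real.exp (-α * loss p b y (P.play τ)) := by
  cases b with
  | false => simp [loss, hP.sum_eq]
  | true =>
    have h := sum_exp_neg_norm_sq_le (s := workingSet τ) (q := P.q) (x := fun i => P.z i - y)
      (c := α / p) (R := R) (by positivity)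
      (by rw [div_mul_eq_mul_div, div_le_one hp]; exact hαR) (fun i _ => hP.nonneg i) hP.sum_eq
      (fun i _ => hR rfl _ (hP.mem i))
    have e : ∑ i ∈ workingSet τ, P.q i • (P.z i - y) = P.play τ - y := by
      simp only [smul_sub, Finset.sum_sub_distrib, ← Finset.sum_smul, hP.sum_eq, one_smul, play]
    rw [e] at h
    have e2 : ∀ z : V, -α * loss p true y z = -(α / p / 2 * ‖z - y‖ ^ 2) := by
      intro z; simp only [loss, if_true]; ring
    simp only [e2]
    exact h

/-- A run of Ada-Pred. -/
structure IsRun (p α : ℝ) (K : Set V) (z0 : ℕ → V) (N : ℕ) (P : ℕ → PredState V) (b : ℕ → Bool)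
    (y : ℕ → V) : Prop where
  init : P 1 = PredState.init z0
  step : ∀ τ, 1 ≤ τ → τ ≤ N → P (τ + 1) = (P τ).step p α K τ (b τ) (y τ)

namespace IsRun

variable [CompleteSpace V] {z0 : ℕ → V} {N : ℕ} {P : ℕ → PredState V} {b : ℕ → Bool} {y : ℕ → V}

lemma valid (h : IsRun p α K z0 N P b y) (hz : ∀ i, z0 i ∈ K) (hc : IsClosed K)
    (hK : Convex ℝ K) : ∀ τ, 1 ≤ τ → τ ≤ N + 1 → (P τ).Valid K τ := by
  intro τ hτ
  induction τ, hτ using Nat.le_induction with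
  | base => intro _; rw [h.init]; exact Valid.init hz
  | succ τ hτ ih =>
    intro hN
    rw [h.step τ hτ (by omega)]
    exact (ih (by omega)).step hc hK

/-- The newborn weight is at least `1 / i`, and the factors `τ / (τ + 1)` telescope to `i / e`. Each
multiplicative update gains the exponential of `α` times the loss difference, because the partition
function is at most the exponential weight of the played point. -/
lemma weight_ge (h : IsRun p α K z0 N P b y) (hz : ∀ i, z0 i ∈ K) (hc : IsClosed K)
    (hK : Convex ℝ K) {R : ℝ} (hp : 0 < p) (hα : 0 ≤ α) (hαR : α * R ^ 2 ≤ p)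
    (hR : ∀ τ, 1 ≤ τ → τ ≤ N → b τ = true → ∀ z ∈ K, ‖z - y τ‖ ≤ R) {i : ℕ} (hi : 1 ≤ i) :
    ∀ e, i ≤ e → e ≤ N + 1 → e ≤ i + (2 ^ (padicValNat 2 i + 2) + 1) →
      1 / (e : ℝ) * Real.exp (α * ∑ τ ∈ Ico i e,
        (loss p (b τ) (y τ) ((P τ).play τ) - loss p (b τ) (y τ) ((P τ).z i))) ≤ (P e).q i := by
  intro e he
  induction e, he using Nat.le_induction with
  | base =>
    intro hN _
    simp only [Finset.Ico_self, Finset.sum_empty, mul_zero, Real.exp_zero, mul_one]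
    rcases hi.eq_or_lt with rfl | hi
    · rw [h.init]; simp [PredState.init]
    · obtain ⟨j, rfl⟩ : ∃ j, i = j + 1 := ⟨i - 1, by omega⟩
      rw [h.step j (by omega) (by omega)]
      refine le_trans (le_of_eq ?_) ((h.valid hz hc hK j (by omega)
        (by omega)).proxyWeight_le_step (self_mem_workingSet (by omega)))
      rw [proxyWeight_self]; push_cast; rfl
  | succ e he ih =>
    intro hN hl
    have ih := ih (by omega) (by omega)
    have hV := h.valid hz hc hK e (by omega) (by omega)
    rw [h.step e (by omega) (by omega)]
    refine le_trans ?_ (hV.proxyWeight_le_step (by rw [mem_workingSet]; omega))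
    have hne : i ≠ e + 1 := by omega
    rw [proxyWeight, if_neg hne]
    set Z := ∑ j ∈ workingSet e, (P e).q j * Real.exp (-α * loss p (b e) (y e) ((P e).z j))
    have hZ : 0 < Z := hV.partition_pos _
    have hZ2 : Z ≤ Real.exp (-α * loss p (b e) (y e) ((P e).play e)) :=
      hV.partition_le hp hα hαR (hR e (by omega) (by omega))
    rw [Finset.sum_Ico_succ_top he, mul_add, Real.exp_add]
    set X := Real.exp (α * ∑ τ ∈ Ico i e,
      (loss p (b τ) (y τ) ((P τ).play τ) - loss p (b τ) (y τ) ((P τ).z i)))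
    have he0 : (0 : ℝ) < e := by exact_mod_cast (by omega : 0 < e)
    have h1 : Real.exp (α * (loss p (b e) (y e) ((P e).play e) - loss p (b e) (y e) ((P e).z i)))
        ≤ Real.exp (-α * loss p (b e) (y e) ((P e).z i)) / Z := by
      rw [le_div_iff₀ hZ]
      calc _ ≤ Real.exp (α * (loss p (b e) (y e) ((P e).play e) -
            loss p (b e) (y e) ((P e).z i))) *
              Real.exp (-α * loss p (b e) (y e) ((P e).play e)) := by gcongr
        _ = _ := by rw [← Real.exp_add]; congr 1; ring
    calc _ = (e : ℝ) / (e + 1) * ((1 / (e : ℝ) * X) * Real.exp (α * (loss p (b e) (y e)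
          ((P e).play e) - loss p (b e) (y e) ((P e).z i)))) := by
          push_cast; field_simp
      _ ≤ (e : ℝ) / (e + 1) * ((P e).q i *
          (Real.exp (-α * loss p (b e) (y e) ((P e).z i)) / Z)) := by
          gcongr
          exact hV.nonneg i
      _ = _ := by ring

/-- Regret of the played iterates against an instance during its life time. -/
lemma sum_loss_play_sub_le (h : IsRun p α K z0 N P b y) (hz : ∀ i, z0 i ∈ K) (hc : IsClosed K)
    (hK : Convex ℝ K) {R : ℝ} (hp : 0 < p) (hα : 0 < α) (hαR : α * R ^ 2 ≤ p)
    (hR : ∀ τ, 1 ≤ τ → τ ≤ N → b τ = true → ∀ z ∈ K, ‖z - y τ‖ ≤ R) {i e : ℕ} (hi : 1 ≤ i)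
    (hie : i ≤ e) (heN : e ≤ N) (he : e < i + 2 ^ padicValNat 2 i) :
    ∑ τ ∈ Icc i e, (loss p (b τ) (y τ) ((P τ).play τ) - loss p (b τ) (y τ) ((P τ).z i)) ≤
      Real.log (e + 1) / α := by
  -- A dyadic piece has length at most `2 ^ v`, while the instance stays active for about four times
  -- as long; in particular its weight in round `e + 1` still exists and is at most one.
  have h2 : 2 ^ (padicValNat 2 i + 2) = 4 * 2 ^ padicValNat 2 i := by ring
  have h1 := h.weight_ge hz hc hK hp hα.le hαR hR hi (e + 1) (by omega) (by omega) (by omega)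
  rw [Finset.Ico_add_one_right_eq_Icc] at h1
  have hV := h.valid hz hc hK (e + 1) (by omega) (by omega)
  have h3 : (P (e + 1)).q i ≤ 1 := by
    rw [← hV.sum_eq]
    exact Finset.single_le_sum (fun j _ => hV.nonneg j) (by rw [mem_workingSet]; omega)
  have h4 := h1.trans h3
  push_cast at h4
  rw [one_div, inv_mul_le_iff₀ (by positivity), mul_one] at h4
  rw [le_div_iff₀ hα, mul_comm, Real.le_log_iff_exp_le (by positivity)]
  exact h4

lemma instance_step (h : IsRun p α K z0 N P b y) {i τ : ℕ} (hi : 1 ≤ i) (hiτ : i ≤ τ)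
    (hτ : τ < i + 2 ^ padicValNat 2 i) (hN : τ ≤ N) :
    (P (τ + 1)).z i = proj K ((P τ).z i - (1 / ((τ : ℝ) - i + 1)) •
      grad p (b τ) (y τ) ((P τ).z i)) := by
  have h2 : 2 ^ (padicValNat 2 i + 2) = 4 * 2 ^ padicValNat 2 i := by ring
  have hm : i ∈ workingSet τ := by rw [mem_workingSet]; omega
  rw [h.step τ (by omega) hN]
  simp [PredState.step, hm]

end IsRun

end PredState

end

/-! ### Trajectories of Ada-Ctrl -/

namespace AdaCtrl

variable {dx du m : ℕ} (a : AdaCtrl dx du m) (S : LTV dx du) (b : ℕ → Bool)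
  (e : ℕ → Fin du → Bool)

/-- The state at time `t`. -/
def xs (t : ℕ) : Vec dx := (a.run S b e (t - 1)).x t

/-- The input at time `t`. -/
def us (t : ℕ) : Vec du := (a.run S b e t).u t

/-- The estimate of Nature's x at time `t`. -/
def ys (t : ℕ) : Vec dx := (a.run S b e (t - 1)).y t

/-- The operator estimate at time `t`. -/
def gh (t : ℕ) : OpSeq a.h dx du := (a.run S b e t).Ghat

/-- The DRC parameter at time `t`. -/
def ms (t : ℕ) : OpSeq m du dx := (a.run S b e (t - 1)).M

/-- The state of Ada-Pred before epoch `τ`. -/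
def preds (τ : ℕ) : PredState (OpSeq a.h dx du) := (a.run S b e ((τ - 1) * a.h)).pred

/-- The one-point estimate made at the end of epoch `τ`. -/
def est (τ : ℕ) : OpSeq a.h dx du :=
  estimate (a.xs S b e (τ * a.h + 1)) (a.us S b e) (τ * a.h)

/-- The epoch of time `t`. -/
def epoch (t : ℕ) : ℕ := (t - 1) / a.h + 1

/-- A round writes only at the newest index, so all the histories stored along the run are
restrictions of one sequence. The same holds for `y` and `u`. -/
lemma run_x {s t : ℕ} (h : s ≤ t + 1) : (a.run S b e t).x s = a.xs S b e s := by
  induction t with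
  | zero =>
    have : s - 1 = 0 := by omega
    rw [xs, this]
  | succ t ih =>
    rcases h.eq_or_lt with rfl | h
    · rfl
    · rw [← ih (by omega)]
      simp only [run, step]
      rw [Function.update_of_ne (by omega)]

lemma run_y {s t : ℕ} (h : s ≤ t + 1) : (a.run S b e t).y s = a.ys S b e s := by
  induction t with
  | zero =>
    have : s - 1 = 0 := by omega
    rw [ys, this]
  | succ t ih =>
    rcases h.eq_or_lt with rfl | h
    · rfl
    · rw [← ih (by omega)]
      simp only [run, step]
      rw [Function.update_of_ne (by omega)]

lemma run_u {s t : ℕ} (h : s ≤ t) : (a.run S b e t).u s = a.us S b e s := by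
  induction t with
  | zero =>
    obtain rfl : s = 0 := by omega
    rfl
  | succ t ih =>
    rcases h.eq_or_lt with rfl | h
    · rfl
    · rw [← ih (by omega)]
      simp only [run, step]
      rw [Function.update_of_ne (by omega)]

@[simp] lemma xs_one : a.xs S b e 1 = 0 := rfl
@[simp] lemma ys_zero : a.ys S b e 0 = 0 := rfl
@[simp] lemma ys_one : a.ys S b e 1 = 0 := rfl
@[simp] lemma gh_zero : a.gh S b e 0 = 0 := rfl

lemma us_eq {t : ℕ} (ht : 1 ≤ t) : a.us S b e t =
    if b (a.epoch t) then signs (e t) else LTV.drcInput (a.ms S b e t) (a.ys S b e) t := by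
  obtain ⟨t, rfl⟩ : ∃ k, t = k + 1 := ⟨t - 1, by omega⟩
  have : LTV.drcInput (a.run S b e t).M (a.run S b e t).y (t + 1) =
      LTV.drcInput (a.ms S b e (t + 1)) (a.ys S b e) (t + 1) :=
    LTV.drcInput_congr _ fun s hs => a.run_y S b e (Finset.mem_Icc.1 hs).2
  simp only [us, run, step, Function.update_self, epoch, this]
  rfl

lemma xs_succ {t : ℕ} (ht : 1 ≤ t) : a.xs S b e (t + 1) =
    app (S.A t) (a.xs S b e t) + app (S.B t) (a.us S b e t) + S.w t := by
  obtain ⟨t, rfl⟩ : ∃ k, t = k + 1 := ⟨t - 1, by omega⟩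
  have h1 : a.xs S b e (t + 1 + 1) = (a.run S b e (t + 1)).x (t + 1 + 1) := rfl
  rw [h1, ← a.run_x S b e (le_refl (t + 1)), ← a.run_u S b e (le_refl (t + 1))]
  simp only [run, step, Function.update_self]

lemma ys_succ {t : ℕ} (ht : 1 ≤ t) : a.ys S b e (t + 1) =
    proj (Metric.closedBall 0 a.Rnat) (a.xs S b e (t + 1) -
      ∑ i ∈ range a.h, if i < t then app (block (a.gh S b e t) i) (a.us S b e (t - i)) else 0) := by
  obtain ⟨t, rfl⟩ : ∃ k, t = k + 1 := ⟨t - 1, by omega⟩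
  have h1 : a.ys S b e (t + 1 + 1) = (a.run S b e (t + 1)).y (t + 1 + 1) := rfl
  have h2 : a.xs S b e (t + 1 + 1) = (a.run S b e (t + 1)).x (t + 1 + 1) := rfl
  have h3 : ∀ i, a.us S b e (t + 1 - i) = (a.run S b e (t + 1)).u (t + 1 - i) := fun i =>
    (a.run_u S b e (by omega)).symm
  rw [h1, h2, gh]
  simp only [h3]
  simp only [run, step, Function.update_self]

lemma ms_succ {t : ℕ} (ht : 1 ≤ t) : a.ms S b e (t + 1) =
    proj (opBall m du dx a.RM) (a.ms S b e t - a.η •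
      a.sg t (proxyLoss S t (a.run S b e (t - 1))) (a.ms S b e t)) := by
  obtain ⟨t, rfl⟩ : ∃ k, t = k + 1 := ⟨t - 1, by omega⟩
  rfl

lemma proxyLoss_run {t : ℕ} (ht : 1 ≤ t) (M : OpSeq m du dx) :
    proxyLoss S t (a.run S b e (t - 1)) M = S.c t
      (a.ys S b e t + ∑ i ∈ range a.h, if i < t - 1 then
        app (block (a.gh S b e (t - 1)) i) (LTV.drcInput M (a.ys S b e) (t - 1 - i)) else 0)
      (LTV.drcInput M (a.ys S b e) t) := by
  have h : ∀ s ≤ t, LTV.drcInput M (a.run S b e (t - 1)).y s =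
      LTV.drcInput M (a.ys S b e) s := fun s hs =>
    LTV.drcInput_congr _ fun s' hs' => a.run_y S b e (by rw [Finset.mem_Icc] at hs'; omega)
  rw [proxyLoss, h t le_rfl, a.run_y S b e (by omega)]
  congr 2
  refine Finset.sum_congr rfl fun i _ => ?_
  rw [h _ (by omega)]
  rfl

/-- Ada-Pred is updated only in the last round of an epoch, so its state is constant until then. -/
lemma run_pred_of_lt (hh : 0 < a.h) (τ n : ℕ) (hn : n < a.h) :
    (a.run S b e (τ * a.h + n)).pred = (a.run S b e (τ * a.h)).pred := by
  induction n with
  | zero => rfl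
  | succ n ih =>
    rw [← ih (by omega), ← add_assoc, run]
    simp only [step]
    rw [if_neg]
    intro h
    have h1 : (τ * a.h + n + 1 - 1) / a.h = τ := by
      rw [Nat.add_sub_cancel, mul_comm, Nat.mul_add_div hh, Nat.div_eq_of_lt (by omega), add_zero]
    rw [h1, add_mul] at h
    omega

lemma epoch_eq (hh : 0 < a.h) {τ n : ℕ} (hn : n < a.h) : a.epoch (τ * a.h + n + 1) = τ + 1 := by
  rw [epoch, Nat.add_sub_cancel, mul_comm, Nat.mul_add_div hh, Nat.div_eq_of_lt hn, add_zero]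

lemma exists_eq_epoch (hh : 0 < a.h) {t : ℕ} (ht : 1 ≤ t) :
    ∃ n < a.h, t = (a.epoch t - 1) * a.h + n + 1 := by
  refine ⟨(t - 1) % a.h, Nat.mod_lt _ hh, ?_⟩
  have := Nat.div_add_mod (t - 1) a.h
  rw [epoch, Nat.add_sub_cancel, mul_comm]
  omega

lemma gh_eq (hh : 0 < a.h) {t : ℕ} (ht : 1 ≤ t) :
    a.gh S b e t = (a.preds S b e (a.epoch t)).play (a.epoch t) := by
  obtain ⟨n, hn, h⟩ := a.exists_eq_epoch hh ht
  set τ := a.epoch t with hτ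
  have h2 : a.gh S b e ((τ - 1) * a.h + n + 1) =
    (a.run S b e ((τ - 1) * a.h + n)).pred.play (a.epoch ((τ - 1) * a.h + n + 1)) := rfl
  rw [h, h2, ← h, ← hτ, a.run_pred_of_lt S b e hh _ _ hn]
  rfl

lemma preds_succ (hh : 0 < a.h) {τ : ℕ} (hτ : 1 ≤ τ) : a.preds S b e (τ + 1) =
    (a.preds S b e τ).step a.p a.α (opBall a.h dx du a.RG) τ (b τ) (a.est S b e τ) := by
  obtain ⟨τ, rfl⟩ : ∃ k, τ = k + 1 := ⟨τ - 1, by omega⟩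
  obtain ⟨n, hn⟩ : ∃ n, a.h = n + 1 := ⟨a.h - 1, by omega⟩
  have h1 : (τ + 1) * a.h = τ * a.h + n + 1 := by rw [add_mul, one_mul]; omega
  have h2 : (τ * a.h + n + 1 - 1) / a.h + 1 = τ + 1 := a.epoch_eq hh (by omega)
  have h3 := a.run_pred_of_lt S b e hh τ n (by omega)
  have h4 : ∀ t, a.xs S b e (t + 1) = (a.run S b e t).x (t + 1) := fun _ => rfl
  have h5 : ∀ t, (estimate (a.xs S b e (t + 1)) (a.us S b e) t : OpSeq a.h dx du) =
      estimate ((a.run S b e t).x (t + 1)) (a.run S b e t).u t := by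
    intro t
    rw [h4]
    simp only [estimate]
    congr 1
    funext j
    rw [a.run_u S b e (by omega)]
  rw [est, h5, preds, Nat.add_sub_cancel, h1]
  conv_lhs => rw [run]
  simp only [step]
  rw [if_pos (by rw [h2, h1]), h2, h3]
  conv_rhs => rw [run]
  rw [Nat.add_sub_cancel] at h2
  simp only [step, Function.update_self, preds, Nat.add_sub_cancel, h2]

lemma isRun_preds (hh : 0 < a.h) (N : ℕ) : PredState.IsRun a.p a.α (opBall a.h dx du a.RG) a.z0 N
    (a.preds S b e) b (a.est S b e) where
  init := by simp [preds, run, init]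
  step _ hτ _ := a.preds_succ S b e hh hτ

/-- The data after `t` rounds depend only on the coins of the first `t` rounds. -/
lemma run_congr {b b' : ℕ → Bool} {e e' : ℕ → Fin du → Bool} {t : ℕ}
    (hb : ∀ s, 1 ≤ s → s ≤ t → b (a.epoch s) = b' (a.epoch s))
    (he : ∀ s, 1 ≤ s → s ≤ t → e s = e' s) : a.run S b e t = a.run S b' e' t := by
  induction t with
  | zero => rfl
  | succ t ih =>
    have h1 := hb (t + 1) (by omega) le_rfl
    simp only [epoch] at h1
    rw [run, run, ih (fun s h1 h2 => hb s h1 (by omega)) (fun s h1 h2 => he s h1 (by omega)),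
      step, step, h1, he (t + 1) (by omega) le_rfl]

lemma epoch_le {τ s : ℕ} (hh : 0 < a.h) (hs : s ≤ τ * a.h) (h1 : 1 ≤ s) : a.epoch s ≤ τ := by
  rw [epoch, Nat.add_one_le_iff, Nat.div_lt_iff_lt_mul hh]
  omega

/-- The first `(τ - 1) * a.h` rounds lie in epochs before `τ`. This is why the iterates of Ada-Pred
before epoch `τ` do not see the coins of that epoch. -/
lemma run_congr_epoch (hh : 0 < a.h) {b b' : ℕ → Bool} {e e' : ℕ → Fin du → Bool} {τ : ℕ}
    (hb : ∀ σ < τ, b σ = b' σ) (he : ∀ s ≤ (τ - 1) * a.h, e s = e' s) {t : ℕ}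
    (ht : t ≤ (τ - 1) * a.h) : a.run S b e t = a.run S b' e' t := by
  refine a.run_congr S (fun s h1 h2 => hb _ ?_) (fun s h1 h2 => he s (by omega))
  have := a.epoch_le hh (h2.trans ht) h1
  have h3 : 1 ≤ a.epoch s := by simp [epoch]
  omega

lemma us_congr_epoch (hh : 0 < a.h) {b b' : ℕ → Bool} {e e' : ℕ → Fin du → Bool} {τ : ℕ}
    (hb : ∀ σ < τ, b σ = b' σ) (he : ∀ s ≤ (τ - 1) * a.h, e s = e' s) {t : ℕ}
    (ht : t ≤ (τ - 1) * a.h) : a.us S b e t = a.us S b' e' t := by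
  rw [us, us, a.run_congr_epoch S hh hb he ht]

lemma preds_congr (hh : 0 < a.h) {b b' : ℕ → Bool} {e e' : ℕ → Fin du → Bool} {τ : ℕ}
    (hb : ∀ σ < τ, b σ = b' σ) (he : ∀ s ≤ (τ - 1) * a.h, e s = e' s) :
    a.preds S b e τ = a.preds S b' e' τ := by
  rw [preds, preds, a.run_congr_epoch S hh hb he le_rfl]

lemma xs_eq (t : ℕ) : a.xs S b e (t + 1) =
    S.xnat (t + 1) + ∑ i ∈ range t, app (S.markov t i) (a.us S b e (t - i)) :=
  S.trajectory_eq (N := t) (a.xs_one S b e) (fun _ h _ => a.xs_succ S b e h) t le_rfl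

/-- Inputs in exploration epochs are random signs. -/
lemma us_eq_signs (hh : 0 < a.h) {τ s : ℕ} (hτ : 1 ≤ τ) (hb : b τ = true)
    (h1 : (τ - 1) * a.h < s) (h2 : s ≤ τ * a.h) : a.us S b e s = signs (e s) := by
  have hτh : τ * a.h = (τ - 1) * a.h + a.h := by
    obtain ⟨τ, rfl⟩ : ∃ k, τ = k + 1 := ⟨τ - 1, by omega⟩
    rw [Nat.add_sub_cancel]; ring
  have h3 := a.epoch_eq hh (τ := τ - 1) (n := s - (τ - 1) * a.h - 1) (by omega)
  rw [show (τ - 1) * a.h + (s - (τ - 1) * a.h - 1) + 1 = s by omega,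
    Nat.sub_add_cancel hτ] at h3
  rw [a.us_eq S b e (by omega), h3, if_pos hb]

lemma norm_signs_sq (e : Fin du → Bool) : ‖signs e‖ ^ 2 = du := by
  rw [EuclideanSpace.norm_sq_eq]
  have : ∀ j, ‖(signs e) j‖ ^ 2 = 1 := by
    intro j; simp only [signs]; split_ifs <;> simp
  rw [Finset.sum_congr rfl fun j _ => this j]
  simp

end AdaCtrl

/-! ### Expectation over the coins of the algorithm -/

/-- The expectation over coins `b_0, …, b_T` with success probability `p` and uniform signs. -/
def coinExp (du T : ℕ) (p : ℝ)
    (f : (Fin (T + 1) → Bool) → (Fin (T + 1) → Fin du → Bool) → ℝ) : ℝ :=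
  ∑ b : Fin (T + 1) → Bool, ∑ e : Fin (T + 1) → Fin du → Bool,
    ((∏ τ, if b τ then p else 1 - p) * ∏ _t : Fin (T + 1), ∏ _j : Fin du, (1 / 2 : ℝ)) * f b e

section
variable {du T : ℕ} {p : ℝ}
variable {f g : (Fin (T + 1) → Bool) → (Fin (T + 1) → Fin du → Bool) → ℝ}

lemma coinExp_add (f g : (Fin (T + 1) → Bool) → (Fin (T + 1) → Fin du → Bool) → ℝ) :
    coinExp du T p (fun b e => f b e + g b e) = coinExp du T p f + coinExp du T p g := by
  simp only [coinExp, mul_add, Finset.sum_add_distrib]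

lemma coinExp_sub (f g : (Fin (T + 1) → Bool) → (Fin (T + 1) → Fin du → Bool) → ℝ) :
    coinExp du T p (fun b e => f b e - g b e) = coinExp du T p f - coinExp du T p g := by
  simp only [coinExp, mul_sub, Finset.sum_sub_distrib]

lemma coinExp_const_mul (c : ℝ) (f : (Fin (T + 1) → Bool) → (Fin (T + 1) → Fin du → Bool) → ℝ) :
    coinExp du T p (fun b e => c * f b e) = c * coinExp du T p f := by
  simp only [coinExp, Finset.mul_sum]
  exact Finset.sum_congr rfl fun _ _ => Finset.sum_congr rfl fun _ _ => by ring

lemma coinExp_sum {ι : Type*} (s : Finset ι)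
    (f : ι → (Fin (T + 1) → Bool) → (Fin (T + 1) → Fin du → Bool) → ℝ) :
    coinExp du T p (fun b e => ∑ i ∈ s, f i b e) = ∑ i ∈ s, coinExp du T p (f i) := by
  simp only [coinExp, Finset.mul_sum]
  rw [Finset.sum_comm]
  conv_lhs => enter [2, e]; rw [Finset.sum_comm]
  rw [Finset.sum_comm]
  refine Finset.sum_congr rfl fun i _ => ?_
  rw [Finset.sum_comm]

lemma coinWeight_nonneg (hp0 : 0 ≤ p) (hp1 : p ≤ 1) (b : Fin (T + 1) → Bool) :
    0 ≤ (∏ τ, if b τ then p else 1 - p) * ∏ _t : Fin (T + 1), ∏ _j : Fin du, (1 / 2 : ℝ) := by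
  refine mul_nonneg (Finset.prod_nonneg fun τ _ => ?_) (by positivity)
  split_ifs <;> linarith

lemma coinExp_mono (hp0 : 0 ≤ p) (hp1 : p ≤ 1) (h : ∀ b e, f b e ≤ g b e) :
    coinExp du T p f ≤ coinExp du T p g :=
  Finset.sum_le_sum fun b _ => Finset.sum_le_sum fun e _ =>
    mul_le_mul_of_nonneg_left (h b e) (coinWeight_nonneg hp0 hp1 b)

lemma coinExp_const (c : ℝ) : coinExp du T p (fun _ _ => c) = c := by
  have h1 : ∑ b : Fin (T + 1) → Bool, ∏ τ, (if b τ then p else 1 - p) = 1 := by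
    have := (Finset.prod_univ_sum (fun _ : Fin (T + 1) => (Finset.univ : Finset Bool))
      (fun _ x => if x then p else 1 - p)).symm
    rw [Fintype.piFinset_univ] at this
    rw [this]; simp
  simp only [coinExp]
  simp only [Finset.sum_const, ← Finset.sum_mul, ← Finset.smul_sum, h1, one_mul]
  simp only [Finset.prod_const, Finset.card_univ, Fintype.card_fin, Fintype.card_pi,
    Fintype.card_bool, nsmul_eq_mul]
  push_cast
  rw [← mul_assoc, ← mul_pow, ← mul_pow]
  norm_num

/-- Symmetry of a single sign. -/
lemma coinExp_flip (f : (Fin (T + 1) → Bool) → (Fin (T + 1) → Fin du → Bool) → ℝ)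
    (t : Fin (T + 1)) (j : Fin du) : coinExp du T p (fun b e =>
      f b (Function.update e t (Function.update (e t) j (!e t j)))) = coinExp du T p f := by
  simp only [coinExp]
  refine Finset.sum_congr rfl fun b _ => ?_
  have hinv : Function.Involutive fun e : Fin (T + 1) → Fin du → Bool =>
      Function.update e t (Function.update (e t) j (!e t j)) := by
    intro e; simp
  exact Equiv.sum_comp (hinv.toPerm _) fun e =>
    ((∏ τ, if b τ then p else 1 - p) * ∏ _t : Fin (T + 1), ∏ _j : Fin du, (1 / 2 : ℝ)) * f b e

/-- A coin is independent of what does not depend on it. -/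
lemma coinExp_ite (τ : Fin (T + 1))
    (hg : ∀ b e, g (Function.update b τ (!b τ)) e = g b e) :
    coinExp du T p (fun b e => if b τ then g b e else 0) = p * coinExp du T p g := by
  rw [← coinExp_const_mul, ← sub_eq_zero, ← coinExp_sub]
  have hinv : Function.Involutive fun b : Fin (T + 1) → Bool =>
      Function.update b τ (!b τ) := by
    intro b; simp
  set F : (Fin (T + 1) → Bool) → ℝ := fun b => ∑ e : Fin (T + 1) → Fin du → Bool,
    ((∏ τ, if b τ then p else 1 - p) * ∏ _t : Fin (T + 1), ∏ _j : Fin du, (1 / 2 : ℝ)) *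
      ((if b τ then g b e else 0) - p * g b e) with hF
  have h1 : ∑ b, F (hinv.toPerm _ b) = ∑ b, F b := Equiv.sum_comp (hinv.toPerm _) F
  -- The integrand carries the factor `p * (1 - p)` when the coin is up and `(1 - p) * (-p)` when it
  -- is down, and everything else is unchanged by the flip.
  have h2 : ∀ b, F (hinv.toPerm _ b) = - F b := by
    intro b
    simp only [hF, Function.Involutive.coe_toPerm, ← Finset.sum_neg_distrib]
    refine Finset.sum_congr rfl fun e _ => ?_
    rw [hg, ← Finset.mul_prod_erase _ _ (Finset.mem_univ τ),
      ← Finset.mul_prod_erase univ (fun τ => if b τ then p else 1 - p) (Finset.mem_univ τ)]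
    have h3 : ∏ x ∈ univ.erase τ, (if Function.update b τ (!b τ) x = true then p else 1 - p) =
        ∏ x ∈ univ.erase τ, (if b x = true then p else 1 - p) := by
      refine Finset.prod_congr rfl fun x hx => ?_
      rw [Function.update_of_ne (Finset.ne_of_mem_erase hx)]
    rw [h3, Function.update_self]
    cases b τ <;> simp <;> ring
  rw [Finset.sum_congr rfl fun b _ => h2 b, Finset.sum_neg_distrib] at h1
  change ∑ b, F b = 0
  linarith

end

/-! ### Expected regret of the operator estimates -/

/-- Periodic extension of a finite family. -/
def periodize {T : ℕ} {β : Type*} (f : Fin (T + 1) → β) (n : ℕ) : β := f (Fin.ofNat (T + 1) n)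

lemma periodize_update_self {T : ℕ} {β : Type*} (f : Fin (T + 1) → β) (n : ℕ) (v : β) :
    periodize (Function.update f (Fin.ofNat (T + 1) n) v) n = v := by
  simp [periodize]

/-- Reduction modulo `T + 1` is injective on 0, …, `T`. -/
lemma periodize_update_of_ne {T : ℕ} {β : Type*} (f : Fin (T + 1) → β) {n k : ℕ} (hn : n ≤ T)
    (hk : k ≤ T) (h : k ≠ n) (v : β) :
    periodize (Function.update f (Fin.ofNat (T + 1) n) v) k = periodize f k := by
  rw [periodize, Function.update_of_ne, periodize]
  intro h2
  apply h
  have := congrArg Fin.val h2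
  simpa [Fin.val_ofNat, Nat.mod_eq_of_lt (Nat.lt_succ_of_le hn),
    Nat.mod_eq_of_lt (Nat.lt_succ_of_le hk)] using this

/-- Dependence on the coins of the epochs before `τ` only, for epochs of length `h`. -/
def DependsOnPast {du : ℕ} {β : Type*} (h τ : ℕ)
    (F : (ℕ → Bool) → (ℕ → Fin du → Bool) → β) : Prop :=
  ∀ b b' e e', (∀ σ < τ, b σ = b' σ) → (∀ s ≤ (τ - 1) * h, e s = e' s) → F b e = F b' e'

namespace AdaCtrl

variable {dx du m : ℕ} (a : AdaCtrl dx du m) (S : LTV dx du)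

/-- The expectation of a function of the coins. -/
def coins (T : ℕ) (f : (ℕ → Bool) → (ℕ → Fin du → Bool) → ℝ) : ℝ :=
  coinExp du T a.p fun b e => f (periodize b) (periodize e)

lemma expRegret_eq (T r s : ℕ) :
    a.expRegret S T r s = a.coins T fun b e => a.regret S T r s b e := rfl

section
variable {a} {T : ℕ} {f g : (ℕ → Bool) → (ℕ → Fin du → Bool) → ℝ}

lemma coins_add (f g : (ℕ → Bool) → (ℕ → Fin du → Bool) → ℝ) :
    a.coins T (fun b e => f b e + g b e) = a.coins T f + a.coins T g :=
  coinExp_add _ _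

lemma coins_sub (f g : (ℕ → Bool) → (ℕ → Fin du → Bool) → ℝ) :
    a.coins T (fun b e => f b e - g b e) = a.coins T f - a.coins T g :=
  coinExp_sub _ _

lemma coins_const_mul (c : ℝ) (f : (ℕ → Bool) → (ℕ → Fin du → Bool) → ℝ) :
    a.coins T (fun b e => c * f b e) = c * a.coins T f :=
  coinExp_const_mul _ _

lemma coins_sum {ι : Type*} (s : Finset ι) (f : ι → (ℕ → Bool) → (ℕ → Fin du → Bool) → ℝ) :
    a.coins T (fun b e => ∑ i ∈ s, f i b e) = ∑ i ∈ s, a.coins T (f i) :=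
  coinExp_sum s fun i b e => f i (periodize b) (periodize e)

lemma coins_const (c : ℝ) : a.coins T (fun _ _ => c) = c := coinExp_const c

lemma coins_mono (hp0 : 0 ≤ a.p) (hp1 : a.p ≤ 1) (h : ∀ b e, f b e ≤ g b e) :
    a.coins T f ≤ a.coins T g :=
  coinExp_mono hp0 hp1 fun _ _ => h _ _

lemma coins_ite {h τ : ℕ} (hτT : τ ≤ T) (hg : DependsOnPast h τ g) :
    a.coins T (fun b e => if b τ then g b e else 0) = a.p * a.coins T g := by
  refine coinExp_ite (g := fun b e => g (periodize b) (periodize e)) (Fin.ofNat (T + 1) τ) fun b e => ?_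
  refine hg _ _ _ _ (fun σ hσ => ?_) fun _ _ => rfl
  exact periodize_update_of_ne b hτT (by omega) (by omega) _

lemma coins_coin {τ : ℕ} :
    a.coins T (fun b _ => if b τ then 1 else 0) = a.p := by
  have := coinExp_ite (du := du) (p := a.p) (T := T) (g := fun _ _ => 1) (Fin.ofNat (T + 1) τ)
    (fun _ _ => rfl)
  rw [coinExp_const, mul_one] at this
  exact this

end

/-- The one-point estimates are unbiased given the past. -/
lemma coins_est_entry {T τ : ℕ} (hh : 0 < a.h) (hτ : 1 ≤ τ) (hT : τ * a.h ≤ T)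
    {F : (ℕ → Bool) → (ℕ → Fin du → Bool) → ℝ} (hF : DependsOnPast a.h τ F)
    (j : Fin a.h × Fin dx × Fin du) :
    a.coins T (fun b e => if b τ then F b e * a.est S b e τ j else 0) =
      a.p * a.coins T (fun b e => F b e * S.markovVec a.h (τ * a.h) j) := by
  obtain ⟨i, r, c⟩ := j
  set t₀ := τ * a.h - i with ht₀
  have hi := i.2
  have hτh : τ * a.h = (τ - 1) * a.h + a.h := by
    obtain ⟨τ, rfl⟩ : ∃ k, τ = k + 1 := ⟨τ - 1, by omega⟩
    rw [Nat.add_sub_cancel]; ring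
  have hτT : τ ≤ T := le_trans (Nat.le_mul_of_pos_right τ hh) hT
  have hus : ∀ (b : ℕ → Bool) (e : ℕ → Fin du → Bool) s, b τ = true → (τ - 1) * a.h < s →
      s ≤ τ * a.h → a.us S b e s = signs (e s) := by
    intro b e s hb h1 h2
    exact a.us_eq_signs S b e hh hτ hb h1 h2
  set f : (ℕ → Bool) → (ℕ → Fin du → Bool) → ℝ :=
    fun b e => if b τ then F b e * a.est S b e τ (i, r, c) else 0 with hf
  have hflip := coinExp_flip (p := a.p) (fun b e => f (periodize b) (periodize e))
    (Fin.ofNat (T + 1) t₀) c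
  -- Pair each outcome with the one where coordinate `c` of the sign vector at time `t₀` is flipped.
  -- The estimate is a state coordinate times that sign σ, so the pair adds up to σ times the change
  -- of the state, which is `2 * σ * σ` times the Markov entry. Invariance under this one flip is
  -- all the independence that is needed.
  have hsum : a.coins T (fun b e => if b τ then
      2 * (F b e * S.markovVec a.h (τ * a.h) (i, r, c)) else 0) = 2 * a.coins T f := by
    rw [two_mul]
    nth_rw 2 [coins]
    rw [← hflip, coins, coins, ← coinExp_add]
    congr 1
    funext b e
    set e' := Function.update e (Fin.ofNat (T + 1) t₀)
      (Function.update (e (Fin.ofNat (T + 1) t₀)) c (!e (Fin.ofNat (T + 1) t₀) c)) with he'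
    simp only [hf]
    by_cases hb : periodize b τ = true
    swap
    · simp [hb]
    rw [if_pos hb, if_pos hb, if_pos hb]
    have hee : ∀ s ≤ T, s ≠ t₀ → periodize e s = periodize e' s := fun s hs hne =>
      (periodize_update_of_ne e (by omega) hs hne _).symm
    have hFF : F (periodize b) (periodize e') = F (periodize b) (periodize e) :=
      hF _ _ _ _ (fun _ _ => rfl) fun s hs => (hee s (by omega) (by omega)).symm
    have hu : ∀ s ≤ τ * a.h, s ≠ t₀ →
        a.us S (periodize b) (periodize e) s = a.us S (periodize b) (periodize e') s := by
      intro s hs hne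
      by_cases h : s ≤ (τ - 1) * a.h
      · exact a.us_congr_epoch S hh (fun _ _ => rfl)
          (fun s hs => hee s (by omega) (by omega)) h
      · rw [hus _ _ s hb (by omega) hs, hus _ _ s hb (by omega) hs, hee s (by omega) hne]
    have hu0 : a.us S (periodize b) (periodize e) t₀ = signs (periodize e t₀) :=
      hus _ _ _ hb (by omega) (by omega)
    have hu0' : a.us S (periodize b) (periodize e') t₀ = signs (periodize e' t₀) :=
      hus _ _ _ hb (by omega) (by omega)
    have he0' : periodize e' t₀ = Function.update (periodize e t₀) c (!periodize e t₀ c) :=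
      periodize_update_self e t₀ _
    -- Only lag `i` notices the flip: inputs before the epoch are fixed by the past, and every other
    -- input in the epoch is its own sign vector.
    have hx : a.xs S (periodize b) (periodize e) (τ * a.h + 1) -
        a.xs S (periodize b) (periodize e') (τ * a.h + 1) =
        app (S.markov (τ * a.h) i) (signs (periodize e t₀) - signs (periodize e' t₀)) := by
      rw [a.xs_eq, a.xs_eq, add_sub_add_left_eq_sub, ← Finset.sum_sub_distrib,
        Finset.sum_eq_single_of_mem (i : ℕ) (by rw [Finset.mem_range]; omega), ← app_sub, ← ht₀,
        hu0, hu0']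
      intro k hk hne
      rw [Finset.mem_range] at hk
      rw [hu (τ * a.h - k) (by omega) (by omega), sub_self]
    have hxr := congrArg (fun v : Vec dx => v r) hx
    simp only [PiLp.sub_apply, app_apply] at hxr
    rw [Finset.sum_eq_single c] at hxr
    rotate_left
    · intro c' _ hc'
      simp [signs, he0', Function.update_of_ne hc']
    · simp
    have hest : ∀ e : ℕ → Fin du → Bool, a.est S (periodize b) e τ (i, r, c) =
        a.xs S (periodize b) e (τ * a.h + 1) r * a.us S (periodize b) e t₀ c := fun e => rfl
    rw [hest, hest, hFF, hu0, hu0']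
    have hG : S.markovVec a.h (τ * a.h) (i, r, c) = S.markov (τ * a.h) i r c := rfl
    have hs : signs (periodize e' t₀) c = - signs (periodize e t₀) c := by
      simp only [signs, he0', Function.update_self]
      cases periodize e t₀ c <;> simp
    have hsq : signs (periodize e t₀) c * signs (periodize e t₀) c = 1 := by
      simp only [signs]
      cases periodize e t₀ c <;> simp
    rw [hs] at hxr ⊢
    rw [hG]
    linear_combination (-2 * F (periodize b) (periodize e) * S.markov (τ * a.h) i r c) * hsq -
      (F (periodize b) (periodize e) * signs (periodize e t₀) c) * hxr
  have h1 := coins_ite (a := a) (h := a.h) hτT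
    (g := fun b e => 2 * (F b e * S.markovVec a.h (τ * a.h) (i, r, c)))
    (fun b b' e e' h1 h2 => by simp only [hF b b' e e' h1 h2])
  rw [coins_const_mul] at h1
  linarith

/-- By linearity, unbiasedness extends to affine functions of the estimate whose coefficients come
from the past. Differences of squared losses and inner products with gradients have this form. -/
lemma coins_inner_est {T τ : ℕ} (hh : 0 < a.h) (hτ : 1 ≤ τ) (hT : τ * a.h ≤ T)
    {F : (ℕ → Bool) → (ℕ → Fin du → Bool) → OpSeq a.h dx du} (hF : DependsOnPast a.h τ F)
    {g : (ℕ → Bool) → (ℕ → Fin du → Bool) → ℝ} (hg : DependsOnPast a.h τ g) :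
    a.coins T (fun b e => if b τ then g b e + inner ℝ (F b e) (a.est S b e τ) else 0) =
      a.p * a.coins T (fun b e => g b e + inner ℝ (F b e) (S.markovVec a.h (τ * a.h))) := by
  have hτT : τ ≤ T := le_trans (Nat.le_mul_of_pos_right τ hh) hT
  have hin : ∀ v w : OpSeq a.h dx du, inner ℝ v w = ∑ j, v j * w j := by
    intro v w
    rw [PiLp.inner_apply]
    exact Finset.sum_congr rfl fun j _ => by simp [mul_comm]
  have h1 : a.coins T (fun b e => if b τ then g b e + inner ℝ (F b e) (a.est S b e τ) else 0) =
      a.coins T (fun b e => (if b τ then g b e else 0) +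
        ∑ j, if b τ then F b e j * a.est S b e τ j else 0) := by
    congr 1
    funext b e
    split_ifs <;> simp [hin]
  rw [h1, coins_add, coins_ite hτT hg, coins_sum, coins_add, mul_add]
  congr 1
  simp only [hin]
  rw [coins_sum, Finset.mul_sum]
  refine Finset.sum_congr rfl fun j _ => ?_
  exact a.coins_est_entry S hh hτ hT
    (fun b b' e e' h1 h2 => by rw [hF b b' e e' h1 h2]) j

/-- The expected adaptive regret of the operator estimates over a range of epochs. -/
lemma coins_sum_norm_play_sub_sq_le {T : ℕ} (hh : 0 < a.h) (hp : 0 < a.p) (hp1 : a.p ≤ 1)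
    (hα : 0 < a.α) {R : ℝ} (hαR : a.α * R ^ 2 = a.p)
    (hz0 : ∀ i, a.z0 i ∈ opBall a.h dx du a.RG)
    {τ₁ τ₂ : ℕ} (hR : ∀ b e τ, 1 ≤ τ → τ ≤ τ₂ → b τ = true → ∀ z ∈ opBall a.h dx du a.RG,
      ‖z - a.est S b e τ‖ ≤ R)
    {z : OpSeq a.h dx du} (hz : z ∈ opBall a.h dx du a.RG) (h1 : 1 ≤ τ₁) (h2 : τ₂ * a.h ≤ T) :
    ∑ τ ∈ Icc τ₁ τ₂, (a.coins T (fun b e =>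
      ‖(a.preds S b e τ).play τ - S.markovVec a.h (τ * a.h)‖ ^ 2) -
        ‖z - S.markovVec a.h (τ * a.h)‖ ^ 2) ≤
      (Nat.log 2 τ₂ + 1 : ℕ) * ((3 * Real.log (T + 1) + 1) * (R ^ 2 / a.p)) := by
  have hlogT : 0 ≤ Real.log (T + 1) := Real.log_nonneg (by
    have : (0 : ℝ) ≤ T := by positivity
    linarith)
  refine sum_Icc_le_of_dyadic (by positivity) (fun i n hi hin hn hnτ => ?_) h1
  have hnT : n * a.h ≤ T := le_trans (Nat.mul_le_mul_right _ hnτ) h2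
  have hc := isClosed_opBall a.h dx du a.RG
  have hK := convex_opBall a.h dx du a.RG
  have hloc : ∀ τ, τ ≤ n → τ * a.h ≤ T := fun τ h => le_trans (Nat.mul_le_mul_right _ h) hnT
  have hdep : ∀ τ, DependsOnPast a.h τ fun b e => a.preds S b e τ := fun τ b b' e e' hb he =>
    a.preds_congr S hh hb he
  have hRbool : ∀ b e τ, 1 ≤ τ → τ ≤ n → b τ = true → ∀ z ∈ opBall a.h dx du a.RG,
      ‖z - a.est S b e τ‖ ≤ R := fun b e τ h1 h2 => hR b e τ h1 (h2.trans hnτ)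
  have hmem : ∀ b e τ, 1 ≤ τ → τ ≤ n → (a.preds S b e τ).Valid (opBall a.h dx du a.RG) τ :=
    fun b e τ h1 h2 => (a.isRun_preds S b e hh n).valid hz0 hc hK τ h1 (by omega)
  set G : ℕ → OpSeq a.h dx du := fun τ => S.markovVec a.h (τ * a.h) with hG
  -- the played iterates against instance `i`
  have hA : ∑ τ ∈ Icc i n, (a.coins T (fun b e => ‖(a.preds S b e τ).play τ - G τ‖ ^ 2) -
      a.coins T (fun b e => ‖(a.preds S b e τ).z i - G τ‖ ^ 2)) ≤
      2 * (Real.log (T + 1) * (R ^ 2 / a.p)) := by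
    have e1 : ∀ τ ∈ Icc i n, a.coins T (fun b e => ‖(a.preds S b e τ).play τ - G τ‖ ^ 2) -
      a.coins T (fun b e => ‖(a.preds S b e τ).z i - G τ‖ ^ 2) = 2 * a.coins T (fun b e =>
        PredState.loss a.p (b τ) (a.est S b e τ) ((a.preds S b e τ).play τ) -
        PredState.loss a.p (b τ) (a.est S b e τ) ((a.preds S b e τ).z i)) := by
      intro τ hτ
      rw [Finset.mem_Icc] at hτ
      have h := a.coins_inner_est S hh (by omega : 1 ≤ τ) (hloc τ hτ.2)
        (F := fun b e => (-2 : ℝ) • ((a.preds S b e τ).play τ - (a.preds S b e τ).z i))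
        (g := fun b e => ‖(a.preds S b e τ).play τ‖ ^ 2 - ‖(a.preds S b e τ).z i‖ ^ 2)
        (fun b b' e e' h1 h2 => by simp only [hdep τ b b' e e' h1 h2])
        (fun b b' e e' h1 h2 => by simp only [hdep τ b b' e e' h1 h2])
      -- The squared norm of the target cancels in the difference, so the variance of the estimates
      -- plays no role here.
      have hexp : ∀ x y w : OpSeq a.h dx du, ‖x‖ ^ 2 - ‖y‖ ^ 2 + inner ℝ ((-2 : ℝ) • (x - y)) w =
          ‖x - w‖ ^ 2 - ‖y - w‖ ^ 2 := by
        intro x y w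
        rw [norm_sub_sq_real, norm_sub_sq_real, real_inner_smul_left, inner_sub_left]; ring
      simp only [hexp] at h
      rw [coins_sub] at h
      have h3 : a.coins T (fun b e =>
          PredState.loss a.p (b τ) (a.est S b e τ) ((a.preds S b e τ).play τ) -
          PredState.loss a.p (b τ) (a.est S b e τ) ((a.preds S b e τ).z i)) =
          1 / (2 * a.p) * a.coins T (fun b e => if b τ then
            ‖(a.preds S b e τ).play τ - a.est S b e τ‖ ^ 2 -
              ‖(a.preds S b e τ).z i - a.est S b e τ‖ ^ 2 else 0) := by
        rw [← coins_const_mul]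
        congr 1
        funext b e
        simp only [PredState.loss]
        split_ifs <;> ring
      rw [h3, h]
      simp only [hG]
      field_simp
    rw [Finset.sum_congr rfl e1, ← Finset.mul_sum, ← coins_sum]
    refine mul_le_mul_of_nonneg_left ?_ (by norm_num)
    refine (coins_mono hp.le hp1 (g := fun _ _ => Real.log (T + 1) * (R ^ 2 / a.p))
      fun b e => ?_).trans_eq (coins_const _)
    refine ((a.isRun_preds S b e hh n).sum_loss_play_sub_le hz0 hc hK hp hα hαR.le
      (hRbool b e) hi hin le_rfl hn).trans ?_
    have hnT' : (n : ℝ) ≤ T := by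
      exact_mod_cast le_trans (Nat.le_mul_of_pos_right n hh) hnT
    have h5 : Real.log (n + 1) ≤ Real.log (T + 1) :=
      Real.log_le_log (by positivity) (by linarith)
    have h6 : R ^ 2 / a.p = 1 / a.α := by
      have hR0 : R ≠ 0 := by
        rintro rfl; norm_num at hαR; linarith
      rw [← hαR]; field_simp
    rw [h6, mul_one_div]
    gcongr
  -- instance `i` against `z`
  set D : ℕ → ℝ := fun τ => a.coins T (fun b e => ‖(a.preds S b e τ).z i - z‖ ^ 2) with hD
  set B : ℕ → ℝ := fun τ => a.coins T (fun b e => ‖(a.preds S b e τ).z i - G τ‖ ^ 2) -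
    ‖z - G τ‖ ^ 2 with hB
  -- `2⟪x - w, x - z⟫ = ‖x - w‖² + ‖x - z‖² - ‖z - w‖²` makes the gradient term equal to `B + D`.
  -- With stepsize `1 / (k + 1)`, the extra `D` turns `(k + 1) * D` into `k * D`, so the distances
  -- telescope. The squared gradient, of size `R ^ 2 / p ^ 2` but present only with probability `p`,
  -- leaves a harmonic sum.
  have hstep : ∀ k, i + k ≤ n → B (i + k) ≤
      k * D (i + k) - (k + 1) * D (i + k + 1) + R ^ 2 / a.p * (1 / (k + 1)) := by
    intro k hk
    set τ := i + k with hτ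
    have hpt : ∀ b e, (k + 1 : ℝ) * ‖(a.preds S b e (τ + 1)).z i - z‖ ^ 2 ≤
        (k + 1) * ‖(a.preds S b e τ).z i - z‖ ^ 2 -
        (2 / a.p) * (if b τ then inner ℝ ((a.preds S b e τ).z i) ((a.preds S b e τ).z i - z) +
          inner ℝ (-((a.preds S b e τ).z i - z)) (a.est S b e τ) else 0) +
        (1 / (k + 1) * (R ^ 2 / a.p ^ 2)) * (if b τ then 1 else 0) := by
      intro b e
      have h3 := norm_proj_step_sq_le hc hK ((a.preds S b e τ).z i)
        (PredState.grad a.p (b τ) (a.est S b e τ) ((a.preds S b e τ).z i))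
        (1 / ((τ : ℝ) - i + 1)) hz
      rw [← (a.isRun_preds S b e hh n).instance_step hi (by omega) (by omega) hk,
        show (τ : ℝ) - i + 1 = k + 1 by rw [hτ]; push_cast; ring] at h3
      have hk1 : (0 : ℝ) < k + 1 := by positivity
      have h4 := mul_le_mul_of_nonneg_left h3 hk1.le
      refine h4.trans ?_
      by_cases hb : b τ = true
      · simp only [PredState.grad, hb, if_true]
        have h5 : ‖(a.preds S b e τ).z i - a.est S b e τ‖ ^ 2 ≤ R ^ 2 := by
          have := hRbool b e τ (by omega) hk hb _ ((hmem b e τ (by omega) hk).mem i)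
          gcongr
        rw [real_inner_smul_left, norm_smul, inner_sub_left, mul_pow, inner_neg_left,
          real_inner_comm (a.est S b e τ), Real.norm_eq_abs, sq_abs]
        rw [← sub_nonneg]
        have h6 : 0 ≤ (1 / ((k : ℝ) + 1)) * (1 / a.p ^ 2) *
          (R ^ 2 - ‖(a.preds S b e τ).z i - a.est S b e τ‖ ^ 2) := by
          have : 0 ≤ R ^ 2 - ‖(a.preds S b e τ).z i - a.est S b e τ‖ ^ 2 := by linarith
          positivity
        refine h6.trans (le_of_eq ?_)
        field_simp
        ring
      · simp [PredState.grad, hb]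
    have h7 := coins_mono (T := T) hp.le hp1 hpt
    rw [coins_const_mul, coins_add, coins_sub, coins_const_mul, coins_const_mul, coins_const_mul,
      coins_coin, a.coins_inner_est S hh (by omega : 1 ≤ τ) (hloc τ hk)
        (F := fun b e => -((a.preds S b e τ).z i - z))
        (g := fun b e => inner ℝ ((a.preds S b e τ).z i) ((a.preds S b e τ).z i - z))
        (fun b b' e e' h1 h2 => by simp only [hdep τ b b' e e' h1 h2])
        (fun b b' e e' h1 h2 => by simp only [hdep τ b b' e e' h1 h2])] at h7
    have h8 : 2 * a.coins T (fun b e => inner ℝ ((a.preds S b e τ).z i)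
        ((a.preds S b e τ).z i - z) + inner ℝ (-((a.preds S b e τ).z i - z)) (G τ)) =
        B τ + D τ := by
      have : ∀ x w : OpSeq a.h dx du, inner ℝ x (x - z) + inner ℝ (-(x - z)) w =
          (1 / 2) * (‖x - w‖ ^ 2 + ‖x - z‖ ^ 2 - ‖z - w‖ ^ 2) := by
        intro x w
        rw [norm_sub_sq_real, norm_sub_sq_real, norm_sub_sq_real, inner_neg_left, inner_sub_left,
          inner_sub_right, real_inner_self_eq_norm_sq]
        ring
      simp only [this]
      rw [coins_const_mul, coins_sub, coins_add, coins_const]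
      simp only [hB, hD]
      ring
    have h9 : 2 / a.p * (a.p * a.coins T (fun b e => inner ℝ ((a.preds S b e τ).z i)
        ((a.preds S b e τ).z i - z) + inner ℝ (-((a.preds S b e τ).z i - z)) (G τ))) =
        B τ + D τ := by
      rw [← h8]; field_simp
    rw [h9] at h7
    have h10 : 1 / ((k : ℝ) + 1) * (R ^ 2 / a.p ^ 2) * a.p = R ^ 2 / a.p * (1 / (k + 1)) := by
      field_simp
    rw [h10] at h7
    simp only [hD] at h7 ⊢
    linarith
  have htel : ∀ N, i + N ≤ n + 1 → ∑ k ∈ range N, B (i + k) ≤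
      - (N * D (i + N)) + R ^ 2 / a.p * ∑ k ∈ range N, (1 / ((k : ℝ) + 1)) := by
    intro N
    induction N with
    | zero => intro _; simp
    | succ N ih =>
      intro hN
      rw [Finset.sum_range_succ, Finset.sum_range_succ, mul_add]
      have h3 := ih (by omega)
      have h4 := hstep N (by omega)
      rw [← add_assoc i N 1]
      push_cast
      linarith
  have hBsum : ∑ τ ∈ Icc i n, B τ ≤ (Real.log (T + 1) + 1) * (R ^ 2 / a.p) := by
    have h3 := htel (n + 1 - i) (by omega)
    rw [← Finset.Ico_add_one_right_eq_Icc, Finset.sum_Ico_eq_sum_range]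
    refine h3.trans ?_
    have h4 : 0 ≤ D (i + (n + 1 - i)) := by
      rw [hD]
      have := coins_mono (a := a) (T := T) hp.le hp1 (f := fun _ _ => 0)
        (g := fun b e => ‖(a.preds S b e (i + (n + 1 - i))).z i - z‖ ^ 2)
        (fun _ _ => by positivity)
      rwa [coins_const] at this
    have h5 : ∑ k ∈ range (n + 1 - i), (1 / ((k : ℝ) + 1)) ≤ Real.log (T + 1) + 1 := by
      have h6 := harmonic_le_one_add_log (n + 1 - i)
      have h7 : ((harmonic (n + 1 - i) : ℚ) : ℝ) =
          ∑ k ∈ range (n + 1 - i), (1 / ((k : ℝ) + 1)) := by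
        simp [harmonic]
      rw [h7] at h6
      have h8 : Real.log ((n + 1 - i : ℕ) : ℝ) ≤ Real.log (T + 1) := by
        refine Real.log_le_log (by exact_mod_cast (by omega : 0 < n + 1 - i)) ?_
        have : n ≤ T := le_trans (Nat.le_mul_of_pos_right n hh) hnT
        exact_mod_cast (by omega : n + 1 - i ≤ T + 1)
      linarith
    have h6 : 0 ≤ ((n + 1 - i : ℕ) : ℝ) * D (i + (n + 1 - i)) := by positivity
    have h7 := mul_le_mul_of_nonneg_left h5 (by positivity : 0 ≤ R ^ 2 / a.p)
    linarith
  have hfin := add_le_add hA hBsum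
  rw [← Finset.sum_add_distrib] at hfin
  refine (le_of_eq (Finset.sum_congr rfl fun τ _ => ?_)).trans (hfin.trans (le_of_eq (by ring)))
  simp only [hB, hG]
  ring

end AdaCtrl

/-! ### Pathwise analysis of the controller -/

/-- Each shift by one loses the last term and brings in one new term at the left end, at most `B`.
Truncated subtraction merely repeats the value at 0. -/
lemma sum_Icc_sub_le {f : ℕ → ℝ} {B : ℝ} {r s : ℕ} (h0 : ∀ t ≤ s, 0 ≤ f t)
    (hB : ∀ t ≤ s, f t ≤ B) (hr : 1 ≤ r) (j : ℕ) :
    ∑ t ∈ Icc r s, f (t - j) ≤ ∑ t ∈ Icc r s, f t + j * B := by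
  have hB0 : 0 ≤ B := (h0 0 (by omega)).trans (hB 0 (by omega))
  rcases lt_or_ge s r with hsr | hrs
  · rw [Finset.Icc_eq_empty (by omega)]; simp; positivity
  induction j with
  | zero => simp
  | succ j ih =>
    have key : ∑ t ∈ Icc r s, f (t - (j + 1)) ≤ ∑ t ∈ Icc r s, f (t - j) + B := by
      have e1 : ∑ t ∈ Icc r s, f (t - (j + 1)) = ∑ t ∈ Icc (r - 1) (s - 1), f (t - j) := by
        refine Finset.sum_bij' (fun t _ => t - 1) (fun t _ => t + 1) ?_ ?_ ?_ ?_ ?_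
        · intro t ht; rw [Finset.mem_Icc] at *; omega
        · intro t ht; rw [Finset.mem_Icc] at *; omega
        · intro t ht; rw [Finset.mem_Icc] at ht; omega
        · intro t ht; omega
        · intro t ht; congr 1; omega
      have e2 : Icc (r - 1) (s - 1) ⊆ insert (r - 1) (Icc r s) := by
        intro t ht
        rw [Finset.mem_insert, Finset.mem_Icc]
        rw [Finset.mem_Icc] at ht
        omega
      rw [e1]
      calc _ ≤ ∑ t ∈ insert (r - 1) (Icc r s), f (t - j) :=
            Finset.sum_le_sum_of_subset_of_nonneg e2 fun t ht _ => h0 _ (by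
              rw [Finset.mem_insert, Finset.mem_Icc] at ht; omega)
        _ = f (r - 1 - j) + ∑ t ∈ Icc r s, f (t - j) :=
            Finset.sum_insert (by rw [Finset.mem_Icc]; omega)
        _ ≤ _ := by linarith [hB (r - 1 - j) (by omega)]
    push_cast
    linarith

namespace AdaCtrl

variable {dx du m : ℕ} (a : AdaCtrl dx du m) (S : LTV dx du) (b : ℕ → Bool)
  (e : ℕ → Fin du → Bool)

/-- A bound on all radii. -/
def radius : ℝ := 1 + a.Rnat + a.RG + a.RM

/-- The error of the operator estimate at time `t`. -/
def predErr (t : ℕ) : ℝ := ∑ i ∈ range a.h, opNorm (block (a.gh S b e t) i - S.markov t i)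

/-- The error of the estimate of Nature's x at time `t`. -/
def natErr (t : ℕ) : ℝ := ‖a.ys S b e t - S.xnat t‖

/-- The number of exploration epochs among the current and the previous one. -/
def explored (t : ℕ) : ℝ :=
  (if b (a.epoch t) then 1 else 0) + (if b (a.epoch t - 1) then 1 else 0)

/-- Replacing the true operator by its estimate in a convolution. -/
lemma norm_conv_sub_le (t : ℕ) {u u' : ℕ → Vec du} {U : ℝ} (hU : 0 ≤ U)
    (hu : ∀ i < a.h, i < t → ‖u' (t - i)‖ ≤ U) :
    ‖∑ i ∈ range a.h, app (S.markov t i) (u (t - i)) - ∑ i ∈ range a.h, (if i < t then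
      app (block (a.gh S b e t) i) (u' (t - i)) else 0)‖ ≤
      ∑ i ∈ range a.h, opNorm (S.markov t i) * ‖u (t - i) - u' (t - i)‖ +
        a.predErr S b e t * U := by
  rw [← Finset.sum_sub_distrib, predErr, Finset.sum_mul, ← Finset.sum_add_distrib]
  refine norm_sum_le_of_le _ fun i hi => ?_
  split_ifs with h
  · have e1 : app (S.markov t i) (u (t - i)) - app (block (a.gh S b e t) i) (u' (t - i)) =
        app (S.markov t i) (u (t - i) - u' (t - i)) -
          app (block (a.gh S b e t) i - S.markov t i) (u' (t - i)) := by
      rw [app_sub, sub_app]; abel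
    rw [e1]
    refine (norm_sub_le _ _).trans (add_le_add (norm_app_le _ _) ((norm_app_le _ _).trans ?_))
    exact mul_le_mul_of_nonneg_left (hu i (by simpa using hi) h) (opNorm_nonneg _)
  · rw [S.markov_of_ge (not_lt.1 h), zero_app, sub_zero, norm_zero]
    exact add_nonneg (mul_nonneg (opNorm_nonneg _) (norm_nonneg _))
      (mul_nonneg (opNorm_nonneg _) hU)

/-- The proxy state of the DRC parameter `M`. -/
def xhat (M : OpSeq m du dx) (t : ℕ) : Vec dx :=
  a.ys S b e t + ∑ i ∈ range a.h, if i < t - 1 then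
    app (block (a.gh S b e (t - 1)) i) (LTV.drcInput M (a.ys S b e) (t - 1 - i)) else 0

lemma natErr_nonneg (t : ℕ) : 0 ≤ a.natErr S b e t := norm_nonneg _

lemma predErr_nonneg (t : ℕ) : 0 ≤ a.predErr S b e t :=
  Finset.sum_nonneg fun _ _ => opNorm_nonneg _

/-- At time 0 both the estimate and the operator vanish, which keeps the index `t - 1` harmless in
round 1. -/
lemma predErr_zero : a.predErr S b e 0 = 0 := by
  refine Finset.sum_eq_zero fun i _ => ?_
  rw [gh_zero, block_zero, S.markov_of_ge (Nat.zero_le i), sub_zero, opNorm_zero]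

lemma explored_nonneg (t : ℕ) : 0 ≤ a.explored b t := by
  unfold explored; split_ifs <;> norm_num

lemma one_le_explored {b : ℕ → Bool} {t : ℕ} (h : a.explored b t ≠ 0) : 1 ≤ a.explored b t := by
  revert h; unfold explored; split_ifs <;> norm_num

/-- The assumptions on the environment and on the parameters that the analysis uses. -/
structure Setting (T : ℕ) (L ρ : ℝ) : Prop where
  adm : S.Admissible T L a.Rnat a.RG ρ
  L_pos : 0 < L
  Rnat_pos : 0 < a.Rnat
  RG_ge : 1 ≤ a.RG
  RM_pos : 0 < a.RM
  ρ_pos : 0 < ρ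
  du_pos : 0 < du
  m_pos : 1 ≤ m
  T_pos : 1 ≤ T
  h_pos : 0 < a.h
  ρ_pow : ρ ^ a.h ≤ 1 / T
  M1_mem : a.M1 ∈ opBall m du dx a.RM
  z0_mem : ∀ i, a.z0 i ∈ opBall a.h dx du a.RG
  sg_spec : ∀ t f, ConvexOn ℝ Set.univ f → ∀ M, IsSubgradient f M (a.sg t f M)
  η_pos : 0 < a.η
  η_le : a.η * (2 * L * a.RG ^ 2 * a.Rnat ^ 2 * √(T : ℝ)) ≤ √(du : ℝ)
  η_ge : 1 ≤ a.η * (8 * L * a.radius ^ 4 * (a.h : ℝ) ^ 2 * √(T : ℝ))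

namespace Setting

variable {a S} {T : ℕ} {L ρ : ℝ} (H : a.Setting S T L ρ)
include H

lemma two_le_radius : 2 ≤ a.radius := by
  have := H.Rnat_pos; have := H.RG_ge; have := H.RM_pos
  unfold radius; linarith

lemma Rnat_le : a.Rnat ≤ a.radius := by
  have := H.Rnat_pos; have := H.RG_ge; have := H.RM_pos
  unfold radius; linarith

lemma RG_le : a.RG ≤ a.radius := by
  have := H.Rnat_pos; have := H.RG_ge; have := H.RM_pos
  unfold radius; linarith

lemma RM_le : a.RM ≤ a.radius := by
  have := H.Rnat_pos; have := H.RG_ge; have := H.RM_pos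
  unfold radius; linarith

lemma RM_mul_Rnat_le : a.RM * a.Rnat ≤ a.radius ^ 2 := by
  rw [sq]; exact mul_le_mul H.RM_le H.Rnat_le H.Rnat_pos.le (by linarith [H.two_le_radius])

lemma one_le_sqrt_du : 1 ≤ √(du : ℝ) := by
  rw [Real.one_le_sqrt]; exact_mod_cast H.du_pos

lemma gh_mem (t : ℕ) : a.gh S b e t ∈ opBall a.h dx du a.RG := by
  rcases Nat.eq_zero_or_pos t with rfl | ht
  · rw [gh_zero]; exact zero_mem_opBall (by linarith [H.RG_ge])
  · have hK := convex_opBall a.h dx du a.RG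
    rw [a.gh_eq S b e H.h_pos ht]
    exact ((a.isRun_preds S b e H.h_pos (a.epoch t)).valid H.z0_mem (isClosed_opBall _ _ _ _) hK
      (a.epoch t) (by simp [epoch]) (by omega)).play_mem hK

lemma ms_mem {t : ℕ} (ht : 1 ≤ t) : a.ms S b e t ∈ opBall m du dx a.RM := by
  induction t, ht using Nat.le_induction with
  | base => exact H.M1_mem
  | succ t ht _ =>
    rw [a.ms_succ S b e ht]
    exact proj_mem ⟨_, H.M1_mem⟩ (isClosed_opBall _ _ _ _) (convex_opBall _ _ _ _) _

lemma norm_ys_le (t : ℕ) : ‖a.ys S b e t‖ ≤ a.Rnat := by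
  have h0 := H.Rnat_pos
  match t with
  | 0 => simpa using h0.le
  | 1 => simpa using h0.le
  | t + 2 =>
    rw [a.ys_succ S b e (by omega : 1 ≤ t + 1)]
    have := proj_mem (K := Metric.closedBall (0 : Vec dx) a.Rnat)
      (Metric.nonempty_closedBall.2 h0.le) Metric.isClosed_closedBall (convex_closedBall _ _)
      (a.xs S b e (t + 1 + 1) - ∑ i ∈ range a.h,
        if i < t + 1 then app (block (a.gh S b e (t + 1)) i) (a.us S b e (t + 1 - i)) else 0)
    simpa using this

lemma norm_uhat_le {M : OpSeq m du dx} (hM : M ∈ opBall m du dx a.RM) (t : ℕ) :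
    ‖LTV.drcInput M (a.ys S b e) t‖ ≤ a.RM * a.Rnat :=
  LTV.norm_drcInput_le hM H.Rnat_pos.le fun s _ => H.norm_ys_le b e s

lemma norm_us_le (t : ℕ) (ht : 1 ≤ t) :
    ‖a.us S b e t‖ ≤ max (√(du : ℝ)) (a.Rnat * a.RM) := by
  rw [a.us_eq S b e ht]
  split_ifs with h
  · refine le_max_of_le_left (le_of_eq ?_)
    rw [← norm_signs_sq (e t), Real.sqrt_sq (norm_nonneg _)]
  · refine le_max_of_le_right ?_
    rw [mul_comm]
    exact H.norm_uhat_le b e (H.ms_mem b e ht) t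

lemma max_sqrt_le : max (√(du : ℝ)) (a.Rnat * a.RM) ≤ a.radius ^ 2 * √(du : ℝ) := by
  have h1 := H.one_le_sqrt_du
  have h2 := H.two_le_radius
  have h3 := H.RM_mul_Rnat_le
  have h4 : 1 ≤ a.radius ^ 2 := by nlinarith
  refine max_le ?_ ?_
  · nlinarith
  · nlinarith

lemma norm_us_le' (t : ℕ) (ht : 1 ≤ t) : ‖a.us S b e t‖ ≤ a.radius ^ 2 * √(du : ℝ) :=
  (H.norm_us_le b e t ht).trans H.max_sqrt_le

lemma norm_xnat_le {t : ℕ} (ht : t ≤ T) : ‖S.xnat t‖ ≤ a.Rnat := by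
  rcases Nat.eq_zero_or_pos t with rfl | h
  · simpa using H.Rnat_pos.le
  · exact H.adm.xnat_le t (Finset.mem_Icc.2 ⟨h, ht⟩)

lemma norm_xs_le {t : ℕ} (ht : t + 1 ≤ T) :
    ‖a.xs S b e (t + 1)‖ ≤ a.Rnat + a.RG * max (√(du : ℝ)) (a.Rnat * a.RM) := by
  rw [a.xs_eq]
  refine (norm_add_le _ _).trans (add_le_add (H.norm_xnat_le ht) ?_)
  rcases Nat.eq_zero_or_pos t with rfl | h
  · have := H.RG_ge; simp; positivity
  · exact H.adm.norm_conv_le (Finset.mem_Icc.2 ⟨h, by omega⟩) t (by positivity)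
      fun i hi _ => H.norm_us_le b e _ (by omega)

lemma natErr_le {t : ℕ} (ht : t ≤ T) : a.natErr S b e t ≤ 2 * a.radius := by
  have := norm_sub_le (a.ys S b e t) (S.xnat t)
  have := H.norm_ys_le b e t
  have := H.norm_xnat_le ht
  have := H.Rnat_le
  unfold natErr
  linarith

lemma predErr_le {t : ℕ} (ht : t ≤ T) : a.predErr S b e t ≤ 2 * a.radius := by
  rcases Nat.eq_zero_or_pos t with rfl | h
  · rw [a.predErr_zero]; linarith [H.two_le_radius]
  have h1 : ∑ i ∈ range a.h, opNorm (block (a.gh S b e t) i) ≤ a.RG := H.gh_mem b e t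
  have h2 := H.adm.sum_markov_le (Finset.mem_Icc.2 ⟨h, ht⟩) a.h
  calc _ ≤ ∑ i ∈ range a.h, (opNorm (block (a.gh S b e t) i) + opNorm (S.markov t i)) :=
        Finset.sum_le_sum fun i _ => opNorm_sub_le _ _
    _ ≤ a.RG + a.RG := by rw [Finset.sum_add_distrib]; linarith
    _ ≤ _ := by linarith [H.RG_le]

/-- A window reaching back `h` rounds from `t` meets only the epoch of `t` and the one before it,
which are the two epochs counted by `explored`. -/
lemma us_eq_of_not_explored {t s : ℕ} (h : a.explored b t = 0) (hs : 1 ≤ s) (hst : s ≤ t)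
    (hts : t ≤ s + a.h) : a.us S b e s = LTV.drcInput (a.ms S b e s) (a.ys S b e) s := by
  have h1 : b (a.epoch t) = false ∧ b (a.epoch t - 1) = false := by
    revert h; unfold explored; split_ifs <;> norm_num; simp_all
  have h2 : a.epoch s = a.epoch t ∨ a.epoch s = a.epoch t - 1 := by
    have h3 : a.epoch s ≤ a.epoch t := by
      unfold epoch
      have : (s - 1) / a.h ≤ (t - 1) / a.h := Nat.div_le_div_right (by omega)
      omega
    have h4 : a.epoch t ≤ a.epoch s + 1 := by
      unfold epoch
      have : (t - 1) / a.h ≤ (s - 1 + a.h) / a.h := Nat.div_le_div_right (by omega)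
      rw [Nat.add_div_right _ H.h_pos] at this
      omega
    omega
  rw [a.us_eq S b e hs, if_neg]
  rcases h2 with h2 | h2 <;> rw [h2] <;> simp [h1]

/-- The epoch length makes ρ^h at most 1/T, so the truncation errors of all rounds together cost no
more than a single input bound. -/
lemma tail_le {t : ℕ} (ht : t ∈ Icc 1 T) {u : ℕ → Vec du} {U : ℝ} (hU : 0 ≤ U)
    (hu : ∀ s ∈ Icc 1 t, ‖u s‖ ≤ U) :
    ‖∑ i ∈ range t, app (S.markov t i) (u (t - i)) -
      ∑ i ∈ range a.h, app (S.markov t i) (u (t - i))‖ ≤ a.radius * U / T := by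
  have h0 : 0 ≤ a.RG := by linarith [H.RG_ge]
  refine (H.adm.norm_conv_sub_trunc_le ht a.h hU hu H.ρ_pos.le h0).trans ?_
  have hT : (0 : ℝ) < T := by exact_mod_cast H.T_pos
  calc _ ≤ a.radius * (1 / T) * U := by
        have := H.two_le_radius
        have := H.ρ_pos
        gcongr
        · exact H.RG_le
        · exact H.ρ_pow
    _ = _ := by ring

/-- Subtracting the estimated response from the state leaves Nature's x up to the operator error and
the tail, and projecting onto a ball that contains Nature's x cannot increase the error. If the
window contains exploration, the trivial bound is charged to `explored`. -/
lemma natErr_le_predErr {t : ℕ} (ht : t ∈ Icc 1 T) : a.natErr S b e t ≤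
    a.radius ^ 2 * a.predErr S b e (t - 1) + a.radius ^ 3 * √(du : ℝ) / T +
      2 * a.radius * a.explored b t := by
  rw [Finset.mem_Icc] at ht
  have hP := H.two_le_radius
  have hε := a.predErr_nonneg S b e (t - 1)
  have hx := a.explored_nonneg b t
  have h1 : 0 ≤ a.radius ^ 2 * a.predErr S b e (t - 1) := by positivity
  have h2 : 0 ≤ a.radius ^ 3 * √(du : ℝ) / T := by positivity
  by_cases hexp : a.explored b t = 0
  swap
  · have h3 := a.one_le_explored hexp
    have h4 := H.natErr_le b e ht.2
    nlinarith
  rw [hexp]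
  obtain ⟨k, rfl⟩ : ∃ k, t = k + 1 := ⟨t - 1, by omega⟩
  rcases Nat.eq_zero_or_pos k with rfl | hk
  · simp only [natErr, zero_add, ys_one, LTV.xnat_one, sub_zero, norm_zero]; linarith
  rw [natErr, a.ys_succ S b e hk]
  have hball : S.xnat (k + 1) ∈ Metric.closedBall (0 : Vec dx) a.Rnat := by
    simpa using H.norm_xnat_le ht.2
  refine (norm_proj_sub_le Metric.isClosed_closedBall (convex_closedBall _ _) _ hball).trans ?_
  have hkT : k ∈ Icc 1 T := Finset.mem_Icc.2 ⟨hk, by omega⟩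
  have ht1 := H.tail_le hkT (u := a.us S b e) (U := a.radius ^ 2 * √(du : ℝ)) (by positivity)
    fun s hs => H.norm_us_le' b e s (Finset.mem_Icc.1 hs).1
  -- Inside the window all inputs come from the controller and obey a bound free of dimension.
  -- Exploratory inputs, of norm `√du`, can enter only through the tail.
  have ht2 := a.norm_conv_sub_le S b e k (u := a.us S b e) (u' := a.us S b e)
    (U := a.radius ^ 2) (by positivity) fun i hi hik => by
      rw [H.us_eq_of_not_explored b e hexp (by omega) (by omega) (by omega)]
      exact (H.norm_uhat_le b e (H.ms_mem b e (by omega)) _).trans H.RM_mul_Rnat_le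
  simp only [sub_self, norm_zero, mul_zero, Finset.sum_const_zero, zero_add] at ht2
  have e1 : a.xs S b e (k + 1) - (∑ i ∈ range a.h, if i < k then
      app (block (a.gh S b e k) i) (a.us S b e (k - i)) else 0) - S.xnat (k + 1) =
      (∑ i ∈ range k, app (S.markov k i) (a.us S b e (k - i)) -
        ∑ i ∈ range a.h, app (S.markov k i) (a.us S b e (k - i))) +
      (∑ i ∈ range a.h, app (S.markov k i) (a.us S b e (k - i)) - ∑ i ∈ range a.h, if i < k then
        app (block (a.gh S b e k) i) (a.us S b e (k - i)) else 0) := by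
    rw [a.xs_eq]; abel
  rw [e1, Nat.add_sub_cancel]
  refine (norm_add_le _ _).trans ?_
  have e2 : a.radius * (a.radius ^ 2 * √(du : ℝ)) / T = a.radius ^ 3 * √(du : ℝ) / T := by ring
  linarith

lemma sum_natErr_le {r s : ℕ} (hr : 1 ≤ r) (hs : s ≤ T) : ∑ t ∈ Icc r s, a.natErr S b e t ≤
    a.radius ^ 2 * ∑ t ∈ Icc r s, a.predErr S b e (t - 1) + a.radius ^ 3 * √(du : ℝ) +
      2 * a.radius * ∑ t ∈ Icc r s, a.explored b t := by
  have hT : (0 : ℝ) < T := by exact_mod_cast H.T_pos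
  have hP := H.two_le_radius
  calc _ ≤ ∑ t ∈ Icc r s, (a.radius ^ 2 * a.predErr S b e (t - 1) +
        a.radius ^ 3 * √(du : ℝ) / T + 2 * a.radius * a.explored b t) :=
        Finset.sum_le_sum fun t ht => H.natErr_le_predErr b e (by
          rw [Finset.mem_Icc] at *; omega)
    _ = a.radius ^ 2 * ∑ t ∈ Icc r s, a.predErr S b e (t - 1) +
        #(Icc r s) * (a.radius ^ 3 * √(du : ℝ) / T) +
        2 * a.radius * ∑ t ∈ Icc r s, a.explored b t := by
        rw [Finset.sum_add_distrib, Finset.sum_add_distrib, Finset.sum_const, nsmul_eq_mul,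
          Finset.mul_sum, Finset.mul_sum]
    _ ≤ _ := by
        have h1 : (#(Icc r s) : ℝ) ≤ T := by
          rw [Nat.card_Icc]; exact_mod_cast (by omega : s + 1 - r ≤ T)
        have h2 : (#(Icc r s) : ℝ) * (a.radius ^ 3 * √(du : ℝ) / T) ≤
            T * (a.radius ^ 3 * √(du : ℝ) / T) := by gcongr
        rw [mul_div_cancel₀ _ hT.ne'] at h2
        linarith

lemma norm_xhat_le {M : OpSeq m du dx} (hM : M ∈ opBall m du dx a.RM) (t : ℕ) :
    ‖a.xhat S b e M t‖ ≤ a.radius + a.radius ^ 3 := by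
  have hP := H.two_le_radius
  refine (norm_add_le _ _).trans (add_le_add ((H.norm_ys_le b e t).trans H.Rnat_le) ?_)
  calc _ ≤ ∑ i ∈ range a.h, opNorm (block (a.gh S b e (t - 1)) i) * a.radius ^ 2 := by
        refine norm_sum_le_of_le _ fun i _ => ?_
        split_ifs
        · refine (norm_app_le _ _).trans ?_
          exact mul_le_mul_of_nonneg_left ((H.norm_uhat_le b e hM _).trans H.RM_mul_Rnat_le)
            (opNorm_nonneg _)
        · rw [norm_zero]; exact mul_nonneg (opNorm_nonneg _) (by positivity)
    _ = (∑ i ∈ range a.h, opNorm (block (a.gh S b e (t - 1)) i)) * a.radius ^ 2 := by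
        rw [Finset.sum_mul]
    _ ≤ a.radius * a.radius ^ 2 := by
        have : ∑ i ∈ range a.h, opNorm (block (a.gh S b e (t - 1)) i) ≤ a.RG := H.gh_mem b e _
        gcongr
        exact this.trans H.RG_le
    _ = _ := by ring

lemma radius_sum_le : a.radius + a.radius ^ 3 + a.radius ^ 2 ≤ 3 * a.radius ^ 3 := by
  have hP := H.two_le_radius
  have h1 : a.radius ≤ a.radius ^ 3 := le_self_pow₀ (by linarith) (by norm_num)
  have h2 : a.radius ^ 2 ≤ a.radius ^ 3 := pow_le_pow_right₀ (by linarith) (by norm_num)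
  linarith

lemma norm_xhat_add_le {M : OpSeq m du dx} (hM : M ∈ opBall m du dx a.RM) (t : ℕ) :
    ‖a.xhat S b e M t‖ + ‖LTV.drcInput M (a.ys S b e) t‖ ≤ 3 * a.radius ^ 3 := by
  have h1 := H.norm_xhat_le b e hM t
  have h2 := (H.norm_uhat_le b e hM t).trans H.RM_mul_Rnat_le
  linarith [H.radius_sum_le]

/-! The gap between the proxy losses and the costs of a fixed DRC policy. -/

lemma norm_drcInput_xnat_le {M : OpSeq m du dx} (hM : M ∈ opBall m du dx a.RM) {t : ℕ}
    (ht : t ≤ T) : ‖LTV.drcInput M S.xnat t‖ ≤ a.radius ^ 2 :=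
  (LTV.norm_drcInput_le hM H.Rnat_pos.le fun s hs => H.norm_xnat_le
    (by rw [Finset.mem_Icc] at hs; omega)).trans H.RM_mul_Rnat_le

lemma norm_state_drcInput_le {M : OpSeq m du dx} (hM : M ∈ opBall m du dx a.RM) {t : ℕ}
    (ht : t ∈ Icc 1 T) :
    ‖S.state (LTV.drcInput M S.xnat) t‖ ≤ a.radius + a.radius ^ 3 := by
  have hP := H.two_le_radius
  have ht' := Finset.mem_Icc.1 ht
  obtain ⟨k, rfl⟩ : ∃ k, t = k + 1 := ⟨t - 1, by omega⟩
  rw [S.state_eq]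
  refine (norm_add_le _ _).trans (add_le_add ((H.norm_xnat_le ht'.2).trans H.Rnat_le) ?_)
  rcases Nat.eq_zero_or_pos k with rfl | hk
  · simp; positivity
  · refine (H.adm.norm_conv_le (Finset.mem_Icc.2 ⟨hk, by omega⟩) k (U := a.radius ^ 2)
      (by positivity) fun i hi _ => H.norm_drcInput_xnat_le hM (by omega)).trans ?_
    have := H.RG_le
    calc _ ≤ a.radius * a.radius ^ 2 := by gcongr
      _ = _ := by ring

/-- Lipschitz continuity on a common ball reduces this to comparing two trajectories of the same
`M`. They differ by the error in the current Nature's x, the operator error, the effect of misjudged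
Nature's x's on past and present inputs, and the truncated tail. -/
lemma proxy_sub_cost_le {M : OpSeq m du dx} (hM : M ∈ opBall m du dx a.RM) {t : ℕ}
    (ht : t ∈ Icc 1 T) :
    S.c t (a.xhat S b e M t) (LTV.drcInput M (a.ys S b e) t) -
      S.c t (S.state (LTV.drcInput M S.xnat) t) (LTV.drcInput M S.xnat t) ≤
    15 * L * a.radius ^ 3 * (a.natErr S b e t + a.radius ^ 2 * a.predErr S b e (t - 1) +
      ∑ i ∈ range a.h, a.radius * ‖LTV.drcInput M (a.ys S b e) (t - 1 - i) -
        LTV.drcInput M S.xnat (t - 1 - i)‖ + a.radius ^ 3 / T +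
      ‖LTV.drcInput M (a.ys S b e) t - LTV.drcInput M S.xnat t‖) := by
  have hP := H.two_le_radius
  have ht' := Finset.mem_Icc.1 ht
  set uM := LTV.drcInput M S.xnat with huM
  have hu : ∀ s ≤ T, ‖uM s‖ ≤ a.radius ^ 2 := fun s hs => H.norm_drcInput_xnat_le hM hs
  obtain ⟨k, rfl⟩ : ∃ k, t = k + 1 := ⟨t - 1, by omega⟩
  have hxM : ‖S.state uM (k + 1)‖ ≤ a.radius + a.radius ^ 3 := H.norm_state_drcInput_le hM ht
  have hR : (1 : ℝ) ≤ 3 * a.radius ^ 3 := by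
    have : (1 : ℝ) ≤ a.radius ^ 3 := one_le_pow₀ (by linarith)
    linarith
  have hc := H.adm.cost_sub_le ht hR H.L_pos (H.norm_xhat_add_le b e hM (k + 1))
    (x' := S.state uM (k + 1)) (u' := uM (k + 1)) (by
      have := hu (k + 1) ht'.2
      linarith [H.radius_sum_le])
  refine hc.trans ?_
  rw [show 5 * L * (3 * a.radius ^ 3) = 15 * L * a.radius ^ 3 by ring]
  have hL := H.L_pos
  refine mul_le_mul_of_nonneg_left (add_le_add ?_ le_rfl) (by positivity)
  have e1 : a.xhat S b e M (k + 1) - S.state uM (k + 1) = (a.ys S b e (k + 1) - S.xnat (k + 1)) -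
      ((∑ i ∈ range k, app (S.markov k i) (uM (k - i)) -
        ∑ i ∈ range a.h, app (S.markov k i) (uM (k - i))) +
      (∑ i ∈ range a.h, app (S.markov k i) (uM (k - i)) - ∑ i ∈ range a.h, if i < k then
        app (block (a.gh S b e k) i) (LTV.drcInput M (a.ys S b e) (k - i)) else 0)) := by
    rw [S.state_eq, xhat, Nat.add_sub_cancel]; abel
  have h1 := a.norm_conv_sub_le S b e k (u := uM) (u' := LTV.drcInput M (a.ys S b e))
    (U := a.radius ^ 2) (by positivity) fun i _ _ =>
      (H.norm_uhat_le b e hM _).trans H.RM_mul_Rnat_le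
  have h2 : ‖∑ i ∈ range k, app (S.markov k i) (uM (k - i)) -
        ∑ i ∈ range a.h, app (S.markov k i) (uM (k - i))‖ ≤ a.radius ^ 3 / T := by
    rcases Nat.eq_zero_or_pos k with rfl | hk
    · rw [S.sum_range_app_markov uM 0 a.h (Nat.zero_le _), sub_self, norm_zero]; positivity
    · refine (H.tail_le (Finset.mem_Icc.2 ⟨hk, by omega⟩) (u := uM) (U := a.radius ^ 2)
        (by positivity) fun s hs => hu s (by rw [Finset.mem_Icc] at hs; omega)).trans
        (le_of_eq (by ring))
  have h3 : ∑ i ∈ range a.h, opNorm (S.markov k i) *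
        ‖uM (k - i) - LTV.drcInput M (a.ys S b e) (k - i)‖ ≤
      ∑ i ∈ range a.h, a.radius * ‖LTV.drcInput M (a.ys S b e) (k - i) - uM (k - i)‖ := by
    refine Finset.sum_le_sum fun i _ => ?_
    rw [norm_sub_rev]
    refine mul_le_mul_of_nonneg_right ?_ (norm_nonneg _)
    rcases Nat.eq_zero_or_pos k with rfl | hk
    · rw [S.markov_of_ge (Nat.zero_le i), opNorm_zero]; linarith
    · refine le_trans ?_ ((H.adm.sum_markov_le (Finset.mem_Icc.2 ⟨hk, by omega⟩) (i + 1)).trans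
        H.RG_le)
      exact Finset.single_le_sum (f := fun i => opNorm (S.markov k i))
        (fun _ _ => opNorm_nonneg _) (Finset.mem_range.2 (Nat.lt_succ_self i))
  rw [e1, Nat.add_sub_cancel]
  refine (norm_sub_le _ _).trans ?_
  have h4 := norm_add_le (∑ i ∈ range k, app (S.markov k i) (uM (k - i)) -
        ∑ i ∈ range a.h, app (S.markov k i) (uM (k - i)))
      (∑ i ∈ range a.h, app (S.markov k i) (uM (k - i)) - ∑ i ∈ range a.h, if i < k then
        app (block (a.gh S b e k) i) (LTV.drcInput M (a.ys S b e) (k - i)) else 0)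
  have h5 : ‖a.ys S b e (k + 1) - S.xnat (k + 1)‖ = a.natErr S b e (k + 1) := rfl
  linarith

lemma sum_proxy_sub_cost_le {M : OpSeq m du dx} (hM : M ∈ opBall m du dx a.RM) {r s : ℕ}
    (hr : 1 ≤ r) (hs : s ≤ T) :
    ∑ t ∈ Icc r s, (S.c t (a.xhat S b e M t) (LTV.drcInput M (a.ys S b e) t) -
      S.c t (S.state (LTV.drcInput M S.xnat) t) (LTV.drcInput M S.xnat t)) ≤
    105 * L * a.radius ^ 6 * (a.h : ℝ) ^ 2 * (∑ t ∈ Icc r s, a.natErr S b e t +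
      ∑ t ∈ Icc r s, a.predErr S b e (t - 1) + m) := by
  have hP := H.two_le_radius
  have hL := H.L_pos
  have hT : (0 : ℝ) < T := by exact_mod_cast H.T_pos
  set v : ℕ → ℝ := fun t => ‖LTV.drcInput M (a.ys S b e) t - LTV.drcInput M S.xnat t‖ with hv
  set E := ∑ t ∈ Icc r s, a.natErr S b e t with hE
  set Eps := ∑ t ∈ Icc r s, a.predErr S b e (t - 1) with hEps
  have hE0 : 0 ≤ E := Finset.sum_nonneg fun t _ => a.natErr_nonneg S b e t
  have hEps0 : 0 ≤ Eps := Finset.sum_nonneg fun t _ => a.predErr_nonneg S b e _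
  have hMsum : ∑ j ∈ range m, opNorm (block M j) ≤ a.radius := le_trans hM H.RM_le
  have hv1 : ∀ t, v t ≤ ∑ j ∈ range m, opNorm (block M j) * a.natErr S b e (t - j) := fun t =>
    LTV.norm_drcInput_sub_le_sum M (a.ys_zero S b e) S.xnat_zero t
  have hv2 : ∀ t ≤ s, v t ≤ 2 * a.radius ^ 2 := by
    intro t ht
    refine (hv1 t).trans ?_
    calc _ ≤ ∑ j ∈ range m, opNorm (block M j) * (2 * a.radius) :=
          Finset.sum_le_sum fun j _ => mul_le_mul_of_nonneg_left
            (H.natErr_le b e (by omega)) (opNorm_nonneg _)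
      _ = (∑ j ∈ range m, opNorm (block M j)) * (2 * a.radius) := by rw [Finset.sum_mul]
      _ ≤ a.radius * (2 * a.radius) := by gcongr
      _ = _ := by ring
  -- After exchanging the sums, the weights `opNorm (block M j)` add up to at most `radius`; `m`
  -- enters only through the boundary terms of the shifts by `j < m`.
  have hV : ∑ t ∈ Icc r s, v t ≤ a.radius * (E + m * (2 * a.radius)) := by
    calc _ ≤ ∑ t ∈ Icc r s, ∑ j ∈ range m, opNorm (block M j) * a.natErr S b e (t - j) :=
          Finset.sum_le_sum fun t _ => hv1 t
      _ = ∑ j ∈ range m, opNorm (block M j) * ∑ t ∈ Icc r s, a.natErr S b e (t - j) := by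
          rw [Finset.sum_comm]; simp only [Finset.mul_sum]
      _ ≤ ∑ j ∈ range m, opNorm (block M j) * (E + m * (2 * a.radius)) := by
          refine Finset.sum_le_sum fun j hj => mul_le_mul_of_nonneg_left ?_ (opNorm_nonneg _)
          refine (sum_Icc_sub_le (fun t _ => a.natErr_nonneg S b e t)
            (fun t ht => H.natErr_le b e (by omega)) hr j).trans ?_
          have : (j : ℝ) ≤ m := by exact_mod_cast (Finset.mem_range.1 hj).le
          gcongr
      _ = (∑ j ∈ range m, opNorm (block M j)) * (E + m * (2 * a.radius)) := by
          rw [Finset.sum_mul]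
      _ ≤ _ := by gcongr
  -- Here the lag is `1 + i ≤ a.h`, so the boundary term of the shift is at most `a.h` times the
  -- bound on `v`.
  have hW : ∑ t ∈ Icc r s, ∑ i ∈ range a.h, a.radius * v (t - 1 - i) ≤
      a.h * (a.radius * (∑ t ∈ Icc r s, v t + a.h * (2 * a.radius ^ 2))) := by
    rw [Finset.sum_comm]
    calc _ ≤ ∑ i ∈ range a.h, a.radius * (∑ t ∈ Icc r s, v t + a.h * (2 * a.radius ^ 2)) := by
          refine Finset.sum_le_sum fun i hi => ?_
          rw [← Finset.mul_sum]
          refine mul_le_mul_of_nonneg_left ?_ (by linarith)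
          have h1 := sum_Icc_sub_le (f := v) (fun t _ => norm_nonneg _) hv2 hr (1 + i)
          simp only [← Nat.sub_sub] at h1
          refine h1.trans ?_
          have : ((1 + i : ℕ) : ℝ) ≤ a.h := by
            rw [Finset.mem_range] at hi; exact_mod_cast (by omega : 1 + i ≤ a.h)
          gcongr
      _ = _ := by rw [Finset.sum_const, card_range, nsmul_eq_mul]
  have hcard : (#(Icc r s) : ℝ) * (a.radius ^ 3 / T) ≤ a.radius ^ 3 := by
    have h1 : (#(Icc r s) : ℝ) ≤ T := by
      rw [Nat.card_Icc]; exact_mod_cast (by omega : s + 1 - r ≤ T)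
    calc _ ≤ T * (a.radius ^ 3 / T) := by gcongr
      _ = _ := mul_div_cancel₀ _ hT.ne'
  calc _ ≤ ∑ t ∈ Icc r s, 15 * L * a.radius ^ 3 * (a.natErr S b e t +
        a.radius ^ 2 * a.predErr S b e (t - 1) + ∑ i ∈ range a.h, a.radius * v (t - 1 - i) +
          a.radius ^ 3 / T + v t) := Finset.sum_le_sum fun t ht =>
        H.proxy_sub_cost_le b e hM (by rw [Finset.mem_Icc] at *; omega)
    _ = 15 * L * a.radius ^ 3 * (E + a.radius ^ 2 * Eps +
        ∑ t ∈ Icc r s, ∑ i ∈ range a.h, a.radius * v (t - 1 - i) +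
        #(Icc r s) * (a.radius ^ 3 / T) + ∑ t ∈ Icc r s, v t) := by
        rw [← Finset.mul_sum]
        simp only [Finset.sum_add_distrib, Finset.sum_const, nsmul_eq_mul, ← Finset.mul_sum]
        rfl
    _ ≤ 15 * L * a.radius ^ 3 * (7 * a.radius ^ 3 * (a.h : ℝ) ^ 2 * (E + Eps + m)) := by
        refine mul_le_mul_of_nonneg_left ?_ (by positivity)
        set P := a.radius
        set V := ∑ t ∈ Icc r s, v t
        have hh : (1 : ℝ) ≤ a.h := by exact_mod_cast H.h_pos
        have hm : (1 : ℝ) ≤ m := by exact_mod_cast H.m_pos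
        set h : ℝ := (a.h : ℝ)
        set n : ℝ := (m : ℝ)
        have hhsq : h ≤ h ^ 2 := le_self_pow₀ hh (by norm_num)
        have hh1 : 1 ≤ h ^ 2 := one_le_pow₀ hh
        have hP1 : P ≤ P ^ 3 := le_self_pow₀ (by linarith) (by norm_num)
        have hP2 : P ^ 2 ≤ P ^ 3 := pow_le_pow_right₀ (by linarith) (by norm_num)
        have hP3 : 1 ≤ P ^ 3 := one_le_pow₀ (by linarith)
        have b1 : h * (P * (V + h * (2 * P ^ 2))) + V ≤
            h * (P * (P * (E + n * (2 * P)) + h * (2 * P ^ 2))) + P * (E + n * (2 * P)) := by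
          gcongr
        have c1 : E ≤ P ^ 3 * h ^ 2 * E := by
          nlinarith [mul_le_mul hP3 hh1 (by norm_num) (by positivity)]
        have c2 : P ^ 2 * Eps ≤ P ^ 3 * h ^ 2 * Eps := by
          have : P ^ 2 * 1 ≤ P ^ 3 * h ^ 2 := by gcongr
          nlinarith
        have c3 : h * P ^ 2 * E ≤ P ^ 3 * h ^ 2 * E := by
          have : P ^ 2 * h ≤ P ^ 3 * h ^ 2 := by gcongr
          nlinarith
        have c4 : P * E ≤ P ^ 3 * h ^ 2 * E := by
          have : P * 1 ≤ P ^ 3 * h ^ 2 := by gcongr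
          nlinarith
        have c5 : h * P ^ 3 * n ≤ P ^ 3 * h ^ 2 * n := by
          have : P ^ 3 * h ≤ P ^ 3 * h ^ 2 := by gcongr
          nlinarith
        have c6 : P ^ 2 * n ≤ P ^ 3 * h ^ 2 * n := by
          have : P ^ 2 * 1 ≤ P ^ 3 * h ^ 2 := by gcongr
          nlinarith
        have c7 : P ^ 3 * h ^ 2 ≤ P ^ 3 * h ^ 2 * n := le_mul_of_one_le_right (by positivity) hm
        have c8 : P ^ 3 ≤ P ^ 3 * h ^ 2 := le_mul_of_one_le_right (by positivity) hh1
        have c9 : 0 ≤ P ^ 3 * h ^ 2 * Eps := by positivity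
        have c10 : 0 ≤ P ^ 3 * h ^ 2 * E := by positivity
        have c11 : 0 ≤ P ^ 3 * h ^ 2 := by positivity
        nlinarith
    _ = _ := by ring

end Setting

end AdaCtrl

/-! ### Gradient descent on the proxy losses and the pathwise regret bound -/

namespace AdaCtrl

variable {dx du m : ℕ} (a : AdaCtrl dx du m) (S : LTV dx du) (b : ℕ → Bool)
  (e : ℕ → Fin du → Bool)

/-- The sensitivity of the proxy state and input to the DRC parameter. -/
def sensitivity : ℝ := (1 + a.RG) * (a.Rnat * √(m : ℝ))

/-- The proxy loss at time `t`. -/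
def proxy (t : ℕ) (M : OpSeq m du dx) : ℝ :=
  S.c t (a.xhat S b e M t) (LTV.drcInput M (a.ys S b e) t)

lemma proxyLoss_run_eq {t : ℕ} (ht : 1 ≤ t) :
    proxyLoss S t (a.run S b e (t - 1)) = a.proxy S b e t :=
  funext fun M => a.proxyLoss_run S b e ht M

/-- The estimates `ys` and `gh` come from the run and not from the argument `M`, so the proxy state
is affine in `M`; this makes the proxy loss convex. -/
lemma xhat_combo (M M' : OpSeq m du dx) {x y : ℝ} (hxy : x + y = 1) (t : ℕ) :
    a.xhat S b e (x • M + y • M') t = x • a.xhat S b e M t + y • a.xhat S b e M' t := by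
  have h1 : a.ys S b e t = x • a.ys S b e t + y • a.ys S b e t := by
    rw [← add_smul, hxy, one_smul]
  unfold xhat
  rw [smul_add, smul_add, Finset.smul_sum, Finset.smul_sum, add_add_add_comm, ← h1,
    ← Finset.sum_add_distrib]
  congr 1
  refine Finset.sum_congr rfl fun i _ => ?_
  split_ifs
  · rw [LTV.drcInput_add, LTV.drcInput_smul, LTV.drcInput_smul, app_add, app_smul, app_smul]
  · simp

namespace Setting

variable {a S} {T : ℕ} {L ρ : ℝ} (H : a.Setting S T L ρ)
include H

lemma convexOn_proxy {t : ℕ} (ht : t ∈ Icc 1 T) :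
    ConvexOn ℝ Set.univ (a.proxy S b e t) := by
  refine ⟨convex_univ, fun M _ M' _ x y hx hy hxy => ?_⟩
  have h := (H.adm.cost_convex t ht).2
    (Set.mem_univ (WithLp.toLp 2 (a.xhat S b e M t, LTV.drcInput M (a.ys S b e) t)))
    (Set.mem_univ (WithLp.toLp 2 (a.xhat S b e M' t, LTV.drcInput M' (a.ys S b e) t))) hx hy hxy
  simp only [WithLp.add_fst, WithLp.add_snd, WithLp.smul_fst, WithLp.smul_snd, WithLp.toLp_fst,
    WithLp.toLp_snd] at h
  unfold proxy
  rw [a.xhat_combo S b e M M' hxy, LTV.drcInput_add, LTV.drcInput_smul, LTV.drcInput_smul]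
  exact h

lemma norm_uhat_sub_le (M M' : OpSeq m du dx) (t : ℕ) :
    ‖LTV.drcInput M (a.ys S b e) t - LTV.drcInput M' (a.ys S b e) t‖ ≤
      a.Rnat * √(m : ℝ) * ‖M - M'‖ :=
  LTV.norm_drcInput_sub_le M M' H.Rnat_pos.le fun s _ => H.norm_ys_le b e s

lemma norm_xhat_sub_add_le (M M' : OpSeq m du dx) (t : ℕ) :
    ‖a.xhat S b e M t - a.xhat S b e M' t‖ +
      ‖LTV.drcInput M (a.ys S b e) t - LTV.drcInput M' (a.ys S b e) t‖ ≤
      a.sensitivity * ‖M - M'‖ := by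
  have h0 := H.Rnat_pos
  have h1 : ‖a.xhat S b e M t - a.xhat S b e M' t‖ ≤
      a.RG * (a.Rnat * √(m : ℝ) * ‖M - M'‖) := by
    unfold xhat
    rw [add_sub_add_left_eq_sub, ← Finset.sum_sub_distrib]
    calc _ ≤ ∑ i ∈ range a.h, opNorm (block (a.gh S b e (t - 1)) i) *
          (a.Rnat * √(m : ℝ) * ‖M - M'‖) := by
          refine norm_sum_le_of_le _ fun i _ => ?_
          split_ifs
          · rw [← app_sub]
            refine (norm_app_le _ _).trans ?_
            exact mul_le_mul_of_nonneg_left (H.norm_uhat_sub_le b e M M' _) (opNorm_nonneg _)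
          · rw [sub_zero, norm_zero]; exact mul_nonneg (opNorm_nonneg _) (by positivity)
      _ = (∑ i ∈ range a.h, opNorm (block (a.gh S b e (t - 1)) i)) *
          (a.Rnat * √(m : ℝ) * ‖M - M'‖) := by rw [Finset.sum_mul]
      _ ≤ _ := mul_le_mul_of_nonneg_right (H.gh_mem b e (t - 1)) (by positivity)
  have h2 := H.norm_uhat_sub_le b e M M' t
  unfold sensitivity
  linarith

lemma sensitivity_pos : 0 < a.sensitivity := by
  have := H.RG_ge
  have := H.Rnat_pos
  have : (0 : ℝ) < m := by exact_mod_cast H.m_pos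
  unfold sensitivity
  positivity

/-- A step along `g` raises the proxy loss by at least the step times `‖g‖ ^ 2`, while the local
Lipschitz bound on the cost limits that rise. -/
lemma norm_subgradient_le {t : ℕ} (ht : t ∈ Icc 1 T) {M g : OpSeq m du dx}
    (hM : M ∈ opBall m du dx a.RM) (hg : IsSubgradient (a.proxy S b e t) M g) :
    ‖g‖ ≤ 20 * L * a.radius ^ 3 * a.sensitivity := by
  have hK := H.sensitivity_pos
  have hL := H.L_pos
  have hP := H.two_le_radius
  rcases eq_or_ne g 0 with rfl | hg0
  · rw [norm_zero]; positivity
  have hgp : 0 < ‖g‖ := norm_pos_iff.2 hg0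
  -- With this step the proxy state and input together move by at most 1. The new parameter may
  -- leave the ball, but its state and input stay where the Lipschitz bound applies.
  set x := 1 / (‖g‖ * a.sensitivity) with hx
  have hx0 : 0 < x := by positivity
  have hsub : M + x • g - M = x • g := by abel
  have h1 := hg (M + x • g)
  rw [hsub, real_inner_smul_right, real_inner_self_eq_norm_sq] at h1
  have h2 := H.norm_xhat_sub_add_le b e (M + x • g) M t
  rw [hsub, norm_smul, Real.norm_of_nonneg hx0.le] at h2
  have h3 : a.sensitivity * (x * ‖g‖) = 1 := by rw [hx]; field_simp
  have h4 := H.norm_xhat_add_le b e hM t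
  have h5 : ‖a.xhat S b e (M + x • g) t‖ + ‖LTV.drcInput (M + x • g) (a.ys S b e) t‖ ≤
      3 * a.radius ^ 3 + 1 := by
    have := norm_sub_norm_le (a.xhat S b e (M + x • g) t) (a.xhat S b e M t)
    have := norm_sub_norm_le (LTV.drcInput (M + x • g) (a.ys S b e) t)
      (LTV.drcInput M (a.ys S b e) t)
    linarith
  have hP3 : 1 ≤ a.radius ^ 3 := one_le_pow₀ (by linarith)
  have h6 := H.adm.cost_sub_le ht (R := 4 * a.radius ^ 3) (by linarith) hL (h5.trans (by linarith))
    (h4.trans (by linarith))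
  have h7 : x * ‖g‖ ^ 2 ≤ 5 * L * (4 * a.radius ^ 3) * (a.sensitivity * (x * ‖g‖)) := by
    have h8 : x * ‖g‖ ^ 2 ≤ a.proxy S b e t (M + x • g) - a.proxy S b e t M := by linarith
    refine h8.trans (h6.trans ?_)
    exact mul_le_mul_of_nonneg_left h2 (by positivity)
  have h8 : (x * ‖g‖) * ‖g‖ ≤ (x * ‖g‖) * (20 * L * a.radius ^ 3 * a.sensitivity) := by
    linarith
  exact le_of_mul_le_mul_left h8 (by positivity)

/-- The squared sensitivity is `(1 + RG)² * Rnat² * m`; the upper bound on `η` absorbs everything in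
it but `m`, together with one factor `L`. -/
lemma η_mul_sq_le : a.η * (20 * L * a.radius ^ 3 * a.sensitivity) ^ 2 * √(T : ℝ) ≤
    800 * L * a.radius ^ 6 * m * √(du : ℝ) := by
  have hη := H.η_pos
  have hL := H.L_pos
  have hP := H.two_le_radius
  have hG := H.RG_ge
  have h1 : (1 + a.RG) ^ 2 ≤ 4 * a.RG ^ 2 := by nlinarith
  have h2 := mul_le_mul_of_nonneg_left H.η_le
    (by positivity : 0 ≤ 800 * L * a.radius ^ 6 * (m : ℝ))
  refine le_trans ?_ h2
  have h3 : (20 * L * a.radius ^ 3 * a.sensitivity) ^ 2 =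
      400 * L ^ 2 * a.radius ^ 6 * a.Rnat ^ 2 * m * (1 + a.RG) ^ 2 := by
    have := Real.sq_sqrt (Nat.cast_nonneg (α := ℝ) m)
    unfold sensitivity
    rw [mul_pow, mul_pow, mul_pow (1 + a.RG), mul_pow a.Rnat, this]; ring
  rw [h3]
  have h4 := mul_le_mul_of_nonneg_left h1
    (by positivity : 0 ≤ a.η * (400 * L ^ 2 * a.radius ^ 6 * a.Rnat ^ 2 * m) * √(T : ℝ))
  linarith

lemma η_mul_le : a.Rnat * √(m : ℝ) * (a.η * (20 * L * a.radius ^ 3 * a.sensitivity)) *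
    √(T : ℝ) ≤ 20 * a.radius ^ 3 * m * √(du : ℝ) := by
  have hη := H.η_pos
  have hL := H.L_pos
  have hP := H.two_le_radius
  have hG := H.RG_ge
  have h1 : 1 + a.RG ≤ 2 * a.RG ^ 2 := by nlinarith
  have h2 := mul_le_mul_of_nonneg_left H.η_le
    (by positivity : 0 ≤ 20 * a.radius ^ 3 * (m : ℝ))
  refine le_trans ?_ h2
  have h3 : a.Rnat * √(m : ℝ) * (a.η * (20 * L * a.radius ^ 3 * a.sensitivity)) * √(T : ℝ) =
      20 * L * a.radius ^ 3 * a.Rnat ^ 2 * m * a.η * √(T : ℝ) * (1 + a.RG) := by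
    have := Real.mul_self_sqrt (Nat.cast_nonneg (α := ℝ) m)
    unfold sensitivity
    linear_combination (a.Rnat ^ 2 * a.η * 20 * L * a.radius ^ 3 * (1 + a.RG) * √(T : ℝ)) * this
  rw [h3]
  have h4 := mul_le_mul_of_nonneg_left h1
    (by positivity : 0 ≤ 20 * L * a.radius ^ 3 * a.Rnat ^ 2 * m * a.η * √(T : ℝ))
  linarith

lemma isSubgradient_sg {t : ℕ} (ht : t ∈ Icc 1 T) (M : OpSeq m du dx) :
    IsSubgradient (a.proxy S b e t) M (a.sg t (a.proxy S b e t) M) :=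
  H.sg_spec t _ (H.convexOn_proxy b e ht) M

omit H in
lemma ms_succ_eq {t : ℕ} (ht : 1 ≤ t) : a.ms S b e (t + 1) = proj (opBall m du dx a.RM)
    (a.ms S b e t - a.η • a.sg t (a.proxy S b e t) (a.ms S b e t)) := by
  rw [a.ms_succ S b e ht, a.proxyLoss_run_eq S b e ht]

/-- A projected step moves the parameter by at most `η` times the gradient bound. This drift matters
because the true state depends on past parameters, whereas the proxy state uses the current one
throughout. -/
lemma norm_ms_sub_le {s : ℕ} (hs : 1 ≤ s) (k : ℕ) (hk : s + k ≤ T) :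
    ‖a.ms S b e (s + k) - a.ms S b e s‖ ≤
      k * (a.η * (20 * L * a.radius ^ 3 * a.sensitivity)) := by
  induction k with
  | zero => simp
  | succ k ih =>
    have h1 := ih (by omega)
    have ht : s + k ∈ Icc 1 T := Finset.mem_Icc.2 ⟨by omega, by omega⟩
    have hM := H.ms_mem b e (by omega : 1 ≤ s + k)
    have h2 : ‖a.ms S b e (s + k + 1) - a.ms S b e (s + k)‖ ≤
        a.η * (20 * L * a.radius ^ 3 * a.sensitivity) := by
      rw [ms_succ_eq b e (by omega : 1 ≤ s + k)]
      refine (norm_proj_step_sub_le (isClosed_opBall _ _ _ _) (convex_opBall _ _ _ _) hM _ _).trans ?_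
      rw [abs_of_pos H.η_pos]
      exact mul_le_mul_of_nonneg_left
        (H.norm_subgradient_le b e ht hM (H.isSubgradient_sg b e ht _)) H.η_pos.le
    have h3 := norm_sub_le_norm_sub_add_norm_sub (a.ms S b e (s + k + 1)) (a.ms S b e (s + k))
      (a.ms S b e s)
    rw [← add_assoc]
    push_cast
    linarith

lemma sqrt_du_le : √(du : ℝ) ≤ du := by
  have h1 := H.one_le_sqrt_du
  have h2 := Real.mul_self_sqrt (Nat.cast_nonneg (α := ℝ) du)
  nlinarith

lemma card_Icc_le {r s : ℕ} (hr : 1 ≤ r) (hs : s ≤ T) : (#(Icc r s) : ℝ) ≤ T := by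
  have := H.T_pos
  rw [Nat.card_Icc]; exact_mod_cast (by omega : s + 1 - r ≤ T)

/-- Regret of the gradient steps on the proxy losses. -/
lemma sum_proxy_sub_le {M : OpSeq m du dx} (hM : M ∈ opBall m du dx a.RM) {r s : ℕ}
    (hr : 1 ≤ r) (hrs : r ≤ s) (hs : s ≤ T) :
    ∑ t ∈ Icc r s, (a.proxy S b e t (a.ms S b e t) - a.proxy S b e t M) ≤
      416 * L * a.radius ^ 6 * (a.h : ℝ) ^ 2 * m * du * √(T : ℝ) := by
  have hη := H.η_pos
  have hL := H.L_pos
  have hP := H.two_le_radius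
  have hT : (0 : ℝ) < T := by exact_mod_cast H.T_pos
  have hin : ∀ t ∈ Icc r s, t ∈ Icc 1 T := fun t ht => by rw [Finset.mem_Icc] at *; omega
  have h1 := projected_descent_regret (isClosed_opBall _ _ _ _) (convex_opBall m du dx a.RM) hη
    (a.ms S b e) (fun t => a.sg t (a.proxy S b e t) (a.ms S b e t)) (a.proxy S b e)
    (by omega : r ≤ s + 1) hM (γ := 20 * L * a.radius ^ 3 * a.sensitivity)
    (fun t ht => ms_succ_eq b e (Finset.mem_Icc.1 (hin t ht)).1)
    (fun t ht => H.isSubgradient_sg b e (hin t ht) _)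
    (fun t ht => H.norm_subgradient_le b e (hin t ht)
      (H.ms_mem b e (Finset.mem_Icc.1 (hin t ht)).1) (H.isSubgradient_sg b e (hin t ht) _))
  refine h1.trans ?_
  set γ := 20 * L * a.radius ^ 3 * a.sensitivity
  have hD : ‖a.ms S b e r - M‖ ^ 2 ≤ 4 * du * a.radius ^ 2 := by
    have h2 := norm_sq_le_of_mem_opBall_left (H.ms_mem b e hr)
    have h3 := norm_sq_le_of_mem_opBall_left hM
    have h4 := norm_sub_le (a.ms S b e r) M
    have h5 : a.RM ^ 2 ≤ a.radius ^ 2 := by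
      have := H.RM_pos; have := H.RM_le; gcongr
    have h6 : (du : ℝ) * a.RM ^ 2 ≤ du * a.radius ^ 2 := by gcongr
    have h7 : ‖a.ms S b e r - M‖ ^ 2 ≤ (‖a.ms S b e r‖ + ‖M‖) ^ 2 := by gcongr
    nlinarith [sq_nonneg (‖a.ms S b e r‖ - ‖M‖)]
  have hA : ‖a.ms S b e r - M‖ ^ 2 / (2 * a.η) ≤
      16 * L * a.radius ^ 6 * (a.h : ℝ) ^ 2 * du * √(T : ℝ) := by
    rw [div_le_iff₀ (by positivity)]
    have := mul_le_mul_of_nonneg_left H.η_ge (by positivity : 0 ≤ 4 * (du : ℝ) * a.radius ^ 2)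
    refine hD.trans (le_trans (by linarith) (this.trans (le_of_eq (by ring))))
  have hq : √(T : ℝ) * √(T : ℝ) = T := Real.mul_self_sqrt hT.le
  have hB : #(Icc r s) * (a.η * γ ^ 2 / 2) ≤ 400 * L * a.radius ^ 6 * m * du * √(T : ℝ) := by
    calc _ ≤ (T : ℝ) * (a.η * γ ^ 2 / 2) :=
          mul_le_mul_of_nonneg_right (H.card_Icc_le hr hs) (by positivity)
      _ = (a.η * γ ^ 2 * √(T : ℝ)) * (√(T : ℝ) / 2) := by
          linear_combination (-(a.η * γ ^ 2 / 2)) * hq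
      _ ≤ (800 * L * a.radius ^ 6 * m * √(du : ℝ)) * (√(T : ℝ) / 2) :=
          mul_le_mul_of_nonneg_right H.η_mul_sq_le (by positivity)
      _ ≤ (800 * L * a.radius ^ 6 * m * du) * (√(T : ℝ) / 2) := by gcongr; exact H.sqrt_du_le
      _ = _ := by ring
  have hh : (1 : ℝ) ≤ (a.h : ℝ) ^ 2 := one_le_pow₀ (by exact_mod_cast H.h_pos)
  have hm : (1 : ℝ) ≤ m := by exact_mod_cast H.m_pos
  have hA' := mul_le_mul_of_nonneg_left hm
    (by positivity : 0 ≤ 16 * L * a.radius ^ 6 * (a.h : ℝ) ^ 2 * du * √(T : ℝ))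
  have hB' := mul_le_mul_of_nonneg_left hh
    (by positivity : 0 ≤ 400 * L * a.radius ^ 6 * m * du * √(T : ℝ))
  linarith

/-! The gap between the incurred costs and the proxy losses. -/

lemma cost_sub_proxy_le {t : ℕ} (ht : t ∈ Icc 1 T) :
    S.c t (a.xs S b e t) (a.us S b e t) - a.proxy S b e t (a.ms S b e t) ≤
      5 * L * a.radius ^ 6 * du * a.explored b t + 15 * L * a.radius ^ 6 * du / T +
      15 * L * a.radius ^ 3 * (a.natErr S b e t + a.radius ^ 2 * a.predErr S b e (t - 1) +
        20 * a.radius ^ 4 * a.h * m * √(du : ℝ) / √(T : ℝ)) := by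
  have hP := H.two_le_radius
  have hL := H.L_pos
  have hd := H.one_le_sqrt_du
  have hdd := Real.mul_self_sqrt (Nat.cast_nonneg (α := ℝ) du)
  have hT : (0 : ℝ) < T := by exact_mod_cast H.T_pos
  have ht' := Finset.mem_Icc.1 ht
  obtain ⟨k, rfl⟩ : ∃ k, t = k + 1 := ⟨t - 1, by omega⟩
  have hε := a.predErr_nonneg S b e (k + 1 - 1)
  have hn := a.natErr_nonneg S b e (k + 1)
  have hex := a.explored_nonneg b (k + 1)
  set P := a.radius
  set d := √(du : ℝ)
  have hP13 : P ≤ P ^ 3 := le_self_pow₀ (by linarith) (by norm_num)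
  have hP23 : P ^ 2 ≤ P ^ 3 := pow_le_pow_right₀ (by linarith) (by norm_num)
  have hu : ‖a.us S b e (k + 1)‖ ≤ P ^ 2 * d := H.norm_us_le' b e _ ht'.1
  have hx : ‖a.xs S b e (k + 1)‖ ≤ 2 * P ^ 3 * d := by
    refine (H.norm_xs_le b e ht'.2).trans ?_
    calc _ ≤ P + P * (P ^ 2 * d) := by
          gcongr
          exacts [H.Rnat_le, H.RG_le, H.max_sqrt_le]
      _ ≤ P ^ 3 * d + P ^ 3 * d := by nlinarith
      _ = _ := by ring
  have r0 : 0 ≤ 15 * L * P ^ 6 * du / T := by positivity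
  have r1 : 0 ≤ 15 * L * P ^ 3 * (a.natErr S b e (k + 1) + P ^ 2 * a.predErr S b e (k + 1 - 1) +
        20 * P ^ 4 * a.h * m * d / √(T : ℝ)) := by positivity
  -- If the window contains exploration, the proxy loss is discarded and the whole cost, of order `L
  -- * P ^ 6 * du`, is charged to `explored`.
  by_cases hexp : a.explored b (k + 1) = 0
  swap
  · have h1 := a.one_le_explored hexp
    have h2 : 0 ≤ a.proxy S b e (k + 1) (a.ms S b e (k + 1)) := H.adm.cost_nonneg _ ht _ _
    have h3 := H.adm.cost_le _ ht (a.xs S b e (k + 1)) (a.us S b e (k + 1))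
    have h4 : max 1 (‖a.xs S b e (k + 1)‖ ^ 2 + ‖a.us S b e (k + 1)‖ ^ 2) ≤ 5 * P ^ 6 * du := by
      have hP6 : 1 ≤ P ^ 6 := one_le_pow₀ (by linarith)
      have hP46 : P ^ 4 ≤ P ^ 6 := pow_le_pow_right₀ (by linarith) (by norm_num)
      have hdu : (1 : ℝ) ≤ du := by exact_mod_cast H.du_pos
      refine max_le (by nlinarith) ?_
      have h5 : ‖a.xs S b e (k + 1)‖ ^ 2 ≤ (2 * P ^ 3 * d) ^ 2 := by gcongr
      have h6 : ‖a.us S b e (k + 1)‖ ^ 2 ≤ (P ^ 2 * d) ^ 2 := by gcongr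
      have h7 : (2 * P ^ 3 * d) ^ 2 = 4 * P ^ 6 * du := by rw [← hdd]; ring
      have h8 : (P ^ 2 * d) ^ 2 = P ^ 4 * du := by rw [← hdd]; ring
      have h9 : P ^ 4 * (du : ℝ) ≤ P ^ 6 * du := by gcongr
      linarith
    have h5 := h3.trans (mul_le_mul_of_nonneg_left h4 hL.le)
    have h6 := mul_le_mul_of_nonneg_left h1 (by positivity : 0 ≤ 5 * L * P ^ 6 * (du : ℝ))
    linarith
  rw [hexp, mul_zero, zero_add]
  -- truncated state
  set xbar := S.xnat (k + 1) + ∑ i ∈ range a.h, app (S.markov k i) (a.us S b e (k - i)) with hxbar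
  have huk : ∀ s, 1 ≤ s → s ≤ k + 1 → k + 1 ≤ s + a.h →
      a.us S b e s = LTV.drcInput (a.ms S b e s) (a.ys S b e) s := fun s h1 h2 h3 =>
    H.us_eq_of_not_explored b e hexp h1 h2 h3
  have hus : ∀ s, 1 ≤ s → s ≤ k + 1 → k + 1 ≤ s + a.h → ‖a.us S b e s‖ ≤ P ^ 2 := by
    intro s h1 h2 h3
    rw [huk s h1 h2 h3]
    exact (H.norm_uhat_le b e (H.ms_mem b e h1) s).trans H.RM_mul_Rnat_le
  have hu2 := hus (k + 1) (by omega) le_rfl (by omega)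
  have hxbarn : ‖xbar‖ ≤ P + P ^ 3 := by
    refine (norm_add_le _ _).trans (add_le_add ((H.norm_xnat_le ht'.2).trans H.Rnat_le) ?_)
    rcases Nat.eq_zero_or_pos k with rfl | hk
    · rw [S.sum_range_app_markov _ 0 a.h (Nat.zero_le _)]; simp; positivity
    · refine (H.adm.norm_conv_le (Finset.mem_Icc.2 ⟨hk, by omega⟩) a.h (U := P ^ 2)
        (by positivity) fun i hi hik => hus _ (by omega) (by omega) (by omega)).trans ?_
      have := H.RG_le
      calc _ ≤ P * P ^ 2 := by gcongr
        _ = _ := by ring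
  have htail : ‖a.xs S b e (k + 1) - xbar‖ ≤ P ^ 3 * d / T := by
    rw [a.xs_eq, hxbar, add_sub_add_left_eq_sub]
    rcases Nat.eq_zero_or_pos k with rfl | hk
    · rw [S.sum_range_app_markov _ 0 a.h (Nat.zero_le _), sub_self, norm_zero]; positivity
    · refine (H.tail_le (Finset.mem_Icc.2 ⟨hk, by omega⟩) (U := P ^ 2 * d)
        (by positivity) fun s hs => H.norm_us_le' b e s (Finset.mem_Icc.1 hs).1).trans
        (le_of_eq (by ring))
  have hP3 : 1 ≤ P ^ 3 := one_le_pow₀ (by linarith)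
  have hsum := H.radius_sum_le
  -- The true state may remember old exploratory inputs, so this comparison needs a ball, hence a
  -- Lipschitz constant, with a factor `√du`. The displacement here is only the tail, of order 1/T.
  have hA := H.adm.cost_sub_le ht (R := 3 * P ^ 3 * d) (by nlinarith) hL
    (x := a.xs S b e (k + 1)) (u := a.us S b e (k + 1)) (x' := xbar) (u' := a.us S b e (k + 1))
    (by nlinarith) (by nlinarith)
  rw [sub_self, norm_zero, add_zero] at hA
  have hA2 : S.c (k + 1) (a.xs S b e (k + 1)) (a.us S b e (k + 1)) -
      S.c (k + 1) xbar (a.us S b e (k + 1)) ≤ 15 * L * P ^ 6 * du / T := by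
    refine hA.trans ((mul_le_mul_of_nonneg_left htail (by positivity)).trans (le_of_eq ?_))
    rw [← hdd]; ring
  -- Once truncated, both arguments lie in a ball free of dimension, so the estimation errors are
  -- not multiplied by `√du`.
  have hB := H.adm.cost_sub_le ht (R := 3 * P ^ 3) (by linarith) hL
    (x := xbar) (u := a.us S b e (k + 1)) (by linarith)
    (H.norm_xhat_add_le b e (H.ms_mem b e ht'.1) (k + 1))
  rw [huk (k + 1) (by omega) le_rfl (by omega), sub_self, norm_zero, add_zero] at hB
  -- Bounds the change of an input when the parameter used at time `k - i` is replaced by the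
  -- current one; at most `a.h` gradient steps lie in between.
  set δ := a.Rnat * √(m : ℝ) * (a.h * (a.η * (20 * L * P ^ 3 * a.sensitivity))) with hδ
  have hη := H.η_pos
  have hse := H.sensitivity_pos
  have hRn := H.Rnat_pos
  have hδ0 : 0 ≤ δ := by positivity
  have hδle : δ ≤ 20 * P ^ 3 * a.h * m * d / √(T : ℝ) := by
    rw [le_div_iff₀ (by positivity)]
    have := mul_le_mul_of_nonneg_left H.η_mul_le (Nat.cast_nonneg (α := ℝ) a.h)
    rw [hδ]
    linarith
  set M := a.ms S b e (k + 1) with hM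
  have hdiff : ‖xbar - a.xhat S b e M (k + 1)‖ ≤ a.natErr S b e (k + 1) + P * δ +
      P ^ 2 * a.predErr S b e k := by
    have e1 : xbar - a.xhat S b e M (k + 1) = -(a.ys S b e (k + 1) - S.xnat (k + 1)) +
        (∑ i ∈ range a.h, app (S.markov k i) (a.us S b e (k - i)) - ∑ i ∈ range a.h, if i < k then
        app (block (a.gh S b e k) i) (LTV.drcInput M (a.ys S b e) (k - i)) else 0) := by
      rw [hxbar, xhat, Nat.add_sub_cancel]; abel
    have h1 := a.norm_conv_sub_le S b e k (u := a.us S b e) (u' := LTV.drcInput M (a.ys S b e))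
      (U := P ^ 2) (by positivity) fun i _ _ =>
        (H.norm_uhat_le b e (H.ms_mem b e ht'.1) _).trans H.RM_mul_Rnat_le
    have h2 : ∑ i ∈ range a.h, opNorm (S.markov k i) *
        ‖a.us S b e (k - i) - LTV.drcInput M (a.ys S b e) (k - i)‖ ≤ P * δ := by
      rcases Nat.eq_zero_or_pos k with rfl | hk
      · refine le_trans (le_of_eq (Finset.sum_eq_zero fun i _ => ?_))
          (by positivity : 0 ≤ P * δ)
        rw [S.markov_of_ge (Nat.zero_le i), opNorm_zero, zero_mul]
      calc _ ≤ ∑ i ∈ range a.h, opNorm (S.markov k i) * δ := by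
            refine Finset.sum_le_sum fun i hi => ?_
            rw [Finset.mem_range] at hi
            by_cases hik : i < k
            swap
            · rw [S.markov_of_ge (not_lt.1 hik), opNorm_zero, zero_mul, zero_mul]
            refine mul_le_mul_of_nonneg_left ?_ (opNorm_nonneg _)
            rw [huk (k - i) (by omega) (by omega) (by omega)]
            refine (H.norm_uhat_sub_le b e _ _ _).trans ?_
            refine mul_le_mul_of_nonneg_left ?_ (by positivity)
            have h3 := H.norm_ms_sub_le b e (by omega : 1 ≤ k - i) (i + 1) (by omega)
            rw [show k - i + (i + 1) = k + 1 by omega, norm_sub_rev] at h3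
            refine h3.trans (mul_le_mul_of_nonneg_right ?_ (by positivity))
            exact_mod_cast (by omega : i + 1 ≤ a.h)
        _ = (∑ i ∈ range a.h, opNorm (S.markov k i)) * δ := by rw [Finset.sum_mul]
        _ ≤ _ := mul_le_mul_of_nonneg_right
            ((H.adm.sum_markov_le (Finset.mem_Icc.2 ⟨hk, by omega⟩) a.h).trans H.RG_le) hδ0
    rw [e1]
    refine (norm_add_le _ _).trans ?_
    rw [norm_neg]
    have h5 : ‖a.ys S b e (k + 1) - S.xnat (k + 1)‖ = a.natErr S b e (k + 1) := rfl
    linarith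
  have hPδ : P * δ ≤ 20 * P ^ 4 * a.h * m * d / √(T : ℝ) := by
    refine (mul_le_mul_of_nonneg_left hδle (by linarith)).trans (le_of_eq (by ring))
  have hfin := hB.trans (mul_le_mul_of_nonneg_left
    (hdiff.trans (add_le_add_left (add_le_add_right hPδ _) _)) (by positivity))
  rw [← huk (k + 1) (by omega) le_rfl (by omega)] at hfin
  have hpr : a.proxy S b e (k + 1) M = S.c (k + 1) (a.xhat S b e M (k + 1))
      (a.us S b e (k + 1)) := by
    rw [proxy, huk (k + 1) (by omega) le_rfl (by omega)]
  rw [hpr, Nat.add_sub_cancel]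
  linarith

lemma sum_cost_sub_proxy_le {r s : ℕ} (hr : 1 ≤ r) (hs : s ≤ T) :
    ∑ t ∈ Icc r s, (S.c t (a.xs S b e t) (a.us S b e t) - a.proxy S b e t (a.ms S b e t)) ≤
      5 * L * a.radius ^ 6 * du * ∑ t ∈ Icc r s, a.explored b t + 15 * L * a.radius ^ 6 * du +
      15 * L * a.radius ^ 3 * (∑ t ∈ Icc r s, a.natErr S b e t +
        a.radius ^ 2 * ∑ t ∈ Icc r s, a.predErr S b e (t - 1) +
        20 * a.radius ^ 4 * a.h * m * √(du : ℝ) * √(T : ℝ)) := by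
  have hP := H.two_le_radius
  have hL := H.L_pos
  have hT : (0 : ℝ) < T := by exact_mod_cast H.T_pos
  have hq : √(T : ℝ) * √(T : ℝ) = T := Real.mul_self_sqrt hT.le
  have hc := H.card_Icc_le hr hs
  have hc1 : (#(Icc r s) : ℝ) * (15 * L * a.radius ^ 6 * du / T) ≤
      15 * L * a.radius ^ 6 * du := by
    calc _ ≤ (T : ℝ) * (15 * L * a.radius ^ 6 * du / T) := by gcongr
      _ = _ := mul_div_cancel₀ _ hT.ne'
  have hc2 : (#(Icc r s) : ℝ) * (20 * a.radius ^ 4 * a.h * m * √(du : ℝ) / √(T : ℝ)) ≤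
      20 * a.radius ^ 4 * a.h * m * √(du : ℝ) * √(T : ℝ) := by
    calc _ ≤ (T : ℝ) * (20 * a.radius ^ 4 * a.h * m * √(du : ℝ) / √(T : ℝ)) := by gcongr
      _ = _ := by
        have : √(T : ℝ) ≠ 0 := (Real.sqrt_pos.2 hT).ne'
        nth_rw 1 [← hq]
        field_simp
  refine (Finset.sum_le_sum fun t ht => H.cost_sub_proxy_le b e (t := t) (by
    rw [Finset.mem_Icc] at *; omega)).trans ?_
  simp only [Finset.sum_add_distrib, Finset.sum_const, nsmul_eq_mul, ← Finset.mul_sum]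
  have hc3 := mul_le_mul_of_nonneg_left hc2 (by positivity : 0 ≤ 15 * L * a.radius ^ 3)
  linarith

/-- The three gaps add up for every comparator `M` with the same bound, so the bound passes to the
infimum. `natErr` is then eliminated in favour of `predErr` and `explored`. -/
lemma regret_le {r s : ℕ} (hr : 1 ≤ r) (hrs : r ≤ s) (hs : s ≤ T) :
    a.regret S T r s b e ≤ 2520 * L * a.radius ^ 10 * (a.h : ℝ) ^ 2 *
      (∑ t ∈ Icc r s, a.predErr S b e (t - 1) + du * ∑ t ∈ Icc r s, a.explored b t +
        m * du * √(T : ℝ)) := by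
  set B := 2520 * L * a.radius ^ 10 * (a.h : ℝ) ^ 2 *
      (∑ t ∈ Icc r s, a.predErr S b e (t - 1) + du * ∑ t ∈ Icc r s, a.explored b t +
        m * du * √(T : ℝ)) with hB
  have hcost : ∑ t ∈ Icc r s, S.c t ((a.run S b e T).x t) ((a.run S b e T).u t) =
      ∑ t ∈ Icc r s, S.c t (a.xs S b e t) (a.us S b e t) := by
    refine Finset.sum_congr rfl fun t ht => ?_
    rw [Finset.mem_Icc] at ht
    rw [a.run_x S b e (by omega), a.run_u S b e (by omega)]
  rw [regret, hcost, sub_le_comm]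
  have : Nonempty (opBall m du dx a.RM) := ⟨⟨a.M1, H.M1_mem⟩⟩
  refine le_ciInf fun M => ?_
  rw [sub_le_comm]
  have h1 := H.sum_cost_sub_proxy_le b e hr hs
  have h2 := H.sum_proxy_sub_le b e M.2 hr hrs hs
  have h3 := H.sum_proxy_sub_cost_le b e M.2 hr hs
  have h4 := H.sum_natErr_le b e hr hs
  set E := ∑ t ∈ Icc r s, a.natErr S b e t
  set Eps := ∑ t ∈ Icc r s, a.predErr S b e (t - 1)
  set Bd := ∑ t ∈ Icc r s, a.explored b t
  have hE0 : 0 ≤ E := Finset.sum_nonneg fun t _ => a.natErr_nonneg S b e t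
  have hEps0 : 0 ≤ Eps := Finset.sum_nonneg fun t _ => a.predErr_nonneg S b e _
  have hBd0 : 0 ≤ Bd := Finset.sum_nonneg fun t _ => a.explored_nonneg b _
  have htot : ∑ t ∈ Icc r s, S.c t (a.xs S b e t) (a.us S b e t) - S.drcCost (M : OpSeq m du dx) r s =
      ∑ t ∈ Icc r s, (S.c t (a.xs S b e t) (a.us S b e t) - a.proxy S b e t (a.ms S b e t)) +
      ∑ t ∈ Icc r s, (a.proxy S b e t (a.ms S b e t) - a.proxy S b e t M) +
      ∑ t ∈ Icc r s, (a.proxy S b e t M - S.c t (S.state (LTV.drcInput (M : OpSeq m du dx) S.xnat) t)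
        (LTV.drcInput (M : OpSeq m du dx) S.xnat t)) := by
    simp only [Finset.sum_sub_distrib, LTV.drcCost]; ring
  rw [htot]
  refine (add_le_add (add_le_add h1 h2) h3).trans ?_
  have hP := H.two_le_radius
  have hL := H.L_pos
  have hT : (1 : ℝ) ≤ T := by exact_mod_cast H.T_pos
  have hq : 1 ≤ √(T : ℝ) := Real.one_le_sqrt.2 hT
  have hd := H.one_le_sqrt_du
  have hd2 := H.sqrt_du_le
  have hdu : (1 : ℝ) ≤ du := by exact_mod_cast H.du_pos
  have hh : (1 : ℝ) ≤ a.h := by exact_mod_cast H.h_pos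
  have hm : (1 : ℝ) ≤ m := by exact_mod_cast H.m_pos
  set P := a.radius
  set h : ℝ := (a.h : ℝ)
  set n : ℝ := (m : ℝ)
  set D : ℝ := (du : ℝ)
  set d := √D
  set q := √(T : ℝ)
  have hP1 : 1 ≤ P := by linarith
  have hh1 : 1 ≤ h ^ 2 := one_le_pow₀ hh
  have hh2 : h ≤ h ^ 2 := le_self_pow₀ hh (by norm_num)
  have hnDq : 1 ≤ n * D * q := by
    have : 1 * 1 * 1 ≤ n * D * q := by gcongr
    linarith
  have hDnDq : D ≤ n * D * q := by
    have : 1 * D * 1 ≤ n * D * q := by gcongr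
    linarith
  have hndq : n * d * q ≤ n * D * q := by gcongr
  have hn2 : n ≤ n * D * q := by
    have : n * 1 * 1 ≤ n * D * q := by gcongr
    linarith
  have hd3 : d ≤ n * D * q := hd2.trans hDnDq
  set N := n * D * q with hN
  have hbd2 : Bd ≤ D * Bd := le_mul_of_one_le_left hBd0 hdu
  -- everything in units of `L * P ^ 7 * h ^ 2`
  have u1 : 5 * L * P ^ 6 * D * Bd ≤ L * P ^ 7 * h ^ 2 * (5 * (D * Bd)) := by
    have : L * P ^ 6 * 1 ≤ L * P ^ 7 * h ^ 2 := by gcongr; norm_num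
    nlinarith [mul_le_mul_of_nonneg_right this (by positivity : 0 ≤ 5 * (D * Bd))]
  have u2 : 15 * L * P ^ 6 * D ≤ L * P ^ 7 * h ^ 2 * (15 * N) := by
    have : L * P ^ 6 * 1 * D ≤ L * P ^ 7 * h ^ 2 * N := by gcongr; norm_num
    linarith
  have u3 : 15 * L * P ^ 3 * E ≤ L * P ^ 7 * h ^ 2 * (15 * E) := by
    have : L * P ^ 3 * 1 * E ≤ L * P ^ 7 * h ^ 2 * E := by gcongr; norm_num
    linarith
  have u4 : 15 * L * P ^ 3 * (P ^ 2 * Eps) ≤ L * P ^ 7 * h ^ 2 * (15 * Eps) := by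
    have : L * P ^ 5 * 1 * Eps ≤ L * P ^ 7 * h ^ 2 * Eps := by gcongr; norm_num
    calc _ = 15 * (L * P ^ 5 * 1 * Eps) := by ring
      _ ≤ _ := by linarith
  have u5 : 15 * L * P ^ 3 * (20 * P ^ 4 * h * n * d * q) ≤ L * P ^ 7 * h ^ 2 * (300 * N) := by
    have : L * P ^ 7 * h * (n * d * q) ≤ L * P ^ 7 * h ^ 2 * N := by gcongr
    calc _ = 300 * (L * P ^ 7 * h * (n * d * q)) := by ring
      _ ≤ _ := by linarith
  have u6 : 416 * L * P ^ 6 * h ^ 2 * n * D * q ≤ L * P ^ 7 * h ^ 2 * (416 * N) := by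
    have : L * P ^ 6 * h ^ 2 * N ≤ L * P ^ 7 * h ^ 2 * N := by gcongr; norm_num
    calc _ = 416 * (L * P ^ 6 * h ^ 2 * N) := by rw [hN]; ring
      _ ≤ _ := by linarith
  have u7 : 105 * L * P ^ 6 * h ^ 2 * (E + Eps + n) ≤
      L * P ^ 7 * h ^ 2 * (105 * (E + Eps + N)) := by
    have : L * P ^ 6 * h ^ 2 * (E + Eps + n) ≤ L * P ^ 7 * h ^ 2 * (E + Eps + N) := by
      gcongr; norm_num
    linarith
  -- Eliminating the errors in Nature's x's costs a factor `P ^ 3`, which raises the seventh power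
  -- to the tenth.
  have v1 : E ≤ P ^ 3 * (Eps + 2 * (D * Bd) + N) := by
    have w1 : P ^ 2 * Eps ≤ P ^ 3 * Eps := by gcongr <;> linarith
    have w2 : 2 * P * Bd ≤ P ^ 3 * (2 * (D * Bd)) := by
      have : P ^ 1 * Bd ≤ P ^ 3 * (D * Bd) := by gcongr <;> linarith
      linarith
    have w3 : P ^ 3 * d ≤ P ^ 3 * N := by gcongr
    linarith
  have v2 : (1 : ℝ) ≤ P ^ 3 := one_le_pow₀ (by linarith)
  have hDB : 0 ≤ D * Bd := by positivity
  have v3 : 120 * E + 120 * Eps + 5 * (D * Bd) + 836 * N ≤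
      P ^ 3 * (2520 * (Eps + D * Bd + N)) := by
    have w1 := mul_le_mul_of_nonneg_right v2 (by positivity : 0 ≤ 120 * Eps + 5 * (D * Bd) + 836 * N)
    have w2 : 0 ≤ P ^ 3 * Eps := by positivity
    have w3 : 0 ≤ P ^ 3 * (D * Bd) := by positivity
    have w4 : 0 ≤ P ^ 3 * N := by positivity
    linarith
  have v4 := mul_le_mul_of_nonneg_left v3 (by positivity : 0 ≤ L * P ^ 7 * h ^ 2)
  have v5 : B = L * P ^ 7 * h ^ 2 * (P ^ 3 * (2520 * (Eps + D * Bd + N))) := by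
    rw [hB]; ring
  rw [v5]
  linarith

end Setting

end AdaCtrl

namespace AdaCtrl

variable {dx du m : ℕ} (a : AdaCtrl dx du m) (S : LTV dx du) (b : ℕ → Bool)
  (e : ℕ → Fin du → Bool)

/-! ### Expected control regret -/

lemma epoch_mono {s t : ℕ} (h : s ≤ t) : a.epoch s ≤ a.epoch t := by
  unfold epoch
  have : (s - 1) / a.h ≤ (t - 1) / a.h := Nat.div_le_div_right (by omega)
  omega

lemma epoch_bounds (hh : 0 < a.h) {t : ℕ} (ht : 1 ≤ t) :
    (a.epoch t - 1) * a.h < t ∧ t ≤ a.epoch t * a.h := by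
  obtain ⟨n, hn, h⟩ := a.exists_eq_epoch hh ht
  have h1 : 1 ≤ a.epoch t := by simp [epoch]
  obtain ⟨k, hk⟩ : ∃ k, a.epoch t = k + 1 := ⟨a.epoch t - 1, by omega⟩
  rw [hk, Nat.add_sub_cancel] at h
  rw [hk, Nat.add_sub_cancel, add_mul, one_mul]
  omega

/-- Each epoch contributes at most `a.h` rounds of the interval. -/
lemma sum_epoch_le (hh : 0 < a.h) {φ : ℕ → ℝ} (hφ : ∀ τ, 0 ≤ φ τ) {r s : ℕ} (hr : 1 ≤ r) :
    ∑ t ∈ Icc r s, φ (a.epoch t) ≤ a.h * ∑ τ ∈ Icc (a.epoch r) (a.epoch s), φ τ := by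
  have hmaps : ∀ t ∈ Icc r s, a.epoch t ∈ Icc (a.epoch r) (a.epoch s) := by
    intro t ht
    rw [Finset.mem_Icc] at *
    exact ⟨a.epoch_mono ht.1, a.epoch_mono ht.2⟩
  rw [← Finset.sum_fiberwise_of_maps_to hmaps, Finset.mul_sum]
  refine Finset.sum_le_sum fun τ _ => ?_
  have hcard : #{t ∈ Icc r s | a.epoch t = τ} ≤ a.h := by
    have hsub : {t ∈ Icc r s | a.epoch t = τ} ⊆ Ioc ((τ - 1) * a.h) ((τ - 1) * a.h + a.h) := by
      intro t ht
      rw [Finset.mem_filter, Finset.mem_Icc] at ht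
      have h1 := a.epoch_bounds hh (hr.trans ht.1.1)
      rw [ht.2] at h1
      have h2 : 1 ≤ τ := by rw [← ht.2]; simp [epoch]
      obtain ⟨k, rfl⟩ : ∃ k, τ = k + 1 := ⟨τ - 1, by omega⟩
      rw [Nat.add_sub_cancel, add_mul, one_mul] at h1
      rw [Finset.mem_Ioc, Nat.add_sub_cancel]
      exact h1
    refine (Finset.card_le_card hsub).trans ?_
    simp
  calc _ = ∑ t ∈ Icc r s with a.epoch t = τ, φ τ :=
        Finset.sum_congr rfl fun t ht => by rw [(Finset.mem_filter.1 ht).2]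
    _ = #{t ∈ Icc r s | a.epoch t = τ} * φ τ := by rw [Finset.sum_const, nsmul_eq_mul]
    _ ≤ _ := mul_le_mul_of_nonneg_right (by exact_mod_cast hcard) (hφ τ)

/-- Every epoch that meets the interval, except the last one, ends inside it. The operators sampled
at these ends are therefore covered by the variability over the same interval. -/
lemma epoch_end_mem (hh : 0 < a.h) {r s τ : ℕ} (hr : 1 ≤ r) (hrs : r ≤ s)
    (hτ : τ ∈ Icc (a.epoch r) (a.epoch s - 1)) : τ * a.h ∈ Icc r s ∧ τ * a.h < s := by
  rw [Finset.mem_Icc] at hτ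
  have h1 := a.epoch_bounds hh hr
  have h2 := a.epoch_bounds hh (hr.trans hrs)
  have h3 := Nat.mul_le_mul_right a.h hτ.1
  have h4 := Nat.mul_le_mul_right a.h hτ.2
  rw [Finset.mem_Icc]
  omega

lemma sum_epoch_end_le (hh : 0 < a.h) {f : ℕ → ℝ} (hf : ∀ t, 0 ≤ f t) {r s : ℕ} (hr : 1 ≤ r)
    (hrs : r ≤ s) :
    ∑ τ ∈ Icc (a.epoch r) (a.epoch s - 1), f (τ * a.h) ≤ ∑ t ∈ Icc r s, f t := by
  rw [← Finset.sum_image (f := f) (g := fun τ => τ * a.h)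
    (fun x _ y _ hxy => Nat.eq_of_mul_eq_mul_right hh hxy)]
  refine Finset.sum_le_sum_of_subset_of_nonneg ?_ fun t _ _ => hf t
  intro t ht
  obtain ⟨τ, hτ, rfl⟩ := Finset.mem_image.1 ht
  exact (a.epoch_end_mem hh hr hrs hτ).1

/-- A bound on `‖z - z̃‖` over all candidates `z` and one-point estimates `z̃`. -/
def estRadius : ℝ :=
  √((a.h : ℝ) * (min dx du : ℕ)) * a.RG +
    √((a.h : ℝ) * du) * (a.Rnat + a.RG * max (√(du : ℝ)) (a.Rnat * a.RM))

namespace Setting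

variable {a S} {T : ℕ} {L ρ : ℝ} (H : a.Setting S T L ρ)
include H

/-- Every block is the rank-one product of one state with a sign vector of squared norm `du`. The
inequality `τ * a.h < T` is strict because the estimate uses the state one round later, and states
are controlled only up to `T`. -/
lemma norm_est_le {τ : ℕ} (hτ : 1 ≤ τ) (hτT : τ * a.h < T) (hb : b τ = true) :
    ‖a.est S b e τ‖ ≤
      √((a.h : ℝ) * du) * (a.Rnat + a.RG * max (√(du : ℝ)) (a.Rnat * a.RM)) := by
  have h1 := H.norm_xs_le b e hτT
  have hG := H.RG_ge
  have hR := H.Rnat_pos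
  refine abs_le_of_sq_le_sq' ?_ (by positivity) |>.2
  rw [mul_pow, Real.sq_sqrt (by positivity)]
  have h2 : ‖a.est S b e τ‖ ^ 2 = a.h * du * ‖a.xs S b e (τ * a.h + 1)‖ ^ 2 := by
    rw [EuclideanSpace.norm_sq_eq, Fintype.sum_prod_type]
    have h3 : ∀ i : Fin a.h, ∑ y : Fin dx × Fin du, ‖(a.est S b e τ) (i, y)‖ ^ 2 =
        ‖a.xs S b e (τ * a.h + 1)‖ ^ 2 * du := by
      intro i
      have hi := i.2
      have hτh : τ * a.h = (τ - 1) * a.h + a.h := by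
        obtain ⟨τ, rfl⟩ : ∃ k, τ = k + 1 := ⟨τ - 1, by omega⟩
        rw [Nat.add_sub_cancel]; ring
      rw [← norm_signs_sq (e (τ * a.h - i)),
        ← a.us_eq_signs S b e H.h_pos hτ hb (s := τ * a.h - i) (by omega) (by omega),
        EuclideanSpace.norm_sq_eq, EuclideanSpace.norm_sq_eq, Finset.sum_mul_sum,
        Fintype.sum_prod_type]
      refine Finset.sum_congr rfl fun r _ => Finset.sum_congr rfl fun c _ => ?_
      rw [← mul_pow, ← norm_mul]
      rfl
    rw [Finset.sum_congr rfl fun i _ => h3 i, Finset.sum_const, Finset.card_univ, Fintype.card_fin,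
      nsmul_eq_mul]
    ring
  rw [h2]
  gcongr

lemma norm_sub_est_le {τ : ℕ} (hτ : 1 ≤ τ) (hτT : τ * a.h < T) (hb : b τ = true)
    {z : OpSeq a.h dx du} (hz : z ∈ opBall a.h dx du a.RG) :
    ‖z - a.est S b e τ‖ ≤ a.estRadius := by
  have hG := H.RG_ge
  refine (norm_sub_le _ _).trans (add_le_add ?_ (H.norm_est_le b e hτ hτT hb))
  refine (norm_le_of_mem_opBall (by linarith) hz).trans ?_
  gcongr
  have : (1 : ℝ) ≤ a.h := by exact_mod_cast H.h_pos
  exact le_mul_of_one_le_left (by positivity) this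

lemma estRadius_sq_le : a.estRadius ^ 2 ≤ 9 * a.h * du ^ 2 * a.radius ^ 6 := by
  have hP := H.two_le_radius
  have hG := H.RG_ge
  have hR := H.Rnat_pos
  have hd := H.one_le_sqrt_du
  have hdd := Real.mul_self_sqrt (Nat.cast_nonneg (α := ℝ) du)
  have hhh := Real.sq_sqrt (Nat.cast_nonneg (α := ℝ) a.h)
  have hP13 : a.radius ≤ a.radius ^ 3 := le_self_pow₀ (by linarith) (by norm_num)
  have h1 : √((a.h : ℝ) * (min dx du : ℕ)) ≤ √(a.h : ℝ) * √(du : ℝ) := by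
    rw [← Real.sqrt_mul (by positivity)]
    gcongr
    exact min_le_right _ _
  have h2 : √((a.h : ℝ) * du) = √(a.h : ℝ) * √(du : ℝ) := Real.sqrt_mul (by positivity) _
  have h3 : a.Rnat + a.RG * max (√(du : ℝ)) (a.Rnat * a.RM) ≤ 2 * a.radius ^ 3 * √(du : ℝ) := by
    calc _ ≤ a.radius + a.radius * (a.radius ^ 2 * √(du : ℝ)) := by
          gcongr
          exacts [H.Rnat_le, H.RG_le, H.max_sqrt_le]
      _ ≤ a.radius ^ 3 * √(du : ℝ) + a.radius ^ 3 * √(du : ℝ) := by nlinarith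
      _ = _ := by ring
  have h4 : a.RG ≤ a.radius ^ 3 * √(du : ℝ) := by nlinarith [H.RG_le]
  have h5 : a.estRadius ≤ 3 * a.radius ^ 3 * √(a.h : ℝ) * du := by
    calc _ ≤ √(a.h : ℝ) * √(du : ℝ) * (a.radius ^ 3 * √(du : ℝ)) +
          √(a.h : ℝ) * √(du : ℝ) * (2 * a.radius ^ 3 * √(du : ℝ)) := by
          unfold estRadius
          rw [h2]
          gcongr
      _ = 3 * a.radius ^ 3 * √(a.h : ℝ) * (√(du : ℝ) * √(du : ℝ)) := by ring
      _ = _ := by rw [hdd]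
  have h6 : 0 ≤ a.estRadius := by unfold estRadius; positivity
  calc _ ≤ (3 * a.radius ^ 3 * √(a.h : ℝ) * du) ^ 2 := by gcongr
    _ = 9 * (√(a.h : ℝ)) ^ 2 * du ^ 2 * a.radius ^ 6 := by ring
    _ = _ := by rw [hhh]

lemma norm_gh_sub_sq_le {t : ℕ} (ht : t ∈ Icc 1 T) :
    ‖a.gh S b e t - S.markovVec a.h t‖ ^ 2 ≤ 4 * du * a.radius ^ 2 := by
  have h2 := norm_sq_le_of_mem_opBall_right (H.gh_mem b e t)
  have h3 := norm_sq_le_of_mem_opBall_right (H.adm.markovVec_mem ht a.h)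
  have h4 := norm_sub_le (a.gh S b e t) (S.markovVec a.h t)
  have h5 : a.RG ^ 2 ≤ a.radius ^ 2 := by
    have := H.RG_ge; have := H.RG_le; gcongr
  have h6 : (du : ℝ) * a.RG ^ 2 ≤ du * a.radius ^ 2 := by gcongr
  have h7 : ‖a.gh S b e t - S.markovVec a.h t‖ ^ 2 ≤
      (‖a.gh S b e t‖ + ‖S.markovVec a.h t‖) ^ 2 := by gcongr
  nlinarith [sq_nonneg (‖a.gh S b e t‖ - ‖S.markovVec a.h t‖)]

omit H in
lemma predErr_le_norm (t : ℕ) :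
    a.predErr S b e t ≤ √(a.h : ℝ) * ‖a.gh S b e t - S.markovVec a.h t‖ := by
  refine le_trans (le_of_eq ?_) (sum_opNorm_block_le _)
  refine Finset.sum_congr rfl fun i hi => ?_
  rw [block_sub, S.block_markovVec t (by simpa using hi)]

/-- The estimate is constant on an epoch, but Ada-Pred is judged against the operator at the end of
the epoch. Inserting the average operator links that operator to the one at time `t`, and the
squared three-term triangle inequality costs the factor 3. -/
lemma sum_norm_gh_sub_sq_le {r s : ℕ} (hr : 1 ≤ r) (hrs : r ≤ s) (hs : s ≤ T) :
    ∑ t ∈ Icc r s, ‖a.gh S b e t - S.markovVec a.h t‖ ^ 2 ≤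
      a.h * (3 * ∑ τ ∈ Icc (a.epoch r) (a.epoch s - 1),
        (‖(a.preds S b e τ).play τ - S.markovVec a.h (τ * a.h)‖ ^ 2 +
          ‖S.avgMarkov a.h r s - S.markovVec a.h (τ * a.h)‖ ^ 2) + 4 * du * a.radius ^ 2) +
      3 * ∑ t ∈ Icc r s, ‖S.avgMarkov a.h r s - S.markovVec a.h t‖ ^ 2 := by
  set Z := S.avgMarkov a.h r s
  set ψ : ℕ → ℝ := fun τ => ‖(a.preds S b e τ).play τ - S.markovVec a.h (τ * a.h)‖ ^ 2 +
    ‖Z - S.markovVec a.h (τ * a.h)‖ ^ 2 with hψ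
  -- The last epoch may end outside the interval, so it is bounded by the diameter of the ball.
  set φ : ℕ → ℝ := fun τ => if τ < a.epoch s then 3 * ψ τ else 4 * du * a.radius ^ 2 with hφ
  have hφ0 : ∀ τ, 0 ≤ φ τ := by
    intro τ; simp only [hφ, hψ]; split_ifs <;> positivity
  have hpt : ∀ t ∈ Icc r s, ‖a.gh S b e t - S.markovVec a.h t‖ ^ 2 ≤
      φ (a.epoch t) + 3 * ‖Z - S.markovVec a.h t‖ ^ 2 := by
    intro t ht
    rw [Finset.mem_Icc] at ht
    have htT : t ∈ Icc 1 T := Finset.mem_Icc.2 ⟨by omega, by omega⟩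
    simp only [hφ]
    split_ifs with h
    · rw [a.gh_eq S b e H.h_pos (by omega)]
      simp only [hψ]
      set x := (a.preds S b e (a.epoch t)).play (a.epoch t)
      set y := S.markovVec a.h (a.epoch t * a.h)
      set w := S.markovVec a.h t
      have h1 : ‖x - w‖ ≤ ‖x - y‖ + ‖Z - y‖ + ‖Z - w‖ := by
        have e1 : x - w = (x - y) - (Z - y) + (Z - w) := by abel
        rw [e1]
        exact (norm_add_le _ _).trans (add_le_add (norm_sub_le _ _) le_rfl)
      have h2 : ‖x - w‖ ^ 2 ≤ (‖x - y‖ + ‖Z - y‖ + ‖Z - w‖) ^ 2 := by gcongr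
      nlinarith [sq_nonneg (‖x - y‖ - ‖Z - y‖), sq_nonneg (‖x - y‖ - ‖Z - w‖),
        sq_nonneg (‖Z - y‖ - ‖Z - w‖)]
    · have := H.norm_gh_sub_sq_le b e htT
      have h2 : 0 ≤ 3 * ‖Z - S.markovVec a.h t‖ ^ 2 := by positivity
      linarith
  refine (Finset.sum_le_sum hpt).trans ?_
  rw [Finset.sum_add_distrib, ← Finset.mul_sum]
  refine add_le_add ((a.sum_epoch_le H.h_pos hφ0 hr).trans ?_) le_rfl
  refine mul_le_mul_of_nonneg_left (le_of_eq ?_) (by positivity)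
  have h1 : 1 ≤ a.epoch s := by simp [epoch]
  have h2 := a.epoch_mono hrs
  have h3 : Icc (a.epoch r) (a.epoch s) = insert (a.epoch s) (Icc (a.epoch r) (a.epoch s - 1)) := by
    ext τ
    rw [Finset.mem_insert, Finset.mem_Icc, Finset.mem_Icc]
    omega
  rw [h3, Finset.sum_insert (by rw [Finset.mem_Icc]; omega), Finset.mul_sum, add_comm]
  congr 1
  · refine Finset.sum_congr rfl fun τ hτ => ?_
    rw [Finset.mem_Icc] at hτ
    simp only [hφ]
    rw [if_pos (by omega)]
  · simp [hφ]

/-- With the average operator as comparator, Ada-Pred does as well as that average up to its regret.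
The comparator's own error at the epoch ends is part of the variability sum, since these ends are
distinct rounds of the interval. -/
lemma coins_sum_norm_gh_sub_sq_le (hp : 0 < a.p) (hp1 : a.p ≤ 1) (hα : 0 < a.α)
    (hαR : a.α * a.estRadius ^ 2 = a.p) {Λ : ℝ} (hΛh : (a.h : ℝ) ≤ Λ)
    (hΛT : 1 + Real.log T ≤ Λ) (hT2 : 2 ≤ T) {r s : ℕ} (hr : 1 ≤ r) (hrs : r ≤ s)
    (hs : s ≤ T) :
    a.coins T (fun b e => ∑ t ∈ Icc r s, ‖a.gh S b e t - S.markovVec a.h t‖ ^ 2) ≤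
      9 * Λ * (#(Icc r s) * S.variability r s) + 220 * Λ ^ 4 * a.radius ^ 6 * du ^ 2 / a.p := by
  set Z := S.avgMarkov a.h r s
  set W := ∑ t ∈ Icc r s, ‖Z - S.markovVec a.h t‖ ^ 2 with hW
  have hWV : W ≤ #(Icc r s) * S.variability r s := S.sum_norm_avgMarkov_sub_sq_le a.h hrs
  have hW0 : 0 ≤ W := Finset.sum_nonneg fun _ _ => by positivity
  have hP := H.two_le_radius
  have hh : (1 : ℝ) ≤ a.h := by exact_mod_cast H.h_pos
  have hdu : (1 : ℝ) ≤ du := by exact_mod_cast H.du_pos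
  have h1 := a.epoch_bounds H.h_pos (hr.trans hrs)
  have hes : 1 ≤ a.epoch s := by simp [epoch]
  have hreg := a.coins_sum_norm_play_sub_sq_le S H.h_pos hp hp1 hα hαR H.z0_mem
    (T := T) (τ₁ := a.epoch r) (τ₂ := a.epoch s - 1)
    (fun b e τ h2 h3 hb z hz => H.norm_sub_est_le b e h2
      (lt_of_le_of_lt (Nat.mul_le_mul_right _ h3) (by omega)) hb hz)
    (H.adm.avgMarkov_mem a.h hr hrs hs) (by simp [epoch]) (by omega)
  rw [Finset.sum_sub_distrib] at hreg
  set Reg := ((Nat.log 2 (a.epoch s - 1) + 1 : ℕ) : ℝ) *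
    ((3 * Real.log (T + 1) + 1) * (a.estRadius ^ 2 / a.p)) with hReg
  have hends : ∑ τ ∈ Icc (a.epoch r) (a.epoch s - 1), ‖Z - S.markovVec a.h (τ * a.h)‖ ^ 2 ≤ W :=
    a.sum_epoch_end_le H.h_pos (f := fun t => ‖Z - S.markovVec a.h t‖ ^ 2)
      (fun _ => by positivity) hr hrs
  have hlogT : 0 ≤ Real.log T := Real.log_nonneg (by exact_mod_cast H.T_pos)
  have hT0 : (2 : ℝ) ≤ T := by exact_mod_cast hT2
  have hRegle : Reg ≤ 72 * Λ ^ 3 * a.radius ^ 6 * du ^ 2 / a.p := by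
    have l1 : ((Nat.log 2 (a.epoch s - 1) + 1 : ℕ) : ℝ) ≤ 2 * Λ := by
      have h2 : a.epoch s - 1 ≤ T := by
        have : (a.epoch s - 1) * 1 ≤ (a.epoch s - 1) * a.h := Nat.mul_le_mul_left _ H.h_pos
        omega
      have h3 : Nat.log 2 (a.epoch s - 1) ≤ Nat.log 2 T := Nat.log_mono_right h2
      have h4 : ((Nat.log 2 T : ℕ) : ℝ) ≤ Real.logb 2 T := by
        exact_mod_cast Real.natLog_le_logb T 2
      have h5 : Real.logb 2 T ≤ 2 * Real.log T := by
        rw [Real.logb, div_le_iff₀ (Real.log_pos (by norm_num))]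
        have := Real.log_two_gt_d9
        nlinarith
      have h6 : ((Nat.log 2 (a.epoch s - 1) : ℕ) : ℝ) ≤ Nat.log 2 T := by exact_mod_cast h3
      push_cast
      linarith
    have l2 : 3 * Real.log (T + 1) + 1 ≤ 4 * Λ := by
      have h2 : Real.log (T + 1) ≤ Real.log T + 1 := by
        have h3 : Real.log (T + 1) ≤ Real.log (2 * T) :=
          Real.log_le_log (by positivity) (by linarith)
        rw [Real.log_mul (by norm_num) (by linarith)] at h3
        have := Real.log_two_lt_d9
        linarith
      linarith
    have l3 : a.estRadius ^ 2 / a.p ≤ 9 * Λ * du ^ 2 * a.radius ^ 6 / a.p := by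
      gcongr
      refine H.estRadius_sq_le.trans ?_
      gcongr
    have l4 : 0 ≤ 3 * Real.log (T + 1) + 1 := by
      have := Real.log_nonneg (show (1 : ℝ) ≤ T + 1 by linarith)
      linarith
    have hΛ0 : 0 ≤ Λ := by linarith
    calc Reg ≤ (2 * Λ) * ((4 * Λ) * (9 * Λ * du ^ 2 * a.radius ^ 6 / a.p)) := by
          rw [hReg]
          gcongr
      _ = _ := by ring
  have hmain := coins_mono (a := a) (T := T) hp.le hp1
    fun b e => H.sum_norm_gh_sub_sq_le b e hr hrs hs
  refine hmain.trans ?_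
  rw [coins_add, coins_const_mul, coins_add, coins_const_mul, coins_const, coins_const, coins_sum]
  have hexp : ∀ τ, a.coins T (fun b e =>
      ‖(a.preds S b e τ).play τ - S.markovVec a.h (τ * a.h)‖ ^ 2 +
        ‖Z - S.markovVec a.h (τ * a.h)‖ ^ 2) = a.coins T (fun b e =>
      ‖(a.preds S b e τ).play τ - S.markovVec a.h (τ * a.h)‖ ^ 2) +
        ‖Z - S.markovVec a.h (τ * a.h)‖ ^ 2 := by
    intro τ
    rw [coins_add, coins_const]
  rw [Finset.sum_congr rfl fun τ _ => hexp τ, Finset.sum_add_distrib]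
  have hpinv : 1 ≤ 1 / a.p := by rw [le_div_iff₀ hp]; linarith
  have hΛ1 : 1 ≤ Λ := by linarith
  have k1 : (a.h : ℝ) * (3 * (∑ τ ∈ Icc (a.epoch r) (a.epoch s - 1), a.coins T (fun b e =>
      ‖(a.preds S b e τ).play τ - S.markovVec a.h (τ * a.h)‖ ^ 2) +
        ∑ τ ∈ Icc (a.epoch r) (a.epoch s - 1), ‖Z - S.markovVec a.h (τ * a.h)‖ ^ 2) +
          4 * du * a.radius ^ 2) ≤
      Λ * (3 * (2 * W + 72 * Λ ^ 3 * a.radius ^ 6 * du ^ 2 / a.p) + 4 * du * a.radius ^ 2) := by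
    have h2 : 0 ≤ 3 * (2 * W + 72 * Λ ^ 3 * a.radius ^ 6 * du ^ 2 / a.p) +
        4 * du * a.radius ^ 2 := by positivity
    refine le_trans (mul_le_mul_of_nonneg_left ?_ (by linarith))
      (mul_le_mul_of_nonneg_right hΛh h2)
    linarith
  have k2 : 4 * (du : ℝ) * a.radius ^ 2 ≤ 4 * (Λ ^ 3 * a.radius ^ 6 * du ^ 2 / a.p) := by
    have : (1 : ℝ) * a.radius ^ 2 * du * 1 ≤ Λ ^ 3 * a.radius ^ 6 * du ^ 2 * (1 / a.p) := by
      gcongr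
      · exact one_le_pow₀ hΛ1
      · linarith
      · norm_num
      · exact le_self_pow₀ hdu (by norm_num)
    calc _ = 4 * ((1 : ℝ) * a.radius ^ 2 * du * 1) := by ring
      _ ≤ 4 * (Λ ^ 3 * a.radius ^ 6 * du ^ 2 * (1 / a.p)) := by gcongr
      _ = _ := by ring
  have k3 : 3 * W ≤ 3 * (Λ * W) := by
    have := le_mul_of_one_le_left hW0 hΛ1
    linarith
  have k4 : Λ * W ≤ Λ * (#(Icc r s) * S.variability r s) := by gcongr
  have k5 : Λ * (4 * (du : ℝ) * a.radius ^ 2) ≤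
      Λ * (4 * (Λ ^ 3 * a.radius ^ 6 * du ^ 2 / a.p)) := by gcongr
  have k6 : 220 * Λ ^ 4 * a.radius ^ 6 * (du : ℝ) ^ 2 / a.p =
    Λ * (3 * (72 * Λ ^ 3 * a.radius ^ 6 * du ^ 2 / a.p)) +
      Λ * (4 * (Λ ^ 3 * a.radius ^ 6 * du ^ 2 / a.p)) := by ring
  rw [k6]
  linarith

/-- The inequality `y ≤ lam + y ^ 2 / lam` replaces Cauchy–Schwarz and keeps everything linear in
the expectation; `lam` is chosen afterwards. -/
lemma coins_sum_predErr_le (hp : 0 < a.p) (hp1 : a.p ≤ 1) {r s : ℕ} {lam : ℝ} (hlam : 0 < lam) :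
    a.coins T (fun b e => ∑ t ∈ Icc r s, a.predErr S b e t) ≤
      a.h * ((#(Icc r s) : ℝ) * lam + lam⁻¹ * a.coins T (fun b e =>
        ∑ t ∈ Icc r s, ‖a.gh S b e t - S.markovVec a.h t‖ ^ 2)) := by
  have hh : (1 : ℝ) ≤ a.h := by exact_mod_cast H.h_pos
  have hpt : ∀ b e, ∑ t ∈ Icc r s, a.predErr S b e t ≤
      a.h * ((#(Icc r s) : ℝ) * lam) + a.h * lam⁻¹ *
        ∑ t ∈ Icc r s, ‖a.gh S b e t - S.markovVec a.h t‖ ^ 2 := by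
    intro b e
    have : ∀ t ∈ Icc r s, a.predErr S b e t ≤ a.h * lam + a.h * lam⁻¹ *
        ‖a.gh S b e t - S.markovVec a.h t‖ ^ 2 := by
      intro t _
      refine (predErr_le_norm b e t).trans ?_
      set y := ‖a.gh S b e t - S.markovVec a.h t‖
      have hy0 : 0 ≤ y := norm_nonneg _
      have h1 : √(a.h : ℝ) ≤ a.h := by
        rw [Real.sqrt_le_left (by linarith)]; nlinarith
      have h2 : y ≤ lam + lam⁻¹ * y ^ 2 := by
        have h3 : lam⁻¹ * (lam * y) = y := by field_simp
        have h4 : lam⁻¹ * (lam * lam) = lam := by field_simp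
        have h5 : lam * y ≤ lam * lam + y ^ 2 := by nlinarith [sq_nonneg (lam - y)]
        have h6 := mul_le_mul_of_nonneg_left h5 (inv_pos.2 hlam).le
        linarith
      calc _ ≤ a.h * (lam + lam⁻¹ * y ^ 2) := by gcongr
        _ = _ := by ring
    refine (Finset.sum_le_sum this).trans (le_of_eq ?_)
    rw [Finset.sum_add_distrib, Finset.sum_const, nsmul_eq_mul, Finset.mul_sum]
    ring
  have h1 := coins_mono (T := T) hp.le hp1 hpt
  rw [coins_add, coins_const, coins_const_mul] at h1
  refine h1.trans (le_of_eq ?_)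
  ring

omit H in
-- The weight `v + d * p` dominates both of its summands: dividing `n * v ^ 2` by `v` leaves `n *
-- v`, and dividing `d ^ 2 / p` by `d * p` leaves `d / p ^ 2 = d * Q`. The term `d * p` also covers
-- the case `v = 0`.
lemma weighted_error_le {n v d p Q Λ K E : ℝ} (hn : 0 ≤ n) (hv : 0 ≤ v) (hd : 0 < d)
    (hp : 0 < p) (hQ : 0 ≤ Q) (hQp : Q * p ^ 2 = 1) (hnQ : n * p ≤ Q) (hΛK : Λ ≤ K)
    (hK : 1 ≤ K) (hE : E ≤ 9 * Λ * (n * (v * v)) + 220 * K * d ^ 2 / p) :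
    n * (v + d * p) + (v + d * p)⁻¹ * E ≤ 221 * (K * (n * v + d * Q)) := by
  have hlam : 0 < v + d * p := by positivity
  have h1 : (v + d * p)⁻¹ * E ≤ 9 * K * (n * v) + 220 * K * (d * Q) := by
    rw [inv_mul_le_iff₀ hlam]
    refine hE.trans ?_
    have h3 : 220 * K * d ^ 2 / p = (d * p) * (220 * K * (d * Q)) := by
      rw [div_eq_iff hp.ne']
      linear_combination (-220 * K * d ^ 2) * hQp
    have h4 : 0 ≤ (d * p) * (9 * K * (n * v)) := by positivity
    have h5 : 0 ≤ v * (220 * K * (d * Q)) := by positivity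
    have h6 : 9 * Λ * (n * (v * v)) ≤ 9 * K * (n * (v * v)) := by gcongr
    rw [h3]
    linarith
  have h2 : n * (v + d * p) ≤ n * v + d * Q := by
    have := mul_le_mul_of_nonneg_left hnQ hd.le
    linarith
  have hX0 : 0 ≤ n * v + d * Q := by positivity
  have h3 : n * v + d * Q ≤ K * (n * v + d * Q) := le_mul_of_one_le_left hX0 hK
  have h4 : 0 ≤ K * (n * v) := by positivity
  linarith

lemma coins_sum_explored_le (hp : 0 < a.p) {r s : ℕ} (hr : 1 ≤ r) (hs : s ≤ T) :
    a.coins T (fun b _ => ∑ t ∈ Icc r s, a.explored b t) ≤ 2 * (T * a.p) := by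
  have hnT := H.card_Icc_le hr hs
  rw [coins_sum]
  -- In the first epoch the preceding index is 0; its coin is not used by the algorithm but has the
  -- same success probability.
  have : ∀ t ∈ Icc r s, a.coins T (fun b _ => a.explored b t) = 2 * a.p := by
    intro t _
    unfold explored
    rw [coins_add, coins_coin, coins_coin]; ring
  rw [Finset.sum_congr rfl this, Finset.sum_const, nsmul_eq_mul]
  have := mul_le_mul_of_nonneg_right hnT hp.le
  linarith

/-- The regret bound for a fixed environment. -/
lemma expRegret_le (hp : 0 < a.p) (hp1 : a.p ≤ 1) (hpT : a.p ^ 3 * T = 1) (hα : 0 < a.α)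
    (hαR : a.α * a.estRadius ^ 2 = a.p) {Λ : ℝ} (hΛh : (a.h : ℝ) ≤ Λ)
    (hΛT : 1 + Real.log T ≤ Λ) (hT2 : 2 ≤ T) {r s : ℕ} (hr : 1 ≤ r) (hrs : r ≤ s)
    (hs : s ≤ T) :
    a.expRegret S T r s ≤ 10 ^ 6 * a.radius ^ 16 * Λ ^ 7 *
      (L * m * (#(Icc r s) * √(S.variability r s) + du * (T * a.p))) := by
  have hP := H.two_le_radius
  have hL := H.L_pos
  have hh : (1 : ℝ) ≤ a.h := by exact_mod_cast H.h_pos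
  have hdu : (1 : ℝ) ≤ du := by exact_mod_cast H.du_pos
  have hm : (1 : ℝ) ≤ m := by exact_mod_cast H.m_pos
  have hT0 : (2 : ℝ) ≤ T := by exact_mod_cast hT2
  have hΛ1 : 1 ≤ Λ := by linarith
  set n : ℝ := (#(Icc r s) : ℝ) with hn
  have hnT : n ≤ T := H.card_Icc_le hr hs
  have hn0 : 0 ≤ n := by positivity
  set v := √(S.variability r s) with hv
  have hv0 : 0 ≤ v := Real.sqrt_nonneg _
  have hvv : v * v = S.variability r s := Real.mul_self_sqrt (S.variability_nonneg r s)
  -- As `p ^ 3 * T = 1`, this is both the exploration cost `T * p` and the estimation cost `1 / p ^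
  -- 2`, and it dominates √T.
  set Q := T * a.p with hQ
  have hQp : Q * a.p ^ 2 = 1 := by rw [hQ, ← hpT]; ring
  have hQ1 : 1 ≤ Q := by
    have : a.p ^ 2 ≤ 1 := pow_le_one₀ hp.le hp1
    have hQ0 : 0 < Q := by positivity
    nlinarith
  have hqQ : √(T : ℝ) ≤ Q := by
    rw [Real.sqrt_le_left (by linarith)]
    have h1 : Q ^ 2 * a.p = T := by
      have : Q ^ 2 * a.p = (Q * a.p ^ 2) * T := by rw [hQ]; ring
      rw [this, hQp, one_mul]
    nlinarith [sq_nonneg Q]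
  set lam := v + du * a.p with hlam
  have hlam0 : 0 < lam := by positivity
  set X := n * v + du * Q with hX
  have hX1 : du * Q ≤ X := by
    have : 0 ≤ n * v := by positivity
    linarith
  have hduQ : 1 ≤ du * Q := by nlinarith
  -- the errors of the operator estimates
  have hsq := H.coins_sum_norm_gh_sub_sq_le hp hp1 hα hαR hΛh hΛT hT2 hr hrs hs
  rw [← hn, ← hvv] at hsq
  have hpe : a.coins T (fun b e => ∑ t ∈ Icc r s, a.predErr S b e t) ≤
      221 * Λ ^ 5 * a.radius ^ 6 * X := by
    refine (H.coins_sum_predErr_le hp hp1 hlam0).trans ?_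
    have hΛ4 : Λ * 1 ≤ Λ ^ 4 * a.radius ^ 6 := by
      gcongr
      · exact le_self_pow₀ hΛ1 (by norm_num)
      · exact one_le_pow₀ (by linarith)
    have hnQ : n * a.p ≤ Q := by rw [hQ]; gcongr
    have h1 := weighted_error_le (Λ := Λ) (K := Λ ^ 4 * a.radius ^ 6) hn0 hv0 (by linarith : (0 : ℝ) < du) hp (by linarith) hQp hnQ
      (by linarith) (by linarith) (hsq.trans_eq (by ring))
    rw [← hlam, ← hX] at h1
    have hX0 : 0 ≤ X := by linarith
    calc _ ≤ a.h * (221 * (Λ ^ 4 * a.radius ^ 6 * X)) :=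
          mul_le_mul_of_nonneg_left h1 (by positivity)
      _ ≤ Λ * (221 * (Λ ^ 4 * a.radius ^ 6 * X)) := by gcongr
      _ = _ := by ring
  have hex := H.coins_sum_explored_le hp hr hs
  rw [← hQ] at hex
  -- assembling
  have hreg : ∀ b e, a.regret S T r s b e ≤ 2520 * L * a.radius ^ 10 * (a.h : ℝ) ^ 2 *
      (∑ t ∈ Icc r s, a.predErr S b e t + du * ∑ t ∈ Icc r s, a.explored b t +
        (2 * a.radius + m * du * √(T : ℝ))) := by
    intro b e
    refine (H.regret_le b e hr hrs hs).trans ?_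
    refine mul_le_mul_of_nonneg_left ?_ (by positivity)
    -- The regret involves the operator error one round earlier; the shift costs one boundary term.
    have := sum_Icc_sub_le (f := a.predErr S b e) (s := s) (B := 2 * a.radius)
      (fun t _ => a.predErr_nonneg S b e t) (fun t ht => H.predErr_le b e (ht.trans hs)) hr 1
    push_cast at this
    linarith
  rw [expRegret_eq]
  refine (coins_mono hp.le hp1 hreg).trans ?_
  rw [coins_const_mul, coins_add, coins_add, coins_const, coins_const_mul]
  set Y := Λ ^ 5 * a.radius ^ 6 * (m * X) with hY
  have hX0 : 0 ≤ X := by linarith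
  have hΛ5 : 1 ≤ Λ ^ 5 := one_le_pow₀ hΛ1
  have hP6 : 1 ≤ a.radius ^ 6 := one_le_pow₀ (by linarith)
  have y1 : Λ ^ 5 * a.radius ^ 6 * X ≤ Y := by
    rw [hY]
    gcongr
    exact le_mul_of_one_le_left hX0 hm
  have y2 : a.radius ≤ Y := by
    have : 1 * a.radius * (1 * 1) ≤ Y := by
      rw [hY]
      gcongr
      · exact le_self_pow₀ (by linarith) (by norm_num)
      · linarith
    linarith
  have y3 : m * X ≤ Y := by
    have : 1 * 1 * (m * X) ≤ Y := by rw [hY]; gcongr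
    linarith
  have y4 : (m : ℝ) * du * √(T : ℝ) ≤ Y := by
    have : (m : ℝ) * (du * √(T : ℝ)) ≤ m * X := by
      gcongr
      refine le_trans ?_ hX1
      gcongr
    linarith
  have y5 : (du : ℝ) * a.coins T (fun b _ => ∑ t ∈ Icc r s, a.explored b t) ≤ 2 * Y := by
    have h1 := mul_le_mul_of_nonneg_left hex (by positivity : (0 : ℝ) ≤ du)
    have h2 : X ≤ m * X := le_mul_of_one_le_left hX0 hm
    linarith
  have hY0 : 0 ≤ Y := by positivity
  calc _ ≤ 2520 * L * a.radius ^ 10 * (a.h : ℝ) ^ 2 * (226 * Y) :=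
        mul_le_mul_of_nonneg_left (by linarith) (by positivity)
    _ ≤ 2520 * L * a.radius ^ 10 * Λ ^ 2 * (226 * Y) := by gcongr
    _ = 569520 * (a.radius ^ 16 * Λ ^ 7 * (L * m * X)) := by rw [hY]; ring
    _ ≤ 10 ^ 6 * (a.radius ^ 16 * Λ ^ 7 * (L * m * X)) := by gcongr; norm_num
    _ = _ := by ring

end Setting

end AdaCtrl

/-! ### Bounds and measurability for a random environment -/

namespace LTV

variable {dx du : ℕ} {S : LTV dx du} {T : ℕ} {L Rnat RG ρ : ℝ}

lemma Admissible.abs_markov_le (hS : S.Admissible T L Rnat RG ρ) {t : ℕ} (ht : t ∈ Icc 1 T)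
    (hRG : 0 ≤ RG) (i : ℕ) (j : Fin dx) (k : Fin du) : |S.markov t i j k| ≤ du * RG := by
  have hdu : (1 : ℝ) ≤ du := by exact_mod_cast k.pos
  have h1 : opNorm (S.markov t i) ≤ RG :=
    le_trans (Finset.single_le_sum (f := fun i => opNorm (S.markov t i))
      (fun _ _ => opNorm_nonneg _) (Finset.mem_range.2 (Nat.lt_succ_self i)))
      (hS.sum_markov_le ht (i + 1))
  have h2 : S.markov t i j k ^ 2 ≤ ∑ j, ∑ k, S.markov t i j k ^ 2 :=
    le_trans (Finset.single_le_sum (f := fun k => S.markov t i j k ^ 2)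
      (fun _ _ => sq_nonneg _) (Finset.mem_univ k))
      (Finset.single_le_sum (f := fun j => ∑ k, S.markov t i j k ^ 2)
        (fun _ _ => by positivity) (Finset.mem_univ j))
  have h3 := h2.trans (frobenius_sq_le_card_right (S.markov t i))
  refine abs_le_of_sq_le_sq (h3.trans ?_) (by positivity)
  have h4 := opNorm_nonneg (S.markov t i)
  calc (du : ℝ) * opNorm (S.markov t i) ^ 2 ≤ (du * du) * RG ^ 2 := by
        gcongr
        exact le_mul_of_one_le_left (by linarith) hdu
    _ = _ := by ring

/-- A crude entrywise bound that serves only to make the variability integrable; its size does not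
enter the regret bound. -/
lemma Admissible.variability_le (hS : S.Admissible T L Rnat RG ρ) (hRG : 0 ≤ RG) {r s : ℕ}
    (hr : 1 ≤ r) (hrs : r ≤ s) (hs : s ≤ T) :
    S.variability r s ≤ s * (dx * (du * (2 * (du * RG)) ^ 2)) := by
  have hpos : (0 : ℝ) < #(Icc r s) := by
    rw [Nat.cast_pos, Finset.card_pos]; exact ⟨r, by simp [hrs]⟩
  have hmem : ∀ t ∈ Icc r s, t ∈ Icc 1 T := fun t ht => by
    rw [Finset.mem_Icc] at ht ⊢; omega
  rw [variability, inv_mul_le_iff₀ hpos, ← nsmul_eq_mul]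
  refine Finset.sum_le_card_nsmul _ _ _ fun t ht => ?_
  have hent : ∀ i (j : Fin dx) (k : Fin du),
      ((#(Icc r s) : ℝ)⁻¹ * (∑ t' ∈ Icc r s, S.markov t' i j k) - S.markov t i j k) ^ 2 ≤
        (2 * (du * RG)) ^ 2 := by
    intro i j k
    rw [sq_le_sq, abs_of_nonneg (by positivity : 0 ≤ 2 * (du * RG))]
    have h1 : |∑ t' ∈ Icc r s, S.markov t' i j k| ≤ #(Icc r s) * (du * RG) := by
      rw [← nsmul_eq_mul]
      exact (Finset.abs_sum_le_sum_abs _ _).trans (Finset.sum_le_card_nsmul _ _ _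
        fun t' ht' => hS.abs_markov_le (hmem t' ht') hRG i j k)
    have h2 : |(#(Icc r s) : ℝ)⁻¹ * (∑ t' ∈ Icc r s, S.markov t' i j k)| ≤ du * RG := by
      rwa [abs_mul, abs_of_pos (inv_pos.2 hpos), inv_mul_le_iff₀ hpos]
    have h3 := hS.abs_markov_le (hmem t ht) hRG i j k
    exact (abs_sub _ _).trans (by linarith)
  calc _ ≤ ∑ _i ∈ range s, ∑ _j : Fin dx, ∑ _k : Fin du, (2 * ((du : ℝ) * RG)) ^ 2 :=
        Finset.sum_le_sum fun i _ => Finset.sum_le_sum fun j _ => Finset.sum_le_sum fun k _ =>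
          hent i j k
    _ = _ := by simp

section Measurability

variable {Ω : Type*} [MeasurableSpace Ω] {S : Ω → LTV dx du}

lemma measurable_Phi (hA : ∀ t i j, Measurable fun ω => (S ω).A t i j) (t n : ℕ)
    (i j : Fin dx) : Measurable fun ω => (S ω).Phi t n i j := by
  induction n generalizing i j with
  | zero => exact measurable_const
  | succ n ih =>
    simp only [Phi, Matrix.mul_apply]
    exact Finset.measurable_sum _ fun k _ => (ih i k).mul (hA _ k j)

lemma measurable_markov (hA : ∀ t i j, Measurable fun ω => (S ω).A t i j)
    (hB : ∀ t i j, Measurable fun ω => (S ω).B t i j) (t n : ℕ) (i : Fin dx) (j : Fin du) :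
    Measurable fun ω => (S ω).markov t n i j := by
  by_cases h : n < t
  · simp only [markov, if_pos h, Matrix.mul_apply]
    exact Finset.measurable_sum _ fun k _ => (measurable_Phi hA t n i k).mul (hB _ k j)
  · simp only [markov, if_neg h]
    exact measurable_const

lemma measurable_variability (hA : ∀ t i j, Measurable fun ω => (S ω).A t i j)
    (hB : ∀ t i j, Measurable fun ω => (S ω).B t i j) (r s : ℕ) :
    Measurable fun ω => (S ω).variability r s := by
  refine Measurable.const_mul ?_ _
  refine Finset.measurable_sum _ fun t _ => Finset.measurable_sum _ fun i _ =>
    Finset.measurable_sum _ fun j _ => Finset.measurable_sum _ fun k _ => ?_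
  exact (((Finset.measurable_sum _ fun t' _ => measurable_markov hA hB t' i j k).const_mul _).sub
    (measurable_markov hA hB t i j k)).pow_const 2

end Measurability

end LTV

namespace AdaCtrl

variable {dx du m : ℕ}

namespace Setting

variable {a : AdaCtrl dx du m} {S : LTV dx du} {T : ℕ} {L ρ : ℝ} (H : a.Setting S T L ρ)
include H

/-- The incurred costs are nonnegative, and the infimum is at most the cost of the single policy
`M1`. A lower bound is needed only for integrability. -/
lemma neg_le_expRegret (hp : 0 ≤ a.p) (hp1 : a.p ≤ 1) {r s : ℕ} (hr : 1 ≤ r) (hs : s ≤ T) :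
    -(#(Icc r s) * (L * (1 + ((a.radius + a.radius ^ 3) ^ 2 + (a.radius ^ 2) ^ 2)))) ≤
      a.expRegret S T r s := by
  have hL := H.L_pos
  have hmem : ∀ t ∈ Icc r s, t ∈ Icc 1 T := fun t ht => by
    rw [Finset.mem_Icc] at ht ⊢; omega
  set K := L * (1 + ((a.radius + a.radius ^ 3) ^ 2 + (a.radius ^ 2) ^ 2)) with hK
  have hM1 : S.drcCost a.M1 r s ≤ #(Icc r s) * K := by
    rw [← nsmul_eq_mul]
    refine Finset.sum_le_card_nsmul _ _ _ fun t ht => ?_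
    refine (H.adm.cost_le t (hmem t ht) _ _).trans (mul_le_mul_of_nonneg_left ?_ hL.le)
    have h1 := H.norm_state_drcInput_le H.M1_mem (hmem t ht)
    have h2 := H.norm_drcInput_xnat_le H.M1_mem (Finset.mem_Icc.1 (hmem t ht)).2
    have h3 : 0 ≤ (a.radius + a.radius ^ 3) ^ 2 + (a.radius ^ 2) ^ 2 := by positivity
    refine max_le (by linarith) ?_
    refine le_trans (b := (a.radius + a.radius ^ 3) ^ 2 + (a.radius ^ 2) ^ 2) ?_ (by linarith)
    gcongr
  have hreg : ∀ b e, -(#(Icc r s) * K) ≤ a.regret S T r s b e := by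
    intro b e
    have h1 : ⨅ M : opBall m du dx a.RM, S.drcCost (M : OpSeq m du dx) r s ≤
        S.drcCost a.M1 r s := by
      refine ciInf_le ⟨0, ?_⟩ (⟨a.M1, H.M1_mem⟩ : opBall m du dx a.RM)
      rintro _ ⟨M, rfl⟩
      exact Finset.sum_nonneg fun t ht => H.adm.cost_nonneg t (hmem t ht) _ _
    have h2 : 0 ≤ ∑ t ∈ Icc r s, S.c t ((a.run S b e T).x t) ((a.run S b e T).u t) :=
      Finset.sum_nonneg fun t ht => H.adm.cost_nonneg t (hmem t ht) _ _
    rw [regret]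
    linarith
  rw [expRegret_eq, ← coins_const (a := a) (T := T) (-(#(Icc r s) * K))]
  exact coins_mono hp hp1 hreg

end Setting

/-! ### The tuned parameters meet the requirements of the analysis -/

section Tuned

variable {T : ℕ} {L Rnat RG RM ρ : ℝ} {M1 : OpSeq m du dx}
  {z0 : ℕ → OpSeq (epochLength T ρ) dx du}
  {sg : ℕ → (OpSeq m du dx → ℝ) → OpSeq m du dx → OpSeq m du dx}

lemma log_inv_pos (hρ : 0 < ρ) (hρ1 : ρ < 1) : 0 < Real.log ρ⁻¹ :=
  Real.log_pos ((one_lt_inv₀ hρ).2 hρ1)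

lemma epochLength_pos (hT : 2 ≤ T) (hρ : 0 < ρ) (hρ1 : ρ < 1) : 0 < epochLength T ρ := by
  rw [epochLength, Nat.ceil_pos]
  exact div_pos (Real.log_pos (by exact_mod_cast hT)) (log_inv_pos hρ hρ1)

lemma pow_epochLength_le (hT : 2 ≤ T) (hρ : 0 < ρ) (hρ1 : ρ < 1) :
    ρ ^ epochLength T ρ ≤ 1 / T := by
  have hT0 : (0 : ℝ) < T := by exact_mod_cast (by omega : 0 < T)
  have h1 : Real.log T ≤ epochLength T ρ * Real.log ρ⁻¹ := by
    rw [← div_le_iff₀ (log_inv_pos hρ hρ1)]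
    exact Nat.le_ceil _
  rw [← Real.log_le_log_iff (by positivity) (by positivity), Real.log_pow, one_div, Real.log_inv]
  rw [Real.log_inv] at h1
  linarith

lemma epochLength_le (hT : 2 ≤ T) (hρ : 0 < ρ) (hρ1 : ρ < 1) :
    (epochLength T ρ : ℝ) ≤ 1 + Real.log T + Real.log T / Real.log ρ⁻¹ := by
  have h1 : 0 ≤ Real.log T := Real.log_nonneg (by exact_mod_cast (by omega : 1 ≤ T))
  have := (Nat.ceil_lt_add_one (div_nonneg h1 (log_inv_pos hρ hρ1).le)).le
  rw [epochLength]
  linarith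

/-- The exact power of `h + 1` in the stepsize is immaterial: the lower bound keeps the steps small,
and the upper bound costs only `h ^ 2` in the regret. -/
lemma stepsize_pow_le {x : ℝ} (hx : 1 ≤ x) :
    1 ≤ (x + 1) ^ (5 / 4 : ℝ) ∧ (x + 1) ^ (5 / 4 : ℝ) ≤ 4 * x ^ 2 := by
  refine ⟨Real.one_le_rpow (by linarith) (by norm_num), ?_⟩
  calc (x + 1) ^ (5 / 4 : ℝ) ≤ (x + 1) ^ (2 : ℝ) :=
        Real.rpow_le_rpow_of_exponent_le (by linarith) (by norm_num)
    _ = (x + 1) ^ 2 := Real.rpow_two _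
    _ ≤ (2 * x) ^ 2 := by gcongr; linarith
    _ = _ := by ring

lemma tuned_setting (hdx : 0 < dx) (hdu : 0 < du) (hm : 1 ≤ m) (hT : 2 ≤ T) (hL : 0 < L)
    (hRnat : 0 < Rnat) (hRG : 1 ≤ RG) (hRM : 0 < RM) (hρ : 0 < ρ) (hρ1 : ρ < 1)
    (hM1 : M1 ∈ opBall m du dx RM) (hz0 : ∀ i, z0 i ∈ opBall (epochLength T ρ) dx du RG)
    (hsg : ∀ t f, ConvexOn ℝ Set.univ f → ∀ M, IsSubgradient f M (sg t f M)) {S : LTV dx du}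
    (hS : S.Admissible T L Rnat RG ρ) : (tuned T L Rnat RG RM ρ M1 z0 sg).Setting S T L ρ := by
  have hT0 : (0 : ℝ) < T := by exact_mod_cast (by omega : 0 < T)
  have hh := epochLength_pos hT hρ hρ1
  have hh1 : (1 : ℝ) ≤ epochLength T ρ := by exact_mod_cast hh
  obtain ⟨hE1, hE2⟩ := stepsize_pow_le hh1
  have hD1 : 1 ≤ √((min dx du : ℕ) : ℝ) := by
    rw [Real.one_le_sqrt]; exact_mod_cast (by omega : 1 ≤ min dx du)
  have hDd : √((min dx du : ℕ) : ℝ) ≤ √(du : ℝ) :=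
    Real.sqrt_le_sqrt (by exact_mod_cast min_le_right dx du)
  have hq : 0 < √(T : ℝ) := Real.sqrt_pos.2 hT0
  have hRG0 : 0 < RG := by linarith
  refine ⟨hS, hL, hRnat, hRG, hRM, hρ, hdu, hm, by omega, hh, pow_epochLength_le hT hρ hρ1, hM1,
    hz0, hsg, ?_, ?_, ?_⟩
  all_goals
    simp only [tuned, radius]
    set D := √((min dx du : ℕ) : ℝ)
    set E := ((epochLength T ρ : ℝ) + 1) ^ (5 / 4 : ℝ)
    set q := √(T : ℝ)
  · positivity
  -- The factor `RM ^ 2` in the numerator cancels against the squared system radius, leaving only `D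
  -- / E`.
  · have : D * RM ^ 2 / (2 * L * (RG * RM * Rnat) ^ 2 * E * q) *
        (2 * L * RG ^ 2 * Rnat ^ 2 * q) = D / E := by
      field_simp
    rw [this]
    exact (div_le_self (by positivity) hE1).trans hDd
  · set P := 1 + Rnat + RG + RM with hP
    have : D * RM ^ 2 / (2 * L * (RG * RM * Rnat) ^ 2 * E * q) *
        (8 * L * P ^ 4 * (epochLength T ρ : ℝ) ^ 2 * q) =
        D * (P ^ 4 * (4 * (epochLength T ρ : ℝ) ^ 2)) / (RG ^ 2 * Rnat ^ 2 * E) := by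
      field_simp; ring
    rw [this, one_le_div (by positivity)]
    have h1 : RG ≤ P := by linarith
    have h2 : Rnat ≤ P := by linarith
    calc RG ^ 2 * Rnat ^ 2 * E ≤ P ^ 2 * P ^ 2 * (4 * (epochLength T ρ : ℝ) ^ 2) := by gcongr
      _ = 1 * (P ^ 4 * (4 * (epochLength T ρ : ℝ) ^ 2)) := by ring
      _ ≤ _ := by gcongr

lemma tuned_p_pos (hT : 2 ≤ T) : 0 < (tuned T L Rnat RG RM ρ M1 z0 sg).p :=
  Real.rpow_pos_of_pos (by exact_mod_cast (by omega : 0 < T)) _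

lemma tuned_p_le_one (hT : 2 ≤ T) : (tuned T L Rnat RG RM ρ M1 z0 sg).p ≤ 1 :=
  Real.rpow_le_one_of_one_le_of_nonpos (by exact_mod_cast (by omega : 1 ≤ T)) (by norm_num)

lemma tuned_p_pow (hT : 2 ≤ T) : (tuned T L Rnat RG RM ρ M1 z0 sg).p ^ 3 * T = 1 := by
  have hT0 : (0 : ℝ) < T := by exact_mod_cast (by omega : 0 < T)
  change ((T : ℝ) ^ (-(1 / 3) : ℝ)) ^ 3 * T = 1
  rw [← Real.rpow_natCast, ← Real.rpow_mul hT0.le]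
  norm_num
  rw [Real.rpow_neg_one, inv_mul_cancel₀ hT0.ne']

lemma mul_tuned_p (hT : 2 ≤ T) :
    T * (tuned T L Rnat RG RM ρ M1 z0 sg).p = (T : ℝ) ^ (2 / 3 : ℝ) := by
  have hT0 : (0 : ℝ) < T := by exact_mod_cast (by omega : 0 < T)
  change T * (T : ℝ) ^ (-(1 / 3) : ℝ) = _
  nth_rw 1 [← Real.rpow_one (T : ℝ)]
  rw [← Real.rpow_add hT0]
  norm_num

lemma tuned_estRadius_pos (hdx : 0 < dx) (hdu : 0 < du) (hT : 2 ≤ T) (hRnat : 0 < Rnat)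
    (hRG : 1 ≤ RG) (hρ : 0 < ρ) (hρ1 : ρ < 1) :
    0 < (tuned T L Rnat RG RM ρ M1 z0 sg).estRadius := by
  have hh : (0 : ℝ) < epochLength T ρ := by exact_mod_cast epochLength_pos hT hρ hρ1
  have hd : (0 : ℝ) < (min dx du : ℕ) := by exact_mod_cast (by omega : 0 < min dx du)
  have h1 : 0 < √((epochLength T ρ : ℝ) * (min dx du : ℕ)) * RG := by positivity
  have h2 : 0 ≤ √((epochLength T ρ : ℝ) * du) *
      (Rnat + RG * max (√(du : ℝ)) (Rnat * RM)) := by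
    have : 0 ≤ max (√(du : ℝ)) (Rnat * RM) := le_max_of_le_left (Real.sqrt_nonneg _)
    positivity
  exact add_pos_of_pos_of_nonneg h1 h2

lemma tuned_α_eq : (tuned T L Rnat RG RM ρ M1 z0 sg).α =
    (tuned T L Rnat RG RM ρ M1 z0 sg).p / (tuned T L Rnat RG RM ρ M1 z0 sg).estRadius ^ 2 := rfl

end Tuned

end AdaCtrl

/-- Jensen's inequality for the square root. -/
lemma integral_sqrt_le {Ω : Type*} [MeasurableSpace Ω] {μ : Measure Ω} [IsProbabilityMeasure μ]
    {f : Ω → ℝ} (hf : Integrable f μ) (hf0 : ∀ ω, 0 ≤ f ω) :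
    Integrable (fun ω => √(f ω)) μ ∧ ∫ ω, √(f ω) ∂μ ≤ √(∫ ω, f ω ∂μ) := by
  have hint : Integrable (fun ω => √(f ω)) μ := by
    refine ((integrable_const (1 : ℝ)).add hf).mono'
      (Real.continuous_sqrt.comp_aestronglyMeasurable hf.1) (.of_forall fun ω => ?_)
    rw [Real.norm_of_nonneg (Real.sqrt_nonneg _), Pi.add_apply,
      Real.sqrt_le_left (by linarith [hf0 ω])]
    nlinarith [hf0 ω]
  exact ⟨hint, Real.strictConcaveOn_sqrt.concaveOn.le_map_integral
    Real.continuous_sqrt.continuousOn isClosed_Ici (.of_forall hf0) hf hint⟩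

theorem mainTheorem2 :
    ∃ (C : ℝ) (k : ℕ), 0 < C ∧
      ∀ (dx du m T : ℕ) (L Rnat RG RM ρ : ℝ),
        0 < dx → 0 < du → 1 ≤ m → 2 ≤ T → (m : ℝ) ≤ √(T : ℝ) →
        0 < L → 0 < Rnat → 1 ≤ RG → 0 < RM → 0 < ρ → ρ < 1 →
      -- the arbitrary choices of the algorithm
      ∀ (M1 : OpSeq m du dx) (z0 : ℕ → OpSeq (AdaCtrl.epochLength T ρ) dx du)
        (sg : ℕ → (OpSeq m du dx → ℝ) → OpSeq m du dx → OpSeq m du dx),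
        M1 ∈ opBall m du dx RM →
        (∀ i, z0 i ∈ opBall (AdaCtrl.epochLength T ρ) dx du RG) →
        (∀ t f, ConvexOn ℝ Set.univ f → ∀ M, IsSubgradient f M (sg t f M)) →
      -- the oblivious, possibly randomized, environment
      ∀ (Ω : Type*) [MeasurableSpace Ω] (μ : Measure Ω) [IsProbabilityMeasure μ]
        (S : Ω → LTV dx du),
        (∀ t i j, Measurable fun ω => (S ω).A t i j) →
        (∀ t i j, Measurable fun ω => (S ω).B t i j) →
        (∀ᵐ ω ∂μ, (S ω).Admissible T L Rnat RG ρ) →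
      ∀ r s : ℕ, 1 ≤ r → r ≤ s → s ≤ T →
        AEStronglyMeasurable
          (fun ω => (AdaCtrl.tuned T L Rnat RG RM ρ M1 z0 sg).expRegret (S ω) T r s) μ →
        Integrable
          (fun ω => (AdaCtrl.tuned T L Rnat RG RM ρ M1 z0 sg).expRegret (S ω) T r s) μ ∧
        Integrable (fun ω => (S ω).variability r s) μ ∧
        ∫ ω, (AdaCtrl.tuned T L Rnat RG RM ρ M1 z0 sg).expRegret (S ω) T r s ∂μ ≤
          C * (1 + Rnat + RG + RM) ^ k *
            (1 + Real.log T + Real.log T / Real.log ρ⁻¹) ^ k *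
            (L * m * ((#(Icc r s) : ℝ) * √(∫ ω, (S ω).variability r s ∂μ) +
              du * (T : ℝ) ^ (2 / 3 : ℝ))) := by
  -- The bound for a fixed environment has the sixteenth power of the radius and the seventh of the
  -- logarithmic factor; as the latter is at least 1, the exponent 16 serves both.
  refine ⟨10 ^ 6, 16, by norm_num, ?_⟩
  intro dx du m T L Rnat RG RM ρ hdx hdu hm hT _ hL hRnat hRG hRM hρ hρ1 M1 z0 sg hM1 hz0 hsg
    Ω _ μ _ S hA hB hS r s hr hrs hs hmeas
  set a := AdaCtrl.tuned T L Rnat RG RM ρ M1 z0 sg with ha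
  set Λ := 1 + Real.log T + Real.log T / Real.log ρ⁻¹ with hΛ
  set n := (#(Icc r s) : ℝ)
  set V := fun ω => (S ω).variability r s with hV
  have hset : ∀ᵐ ω ∂μ, a.Setting (S ω) T L ρ := hS.mono fun ω h =>
    AdaCtrl.tuned_setting hdx hdu hm hT hL hRnat hRG hRM hρ hρ1 hM1 hz0 hsg h
  have hp : 0 < a.p := AdaCtrl.tuned_p_pos hT
  have hp1 : a.p ≤ 1 := AdaCtrl.tuned_p_le_one hT
  have hpT : a.p ^ 3 * T = 1 := AdaCtrl.tuned_p_pow hT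
  have hTp : T * a.p = (T : ℝ) ^ (2 / 3 : ℝ) := AdaCtrl.mul_tuned_p hT
  have hrad : 0 < a.estRadius := AdaCtrl.tuned_estRadius_pos hdx hdu hT hRnat hRG hρ hρ1
  have hα : a.α = a.p / a.estRadius ^ 2 := AdaCtrl.tuned_α_eq
  have hα0 : 0 < a.α := by rw [hα]; positivity
  have hαR : a.α * a.estRadius ^ 2 = a.p := by rw [hα]; field_simp
  have hh : (a.h : ℝ) ≤ Λ := AdaCtrl.epochLength_le hT hρ hρ1
  have hradius : a.radius = 1 + Rnat + RG + RM := rfl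
  clear_value a
  have hlogT : 0 ≤ Real.log T := Real.log_nonneg (by exact_mod_cast (by omega : 1 ≤ T))
  have hlogρ : 0 ≤ Real.log T / Real.log ρ⁻¹ := div_nonneg hlogT (AdaCtrl.log_inv_pos hρ hρ1).le
  have hΛT : 1 + Real.log T ≤ Λ := le_add_of_nonneg_right hlogρ
  have hΛ1 : 1 ≤ Λ := (le_add_of_nonneg_right hlogT).trans hΛT
  clear_value Λ
  set K := 10 ^ 6 * (1 + Rnat + RG + RM) ^ 16 * Λ ^ 16 with hK
  have hK0 : 0 ≤ K := by positivity
  have hK7 : 10 ^ 6 * (1 + Rnat + RG + RM) ^ 16 * Λ ^ 7 ≤ K := by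
    rw [hK]
    have : Λ ^ 7 ≤ Λ ^ 16 := pow_le_pow_right₀ hΛ1 (by norm_num)
    gcongr
  clear_value K
  have hupper : ∀ᵐ ω ∂μ, a.expRegret (S ω) T r s ≤
      K * (L * m * (n * √(V ω) + du * (T : ℝ) ^ (2 / 3 : ℝ))) := by
    filter_upwards [hset] with ω H
    have h1 := H.expRegret_le hp hp1 hpT hα0 hαR hh hΛT hT hr hrs hs
    rw [hTp, hradius] at h1
    have hX : 0 ≤ L * m * (n * √(V ω) + du * (T : ℝ) ^ (2 / 3 : ℝ)) := by positivity
    exact h1.trans (mul_le_mul_of_nonneg_right hK7 hX)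
  have hVint : Integrable V μ := by
    refine .of_bound (LTV.measurable_variability hA hB r s).aestronglyMeasurable
      (s * (dx * (du * (2 * (du * RG)) ^ 2))) ?_
    filter_upwards [hS] with ω h
    rw [Real.norm_of_nonneg ((S ω).variability_nonneg r s)]
    exact h.variability_le (by linarith) hr hrs hs
  obtain ⟨hsq, hjensen⟩ := integral_sqrt_le hVint fun ω => (S ω).variability_nonneg r s
  have hUint : Integrable (fun ω => K * (L * m * (n * √(V ω) + du * (T : ℝ) ^ (2 / 3 : ℝ)))) μ :=
    (((hsq.const_mul n).add (integrable_const _)).const_mul _).const_mul _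
  -- The expected regret lies between a constant and the integrable upper bound, almost surely.
  have hint : Integrable (fun ω => a.expRegret (S ω) T r s) μ := by
    set c := n * (L * (1 + ((a.radius + a.radius ^ 3) ^ 2 + (a.radius ^ 2) ^ 2)))
    refine (hUint.add (integrable_const |c|)).mono' hmeas ?_
    filter_upwards [hset, hupper] with ω H hu
    have hl : -c ≤ _ := H.neg_le_expRegret hp.le hp1 hr hs
    have h0 : 0 ≤ K * (L * m * (n * √(V ω) + du * (T : ℝ) ^ (2 / 3 : ℝ))) := by positivity
    rw [Pi.add_apply, Real.norm_eq_abs, abs_le]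
    constructor
    · linarith [le_abs_self c]
    · linarith [abs_nonneg c]
  refine ⟨hint, hVint, (integral_mono_ae hint hUint hupper).trans ?_⟩
  rw [integral_const_mul, integral_const_mul, integral_add (hsq.const_mul n) (integrable_const _),
    integral_const_mul, integral_const, probReal_univ, one_smul]
  gcongr

end
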